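/- Let $d\ge 1$ and let $K\subset\mathbb{R}^d$ be a convex body (compact, convex, with non-empty interior) with $C^2$ boundary that slides freely in a closed ball $B$ of some radius $R>0$, i.e. for each $x\in\partial B$ there is $v\in\mathbb{R}^d$ with $x\in K+v\subset B$. Let $r>R$. For $n\in\mathbb{N}$ let $x_1,\dots,x_n$ be i.i.d. uniform random points in $K$, and let $K^r_{(n)}$ be the intersection of all closed balls of radius $r$ that contain $x_1,\dots,x_n$. A facet of $K^r_{(n)}$ is a set $F\subset\partial K^r_{(n)}$ with positive $(d-1)$-dimensional surface measure and of the form $F=K^r_{(n)}\cap\partial B'$, where $B'$ is a closed ball of radius $r$ with $K^r_{(n)}\subset B'$ and $K^r_{(n)}\cap\partial B'\neq\emptyset$. Let $f_{d-1}(K^r_{(n)})$ be the number of facets of $K^r_{(n)}$. Then there are constants $\gamma_1,\gamma_2>0$ and $n_0\in\mathbb{N}$, depending only on $K$, $d$ and $r$, such that for all $n>n_0$ $$\gamma_1\, n^{\frac{d-1}{d+1}}<\mathbb{E}\, f_{d-1}\big(K^r_{(n)}\big)<\gamma_2\, n^{\frac{d-1}{d+1}}.$$ -/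

import Mathlib

open MeasureTheory Set Metric
open scoped ENNReal NNReal

/-- `K ⊆ ℝᵈ` has boundary of class `C²`: near each boundary point `x`, the set `K` is the sublevel
set `{φ ≤ 0}` of a `C²` function `φ` whose differential at `x` does not vanish. -/
def HasC2Boundary {d : ℕ} (K : Set (EuclideanSpace ℝ (Fin d))) : Prop :=
  ∀ x ∈ frontier K, ∃ (U : Set (EuclideanSpace ℝ (Fin d))) (φ : EuclideanSpace ℝ (Fin d) → ℝ),
    IsOpen U ∧ x ∈ U ∧ ContDiffOn ℝ 2 φ U ∧ fderiv ℝ φ x ≠ 0 ∧ K ∩ U = {y ∈ U | φ y ≤ 0}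

/-- `K` slides freely in `B`: for each boundary point `x` of `B` there is a vector `v` with
`x ∈ K + v ⊆ B`. -/
def SlidesFreelyIn {d : ℕ} (K B : Set (EuclideanSpace ℝ (Fin d))) : Prop :=
  ∀ x ∈ frontier B, ∃ v : EuclideanSpace ℝ (Fin d),
    x ∈ (fun y => y + v) '' K ∧ (fun y => y + v) '' K ⊆ B

/-- The intersection of all closed balls of radius `r` that contain `S`. -/
def ballHull {d : ℕ} (r : ℝ) (S : Set (EuclideanSpace ℝ (Fin d))) :
    Set (EuclideanSpace ℝ (Fin d)) :=
  {y | ∀ c : EuclideanSpace ℝ (Fin d), S ⊆ closedBall c r → y ∈ closedBall c r}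

/-- The closed ball of radius `r` and centre `c` is a supporting ball of `P`. -/
def IsSupportingBall {d : ℕ} (r : ℝ) (c : EuclideanSpace ℝ (Fin d))
    (P : Set (EuclideanSpace ℝ (Fin d))) : Prop :=
  P ⊆ closedBall c r ∧ (P ∩ sphere c r).Nonempty

/-- The facets of `P` with respect to balls of radius `r`: the subsets of the boundary of `P` of the
form `P ∩ bd B`, for a supporting ball `B` of radius `r`, that have positive surface measure, i.e.
positive `(d-1)`-dimensional Hausdorff measure. -/
def facets {d : ℕ} (r : ℝ) (P : Set (EuclideanSpace ℝ (Fin d))) :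
    Set (Set (EuclideanSpace ℝ (Fin d))) :=
  {F | F ⊆ frontier P ∧ (∃ c, IsSupportingBall r c P ∧ F = P ∩ sphere c r) ∧
    0 < Measure.hausdorffMeasure ((d : ℝ) - 1) F}

/-- The number of facets (possibly infinite a priori) of the radius-`r` ball-polytope generated by
the points `x 0, …, x (n-1)`. -/
noncomputable def numFacets {d n : ℕ} (r : ℝ) (x : Fin n → EuclideanSpace ℝ (Fin d)) : ℝ≥0∞ :=
  ((facets r (ballHull r (range x))).encard : ℝ≥0∞)

/-- The joint law of `n` independent random points, each uniformly distributed in `K`: the `n`-fold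
product of Lebesgue measure restricted to `K` and normalized to total mass one. -/
noncomputable def uniformSample {d : ℕ} (K : Set (EuclideanSpace ℝ (Fin d))) (n : ℕ) :
    Measure (Fin n → EuclideanSpace ℝ (Fin d)) :=
  Measure.pi fun _ => ProbabilityTheory.cond volume K

/-- The expected number of facets of the radius-`r` uniform random ball-polytope generated by `n`
i.i.d. uniform random points in `K`. -/
noncomputable def expectedNumFacets {d : ℕ} (K : Set (EuclideanSpace ℝ (Fin d))) (r : ℝ) (n : ℕ) :
    ℝ≥0∞ :=
  ∫⁻ x, numFacets r x ∂(uniformSample K n)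

/-- `f ≪ g`: there are a finite `γ > 0` and `n₀` with `f n < γ g n` for all `n > n₀`. -/
def MuchLE (f g : ℕ → ℝ≥0∞) : Prop :=
  ∃ γ : ℝ≥0, 0 < γ ∧ ∃ n₀ : ℕ, ∀ n > n₀, f n < (γ : ℝ≥0∞) * g n

/-- `f ≈ g`: both `g ≪ f` and `f ≪ g`. -/
def SameOrder (f g : ℕ → ℝ≥0∞) : Prop :=
  MuchLE g f ∧ MuchLE f g

/-! Facets are counted through centres. A radius-`r` ball containing the sample cuts a facet out of
the ball hull exactly when its contact directions span the space: otherwise the hull meets the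
sphere inside a hyperplane through the centre, a null set, while `d` independent contact directions
put an open piece of the sphere into the hull. If the sample lies in a ball of radius `R < r` and is
not a single point, this is a bijection (`numFacets_eq_encard_facetCenters`).

Only a two-sided ball condition on `K` is used (`RollsBetween`). The `C²` boundary and compactness
give inner tangent balls of one radius `ρ`; free sliding gives outer tangent balls of radius `R`. So
a cap of height `s ^ 2` has width of order `s` and volume of order `s ^ (d + 1)`.

Upper bound: `d` given points lie on at most two spheres of radius `r` in the required position. If
such a ball cuts off a cap of height `s ^ 2`, the remaining `n - d` points miss the cap with
probability at most `exp (-κ' (n - d) s ^ (d + 1))`, and the `d` points lie within order `s` of each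
other in a boundary layer of thickness of order `s ^ 2`. The latter has probability of order `s ^ 2
* (s ^ (d + 1)) ^ (d - 1) = s ^ (d ^ 2 + 1)`. Summation over scales gives order `n ^ (-(d ^ 2 + 1) /
(d + 1))` for each `d`-subset, and there are at most `n ^ d` subsets.

Lower bound: put `t = n ^ (-1 / (d + 1))`. There are of order `t ^ (-(d - 1))` boundary points `z`
at mutual distance of order `t`. With probability bounded below, a cap of size `t` at `z` contains
exactly `2 * d` sample points, one in each of `2 * d` prescribed small regions. These points confine
the centre to a neighbourhood of `z - r • u`, and the admissible centre farthest from a suitable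
point has spanning contact directions by a second-order argument (`exists_local_facet`). Since `r >
R`, the points `z - r • u` stay separated, so different `z` yield different facets. -/

/-- The centres of the radius-`r` balls that contain all the points `x i` and have `d` of them on
their boundary, in linearly independent directions. -/
def facetCenters {d n : ℕ} (r : ℝ) (x : Fin n → EuclideanSpace ℝ (Fin d)) :
    Set (EuclideanSpace ℝ (Fin d)) :=
  {c | (∀ i, dist (x i) c ≤ r) ∧ ∃ S : Finset (Fin n), S.card = d ∧ (∀ i ∈ S, dist (x i) c = r) ∧
    LinearIndepOn ℝ (fun i => x i - c) (S : Set (Fin n))}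

/-! ### Moving a centre along a direction. -/

section InnerProduct

variable {V : Type*} [NormedAddCommGroup V] [InnerProductSpace ℝ V]

lemma dist_add_smul_sq (x c z : V) (ε : ℝ) :
    dist x (c + ε • z) ^ 2 = dist x c ^ 2 - 2 * ε * inner ℝ (x - c) z + ε ^ 2 * ‖z‖ ^ 2 := by
  rw [dist_eq_norm, dist_eq_norm, show x - (c + ε • z) = (x - c) - ε • z by abel,
    norm_sub_sq_real, inner_smul_right, norm_smul, mul_pow, Real.norm_eq_abs, sq_abs]
  ring

open Filter Topology in
lemma eventually_dist_add_smul_le {x c z : V} {r : ℝ} (hr : 0 ≤ r) (h : dist x c ≤ r)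
    (h' : dist x c = r → 0 < inner ℝ (x - c) z) :
    ∀ᶠ ε in 𝓝[>] (0 : ℝ), dist x (c + ε • z) ≤ r := by
  rcases h.lt_or_eq with hlt | heq
  · have hc : Continuous fun ε : ℝ => dist x (c + ε • z) := by fun_prop
    have : ∀ᶠ ε in 𝓝 (0 : ℝ), dist x (c + ε • z) < r :=
      hc.continuousAt.eventually_lt_const (by simpa using hlt)
    exact (this.filter_mono nhdsWithin_le_nhds).mono fun _ h => h.le
  · have hpos := h' heq
    have hc : Continuous fun ε : ℝ => ε * ‖z‖ ^ 2 := by fun_prop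
    have h1 : ∀ᶠ ε in 𝓝 (0 : ℝ), ε * ‖z‖ ^ 2 < 2 * inner ℝ (x - c) z :=
      hc.continuousAt.eventually_lt_const (by simpa using hpos)
    filter_upwards [h1.filter_mono nhdsWithin_le_nhds, self_mem_nhdsWithin] with ε hε hε0
    have hε0 : 0 < ε := hε0
    refine abs_le_of_sq_le_sq' ?_ hr |>.2
    rw [dist_add_smul_sq, heq]
    nlinarith

open Filter Topology in
lemma eventually_lt_dist_add_smul {q c z : V} (h : inner ℝ (q - c) z < 0) :
    ∀ᶠ ε in 𝓝[>] (0 : ℝ), dist q c < dist q (c + ε • z) := by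
  filter_upwards [self_mem_nhdsWithin] with ε hε0
  have hε0 : 0 < ε := hε0
  refine lt_of_pow_lt_pow_left₀ 2 dist_nonneg ?_
  rw [dist_add_smul_sq]
  nlinarith [mul_pos hε0 (neg_pos.2 h), sq_nonneg (ε * ‖z‖)]

end InnerProduct

/-! ### Contact directions and the ball hull. -/

section Hull

variable {d n : ℕ} {r : ℝ} {x : Fin n → EuclideanSpace ℝ (Fin d)}

/-- A point of the ball hull on the boundary of a ball `closedBall c r` containing the points lies
in the span of the directions from `c` to the points on the boundary. -/
lemma inner_eq_zero_of_mem_ballHull_sphere {R : ℝ} (hr : 0 ≤ r) (hRr : R < r)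
    {c₀ c q v : EuclideanSpace ℝ (Fin d)} (h₀ : ∀ i, dist (x i) c₀ ≤ R)
    (hc : ∀ i, dist (x i) c ≤ r) (hq : q ∈ ballHull r (range x)) (hqc : dist q c = r)
    (hv : ∀ i, dist (x i) c = r → inner ℝ (x i - c) v = 0) : inner ℝ (q - c) v = 0 := by
  by_contra hne
  set a := inner ℝ (q - c) v with ha
  set b := inner ℝ (q - c) (c₀ - c) with hb
  -- Moving `c` towards `c₀` brings it closer to all contact points because `R < r`, and `v` does
  -- not affect them to first order. The multiple of `v` makes the product with `q - c` equal to `b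
  -- - (|b| + 1) < 0`, so the moved ball keeps the sample and loses `q`.
  set z := (c₀ - c) - ((|b| + 1) / a) • v with hz
  have hqz : inner ℝ (q - c) z < 0 := by
    rw [hz, inner_sub_right, inner_smul_right, ← ha, ← hb, div_mul_cancel₀ _ hne]
    linarith [le_abs_self b]
  have hact : ∀ i, dist (x i) c = r → 0 < inner ℝ (x i - c) z := by
    intro i hi
    rw [hz, inner_sub_right, inner_smul_right, hv i hi, mul_zero, sub_zero]
    have h1 := dist_add_smul_sq (x i) c (c₀ - c) 1
    rw [one_smul, add_sub_cancel, hi] at h1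
    have h2 : dist (x i) c₀ ^ 2 < r ^ 2 :=
      pow_lt_pow_left₀ ((h₀ i).trans_lt hRr) dist_nonneg two_ne_zero
    nlinarith [sq_nonneg ‖c₀ - c‖]
  have hall := Filter.eventually_all.2 fun i => eventually_dist_add_smul_le hr (hc i) (hact i)
  obtain ⟨ε, h1, h2⟩ := (hall.and (eventually_lt_dist_add_smul hqz)).exists
  have := hq (c + ε • z) (by rintro _ ⟨i, rfl⟩; exact h1 i)
  rw [mem_closedBall] at this
  linarith

/-- Positive combinations of directions to boundary points lead to points of the ball hull. -/
lemma mem_ballHull_of_sum {c q : EuclideanSpace ℝ (Fin d)} {S : Finset (Fin n)} (hr : 0 < r)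
    (hS : ∀ i ∈ S, dist (x i) c = r) {w : Fin n → ℝ} (hw : ∀ i ∈ S, 0 ≤ w i)
    (hq : q - c = ∑ i ∈ S, w i • (x i - c)) (hqc : dist q c = r) :
    q ∈ ballHull r (range x) := by
  intro c' hc'
  -- All vectors involved have length `r`, so the triangle inequality forces total weight at least
  -- `1`. This lets the contact points' inequalities against `c'` add up to the one for `q`.
  have hsum : 1 ≤ ∑ i ∈ S, w i := by
    have h1 : r ≤ (∑ i ∈ S, w i) * r := by
      calc r = ‖q - c‖ := by rw [← hqc, dist_eq_norm]
        _ ≤ ∑ i ∈ S, ‖w i • (x i - c)‖ := by rw [hq]; exact norm_sum_le _ _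
        _ = (∑ i ∈ S, w i) * r := by
          rw [Finset.sum_mul]
          refine Finset.sum_congr rfl fun i hi => ?_
          rw [norm_smul, ← dist_eq_norm, hS i hi, Real.norm_eq_abs, abs_of_nonneg (hw i hi)]
    nlinarith
  have key : ∀ p : EuclideanSpace ℝ (Fin d),
      dist p c' ^ 2 = dist p c ^ 2 - 2 * inner ℝ (p - c) (c' - c) + ‖c' - c‖ ^ 2 := by
    intro p
    have := dist_add_smul_sq p c (c' - c) 1
    rw [one_smul, add_sub_cancel] at this
    rw [this]; ring
  have hi : ∀ i ∈ S, ‖c' - c‖ ^ 2 ≤ 2 * inner ℝ (x i - c) (c' - c) := by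
    intro i hi
    have h1 := key (x i)
    have h2 : dist (x i) c' ≤ r := hc' (mem_range_self i)
    rw [hS i hi] at h1
    nlinarith [pow_le_pow_left₀ dist_nonneg h2 2]
  have hge : (∑ i ∈ S, w i) * ‖c' - c‖ ^ 2 ≤ 2 * inner ℝ (q - c) (c' - c) := by
    rw [hq, sum_inner, Finset.sum_mul, Finset.mul_sum]
    refine Finset.sum_le_sum fun i his => ?_
    rw [inner_smul_left]
    have := mul_le_mul_of_nonneg_left (hi i his) (hw i his)
    simpa [mul_left_comm] using this
  refine abs_le_of_sq_le_sq' ?_ hr.le |>.2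
  rw [key q, hqc]
  nlinarith [mul_le_mul_of_nonneg_right hsum (sq_nonneg ‖c' - c‖)]

end Hull

/-! ### Surface measure of pieces of spheres. -/

section HausdorffSphere

variable {d : ℕ}

lemma finrank_orthogonal_singleton (hd : 1 ≤ d) {v : EuclideanSpace ℝ (Fin d)} (hv : v ≠ 0) :
    Module.finrank ℝ (ℝ ∙ v)ᗮ = d - 1 := by
  have : Fact (Module.finrank ℝ (EuclideanSpace ℝ (Fin d)) = (d - 1) + 1) :=
    ⟨by rw [finrank_euclideanSpace_fin]; omega⟩
  exact Submodule.finrank_orthogonal_span_singleton hv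

lemma isAddHaarMeasure_hausdorff_orthogonal (hd : 1 ≤ d) {v : EuclideanSpace ℝ (Fin d)}
    (hv : v ≠ 0) :
    (Measure.hausdorffMeasure ((d : ℝ) - 1) : Measure (ℝ ∙ v)ᗮ).IsAddHaarMeasure := by
  have h := finrank_orthogonal_singleton hd hv
  have h2 : ((Module.finrank ℝ (ℝ ∙ v)ᗮ : ℕ) : ℝ) = (d : ℝ) - 1 := by
    rw [h, Nat.cast_sub hd, Nat.cast_one]
  rw [← h2]
  infer_instance

/-- On the hyperplane the `(d-1)`-dimensional Hausdorff measure is a Haar measure, for which spheres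
are null. The condition `s ≠ 0` matters for `d = 1`, where the hyperplane is a point of positive
measure. -/
lemma hausdorffMeasure_eq_zero_of_subset_sphere_hyperplane (hd : 1 ≤ d)
    {v m : EuclideanSpace ℝ (Fin d)} (hv : v ≠ 0) {s : ℝ} (hs : s ≠ 0)
    {A : Set (EuclideanSpace ℝ (Fin d))}
    (hA : ∀ a ∈ A, inner ℝ (a - m) v = 0 ∧ dist a m = s) :
    Measure.hausdorffMeasure ((d : ℝ) - 1) A = 0 := by
  have := isAddHaarMeasure_hausdorff_orthogonal hd hv
  have hiso : Isometry fun w : (ℝ ∙ v)ᗮ => m + (w : EuclideanSpace ℝ (Fin d)) :=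
    (IsometryEquiv.addLeft m).isometry.comp (Submodule.subtypeₗᵢ _).isometry
  have hsub : A ⊆ (fun w : (ℝ ∙ v)ᗮ => m + (w : EuclideanSpace ℝ (Fin d))) '' sphere 0 s := by
    intro a ha
    obtain ⟨h1, h2⟩ := hA a ha
    refine ⟨⟨a - m, Submodule.mem_orthogonal_singleton_iff_inner_left.2 h1⟩, ?_, by simp⟩
    rw [mem_sphere_zero_iff_norm, Submodule.coe_norm, ← h2, dist_eq_norm]
  refine measure_mono_null hsub ?_
  have hd1 : (0 : ℝ) ≤ (d : ℝ) - 1 := by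
    rw [sub_nonneg]; exact_mod_cast hd
  rw [hiso.hausdorffMeasure_image (Or.inl hd1)]
  exact Measure.addHaar_sphere_of_ne_zero _ _ hs

/-- Orthogonal projection along `q₀` is `1`-Lipschitz, so it does not increase the measure, and the
image of `F` contains an open subset of the hyperplane. -/
lemma hausdorffMeasure_pos_of_open_cone (hd : 1 ≤ d) {r : ℝ} (hr : 0 < r)
    {c q₀ : EuclideanSpace ℝ (Fin d)} {O F : Set (EuclideanSpace ℝ (Fin d))} (hO : IsOpen O)
    (hq₀ : q₀ ∈ O) (hq₀r : ‖q₀‖ = r) (hF : ∀ v ∈ O, ‖v‖ = r → c + v ∈ F) :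
    0 < Measure.hausdorffMeasure ((d : ℝ) - 1) F := by
  have hne : q₀ ≠ 0 := by
    rintro rfl
    rw [norm_zero] at hq₀r
    exact hr.ne hq₀r
  have := isAddHaarMeasure_hausdorff_orthogonal hd hne
  set W := (ℝ ∙ q₀)ᗮ with hW
  -- Lift of the hyperplane to the hemisphere of radius `r` around `q₀`, a section of the
  -- projection.
  let ψ : W → EuclideanSpace ℝ (Fin d) := fun w => w + (√(r ^ 2 - ‖w‖ ^ 2) / r) • q₀
  have hψ : Continuous ψ := by fun_prop
  let U : Set W := ψ ⁻¹' O ∩ ball 0 r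
  have hU : IsOpen U := (hO.preimage hψ).inter isOpen_ball
  have hU0 : (0 : W) ∈ U := by
    refine ⟨?_, mem_ball_self hr⟩
    simp only [mem_preimage, ψ]
    simpa [Real.sqrt_sq hr.le, hr.ne'] using hq₀
  have hd1 : (0 : ℝ) ≤ (d : ℝ) - 1 := by
    rw [sub_nonneg]; exact_mod_cast hd
  let g : EuclideanSpace ℝ (Fin d) → W := fun q => W.orthogonalProjectionOnto (q - c)
  have hg : LipschitzWith 1 g := by
    refine LipschitzWith.of_dist_le_mul fun a b => ?_
    simp only [g, NNReal.coe_one, one_mul]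
    rw [dist_eq_norm, ← map_sub, sub_sub_sub_cancel_right, dist_eq_norm]
    exact W.norm_orthogonalProjectionOnto_apply_le _
  have hsub : U ⊆ g '' F := by
    rintro w ⟨hw1, hw2⟩
    rw [mem_ball_zero_iff] at hw2
    have horth : inner ℝ (w : EuclideanSpace ℝ (Fin d)) q₀ = 0 :=
      Submodule.mem_orthogonal_singleton_iff_inner_left.1 w.2
    have hnn : 0 ≤ r ^ 2 - ‖w‖ ^ 2 := by
      nlinarith [norm_nonneg w]
    have hnorm : ‖ψ w‖ = r := by
      rw [← sq_eq_sq₀ (norm_nonneg _) hr.le]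
      simp only [ψ]
      rw [norm_add_sq_real, inner_smul_right, horth, norm_smul, hq₀r, mul_pow, Real.norm_eq_abs,
        sq_abs, div_pow, Real.sq_sqrt hnn, Submodule.coe_norm]
      field_simp
      ring
    refine ⟨c + ψ w, hF _ hw1 hnorm, ?_⟩
    simp only [g, ψ, add_sub_cancel_left, map_add, map_smul]
    rw [W.orthogonalProjectionOnto_mem_subspace_eq_self w,
      Submodule.orthogonalProjectionOnto_orthogonalComplement_singleton_eq_zero, smul_zero, add_zero]
  have hpos : 0 < (Measure.hausdorffMeasure ((d : ℝ) - 1) : Measure W) U :=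
    hU.measure_pos _ ⟨0, hU0⟩
  have hle := hg.hausdorffMeasure_image_le hd1 F
  rw [ENNReal.coe_one, ENNReal.one_rpow, one_mul] at hle
  exact (hpos.trans_le (measure_mono hsub)).trans_le hle

end HausdorffSphere

/-! ### Facets as centres with spanning contact directions. -/

section Facets

variable {d n : ℕ} {r : ℝ} {x : Fin n → EuclideanSpace ℝ (Fin d)}

lemma range_subset_ballHull : range x ⊆ ballHull r (range x) := fun _ hy _ hc => hc hy

/-- The `d` contact directions form a basis, and the points of the sphere in the open cone of
positive combinations belong to the hull by `mem_ballHull_of_sum`. -/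
lemma hausdorffMeasure_facet_pos (hd : 1 ≤ d) (hr : 0 < r) {c : EuclideanSpace ℝ (Fin d)}
    (hc : c ∈ facetCenters r x) :
    0 < Measure.hausdorffMeasure ((d : ℝ) - 1) (ballHull r (range x) ∩ sphere c r) := by
  obtain ⟨-, S, hcard, hS, hind⟩ := hc
  have hli : LinearIndependent ℝ (fun i : S => x i - c) := hind
  have : Nonempty S := by
    rw [Finset.nonempty_coe_sort, ← Finset.card_pos]; omega
  let b := basisOfLinearIndependentOfCardEqFinrank hli
    (by rw [Fintype.card_coe, hcard, finrank_euclideanSpace_fin])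
  have hb : ∀ i, b i = x i - c := fun i => by simp [b]
  let O : Set (EuclideanSpace ℝ (Fin d)) := {v | ∀ i, 0 < b.repr v i}
  have hO : IsOpen O := by
    have : O = ⋂ i, {v | 0 < b.coord i v} := by ext v; simp [O]
    rw [this]
    refine isOpen_iInter_of_finite fun i => isOpen_lt continuous_const ?_
    exact LinearMap.continuous_of_finiteDimensional _
  set v₀ := ∑ i, b i with hv₀
  have hv₀O : ∀ i, b.repr v₀ i = 1 := by
    intro i
    have : v₀ = ∑ j, (1 : ℝ) • b j := by simp [hv₀]
    rw [this, Module.Basis.repr_sum_self]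
  have hv₀ne : v₀ ≠ 0 := by
    intro h
    have := hv₀O (Classical.arbitrary S)
    rw [h] at this
    simp at this
  have hn : 0 < ‖v₀‖ := norm_pos_iff.2 hv₀ne
  refine hausdorffMeasure_pos_of_open_cone hd hr (c := c) (q₀ := (r / ‖v₀‖) • v₀) hO ?_ ?_ ?_
  · intro i
    rw [map_smul, Finsupp.smul_apply, hv₀O i, smul_eq_mul, mul_one]
    positivity
  · rw [norm_smul, Real.norm_eq_abs, abs_of_pos (by positivity), div_mul_cancel₀ _ hn.ne']
  · intro v hv hvr
    have hdist : dist (c + v) c = r := by rw [dist_eq_norm, add_sub_cancel_left, hvr]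
    refine ⟨?_, hdist⟩
    classical
    refine mem_ballHull_of_sum (w := fun i => if h : i ∈ S then b.repr v ⟨i, h⟩ else 0) hr hS
      (fun i hi => by simpa [hi] using (hv ⟨i, hi⟩).le) ?_ hdist
    rw [add_sub_cancel_left, ← Finset.sum_coe_sort]
    conv_lhs => rw [← b.sum_repr v]
    refine Finset.sum_congr rfl fun i _ => ?_
    simp [hb]

lemma mem_facetCenters_of_span_eq_top {c : EuclideanSpace ℝ (Fin d)}
    (hc : ∀ i, dist (x i) c ≤ r)
    (hspan : Submodule.span ℝ ((fun i => x i - c) '' {i | dist (x i) c = r}) = ⊤) :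
    c ∈ facetCenters r x := by
  refine ⟨hc, ?_⟩
  obtain ⟨b, hbJ, -, hb, hli⟩ := exists_linearIndepOn_extension
    (linearIndepOn_empty ℝ (fun i => x i - c)) (empty_subset {i | dist (x i) c = r})
  classical
  have htop : Submodule.span ℝ ((fun i => x i - c) '' b) = ⊤ :=
    top_le_iff.1 (hspan ▸ Submodule.span_le.2 hb)
  refine ⟨b.toFinset, ?_, fun i hi => hbJ (by simpa using hi), by simpa using hli⟩
  have hli' : LinearIndependent ℝ (fun i : b => x i - c) := hli
  have h1 := finrank_span_eq_card hli'
  rw [← image_eq_range (fun i => x i - c) b, htop, finrank_top, finrank_euclideanSpace_fin] at h1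
  rw [toFinset_card, ← h1]

/-- If the contact directions do not span, then by `inner_eq_zero_of_mem_ballHull_sphere` the facet
lies in a hyperplane through `c`, and its part on the sphere is null. -/
lemma mem_facetCenters_of_hausdorffMeasure_pos (hd : 1 ≤ d) {R : ℝ} (hr : 0 < r) (hRr : R < r)
    {c₀ c : EuclideanSpace ℝ (Fin d)} (h₀ : ∀ i, dist (x i) c₀ ≤ R)
    (hc : ∀ i, dist (x i) c ≤ r)
    (hpos : 0 < Measure.hausdorffMeasure ((d : ℝ) - 1) (ballHull r (range x) ∩ sphere c r)) :
    c ∈ facetCenters r x := by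
  refine mem_facetCenters_of_span_eq_top hc ?_
  by_contra hne
  obtain ⟨v, hv, hv0⟩ := Submodule.exists_mem_ne_zero_of_ne_bot
    (mt Submodule.orthogonal_eq_bot_iff.1 hne)
  refine hpos.ne' (hausdorffMeasure_eq_zero_of_subset_sphere_hyperplane hd hv0 (m := c) hr.ne' ?_)
  rintro q ⟨hq, hqc⟩
  refine ⟨inner_eq_zero_of_mem_ballHull_sphere hr.le hRr h₀ hc hq hqc fun i hi => ?_, hqc⟩
  exact (Submodule.mem_orthogonal _ _).1 hv _ (Submodule.subset_span ⟨i, hi, rfl⟩)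

/-- Facets correspond to centres with `d` linearly independent directions to boundary points. -/
theorem numFacets_eq_encard_facetCenters (hd : 1 ≤ d) {R : ℝ} (hr : 0 < r) (hRr : R < r)
    {c₀ : EuclideanSpace ℝ (Fin d)} (h₀ : ∀ i, dist (x i) c₀ ≤ R) (hne : ∃ i j, x i ≠ x j) :
    numFacets r x = ((facetCenters r x).encard : ℝ≥0∞) := by
  -- Two centres with the same facet would place it in the intersection of two spheres, a
  -- lower-dimensional sphere around the midpoint `m`.
  have hinj : InjOn (fun c => ballHull r (range x) ∩ sphere c r) (facetCenters r x) := by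
    intro c hc c' hc' heq
    by_contra hcc
    have heq : ballHull r (range x) ∩ sphere c r = ballHull r (range x) ∩ sphere c' r := heq
    set m := midpoint ℝ c c' with hm
    have hpar : ∀ p, dist p m ^ 2 = (dist p c ^ 2 + dist p c' ^ 2) / 2 - dist c c' ^ 2 / 4 := by
      intro p
      have h1 := parallelogram_law_with_norm ℝ (p - c) (p - c')
      have h2 : p - c + (p - c') = (2 : ℝ) • (p - m) := by
        rw [hm, midpoint_eq_smul_add, smul_sub, smul_smul]
        norm_num
        rw [two_smul]; abel
      rw [h2, norm_smul, sub_sub_sub_cancel_left, ← dist_eq_norm, ← dist_eq_norm, ← dist_eq_norm,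
        ← dist_eq_norm, dist_comm c' c] at h1
      norm_num at h1
      nlinarith
    -- If the squared radius were not positive, the two balls would share at most `m`, and all
    -- sample points would coincide.
    have hs : 0 < r ^ 2 - dist c c' ^ 2 / 4 := by
      by_contra hle
      obtain ⟨i, j, hij⟩ := hne
      have hz : ∀ i, x i = m := by
        intro i
        have h1 := hpar (x i)
        have h2 := pow_le_pow_left₀ dist_nonneg (hc.1 i) 2
        have h3 := pow_le_pow_left₀ dist_nonneg (hc'.1 i) 2
        rw [← dist_eq_zero, ← sq_eq_zero_iff]
        nlinarith [sq_nonneg (dist (x i) m)]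
      exact hij ((hz i).trans (hz j).symm)
    refine (hausdorffMeasure_facet_pos hd hr hc).ne'
      (hausdorffMeasure_eq_zero_of_subset_sphere_hyperplane hd (v := c - c') (m := m)
        (sub_ne_zero.2 hcc) (Real.sqrt_pos.2 hs).ne' fun p hp => ?_)
    have hp1 : dist p c = r := hp.2
    have hp2 : dist p c' = r := (heq ▸ hp).2
    constructor
    · have h1 := dist_add_smul_sq p m (c - c') (1 / 2)
      have h2 := dist_add_smul_sq p m (c - c') (-(1 / 2))
      have h3 : m + (1 / 2 : ℝ) • (c - c') = c := by
        rw [hm, midpoint_eq_smul_add, invOf_eq_inv]; module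
      have h4 : m + (-(1 / 2) : ℝ) • (c - c') = c' := by
        rw [hm, midpoint_eq_smul_add, invOf_eq_inv]; module
      rw [h3, hp1] at h1
      rw [h4, hp2] at h2
      linarith
    · rw [← sq_eq_sq₀ dist_nonneg (Real.sqrt_nonneg _), hpar, hp1, hp2, Real.sq_sqrt hs.le]
      ring
  have himg : facets r (ballHull r (range x))
      = (fun c => ballHull r (range x) ∩ sphere c r) '' facetCenters r x := by
    ext F
    constructor
    · rintro ⟨-, ⟨c, ⟨hc, -⟩, rfl⟩, hpos⟩
      exact ⟨c, mem_facetCenters_of_hausdorffMeasure_pos hd hr hRr h₀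
        (fun i => hc (range_subset_ballHull (mem_range_self i))) hpos, rfl⟩
    · rintro ⟨c, hc, rfl⟩
      have hpos := hausdorffMeasure_facet_pos hd hr hc
      have hsub : ballHull r (range x) ⊆ closedBall c r :=
        fun q hq => hq c (by rintro _ ⟨i, rfl⟩; exact hc.1 i)
      refine ⟨?_, ⟨c, ⟨hsub, nonempty_of_measure_ne_zero hpos.ne'⟩, rfl⟩, hpos⟩
      rintro q ⟨hq, hqc⟩
      refine ⟨subset_closure hq, fun hqi => ?_⟩
      have := interior_mono hsub hqi
      rw [interior_closedBall _ hr.ne'] at this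
      exact (mem_ball.1 this).ne hqc
  rw [numFacets, himg, hinj.encard_image]

end Facets

/-! ### Outer normals and tangent balls. -/

section Normals

variable {V : Type*} [NormedAddCommGroup V] [InnerProductSpace ℝ V]

/-- `u` is an outer unit normal of `K` at its point `x`. -/
structure IsOuterNormal (K : Set V) (x u : V) : Prop where
  mem : x ∈ K
  norm_eq : ‖u‖ = 1
  inner_le : ∀ y ∈ K, inner ℝ (y - x) u ≤ 0

/-- At each boundary point of `K` with outer normal `u`, the set `K` lies between the balls of radii
`ρ` and `R` that touch it there. -/
def RollsBetween (K : Set V) (ρ R : ℝ) : Prop :=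
  ∀ x u, IsOuterNormal K x u → closedBall (x - ρ • u) ρ ⊆ K ∧ K ⊆ closedBall (x - R • u) R

variable {K : Set V} {ρ R : ℝ}

lemma IsCompact.exists_isOuterNormal (hK : IsCompact K) (hne : K.Nonempty) {u : V} (hu : ‖u‖ = 1) :
    ∃ x, IsOuterNormal K x u := by
  obtain ⟨x, hx, hmax⟩ := hK.exists_isMaxOn hne
    (f := fun y => inner ℝ y u) (by fun_prop)
  refine ⟨x, hx, hu, fun y hy => ?_⟩
  rw [inner_sub_left]
  exact sub_nonpos.2 (hmax hy)

lemma isOuterNormal_of_farthest {c x : V} (hx : x ∈ K) (hmax : ∀ y ∈ K, dist y c ≤ dist x c)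
    (hpos : 0 < dist x c) : IsOuterNormal K x ((dist x c)⁻¹ • (x - c)) := by
  refine ⟨hx, ?_, fun y hy => ?_⟩
  · rw [norm_smul, ← dist_eq_norm, norm_inv, Real.norm_eq_abs, abs_of_pos hpos,
      inv_mul_cancel₀ hpos.ne']
  · rw [inner_smul_right]
    refine mul_nonpos_of_nonneg_of_nonpos (inv_nonneg.2 hpos.le) ?_
    have h1 := pow_le_pow_left₀ dist_nonneg (hmax y hy) 2
    rw [dist_eq_norm, dist_eq_norm, show y - c = (y - x) + (x - c) by abel, norm_add_sq_real] at h1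
    nlinarith [sq_nonneg ‖y - x‖]

/-- A ball tangent at `x` is described by comparing squared distance with depth below the tangent
hyperplane; most later estimates use this form. -/
lemma mem_closedBall_sub_smul_iff {x y u : V} (hu : ‖u‖ = 1) {s : ℝ} (hs : 0 ≤ s) :
    y ∈ closedBall (x - s • u) s ↔ ‖x - y‖ ^ 2 ≤ 2 * s * inner ℝ (x - y) u := by
  rw [mem_closedBall, dist_comm, dist_eq_norm, ← sq_le_sq₀ (norm_nonneg _) hs,
    show x - s • u - y = (x - y) - s • u by abel, norm_sub_sq_real, inner_smul_right, norm_smul, hu,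
    mul_one, Real.norm_eq_abs, sq_abs]
  constructor <;> intro h <;> linarith

lemma closedBall_sub_smul_subset {x u : V} (hu : ‖u‖ = 1) {s t : ℝ} (hs : 0 ≤ s) (hst : s ≤ t) :
    closedBall (x - s • u) s ⊆ closedBall (x - t • u) t := by
  intro y hy
  rw [mem_closedBall_sub_smul_iff hu hs] at hy
  rw [mem_closedBall_sub_smul_iff hu (hs.trans hst)]
  rcases hs.eq_or_lt with rfl | hs
  · have h0 : x - y = 0 := by
      rw [← norm_eq_zero, ← sq_eq_zero_iff]
      nlinarith [sq_nonneg ‖x - y‖]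
    simp [h0]
  · have : 0 ≤ inner ℝ (x - y) u := by
      by_contra hneg
      nlinarith [sq_nonneg ‖x - y‖, mul_pos hs (neg_pos.2 (not_le.1 hneg))]
    nlinarith

namespace RollsBetween

variable {x y u z z' u' : V}

lemma norm_sub_sq_le (h : RollsBetween K ρ R) (hR : 0 ≤ R) (hx : IsOuterNormal K x u) (hy : y ∈ K) :
    ‖x - y‖ ^ 2 ≤ 2 * R * inner ℝ (x - y) u :=
  (mem_closedBall_sub_smul_iff hx.norm_eq hR).1 ((h x u hx).2 hy)

lemma mem_of_norm_sq_le (h : RollsBetween K ρ R) (hρ : 0 ≤ ρ) (hx : IsOuterNormal K x u)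
    (hy : ‖x - y‖ ^ 2 ≤ 2 * ρ * inner ℝ (x - y) u) : y ∈ K :=
  (h x u hx).1 ((mem_closedBall_sub_smul_iff hx.norm_eq hρ).2 hy)

/-- The Gauss map is `1 / ρ`-Lipschitz. The point of the inner ball at one foot that is extreme in
the other normal direction lies in `K`, hence below the other supporting hyperplane; the two
resulting inequalities are added and Cauchy–Schwarz is applied. -/
lemma mul_norm_sub_le (h : RollsBetween K ρ R) (hρ : 0 ≤ ρ) (hz : IsOuterNormal K z u)
    (hz' : IsOuterNormal K z' u') : ρ * ‖u - u'‖ ≤ ‖z - z'‖ := by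
  have key : ∀ {a b v w : V}, IsOuterNormal K a v → IsOuterNormal K b w →
      ρ * (1 - inner ℝ v w) ≤ inner ℝ (b - a) w := by
    intro a b v w ha hb
    have hmem : a - ρ • v + ρ • w ∈ K := by
      refine (h a v ha).1 ?_
      rw [mem_closedBall, dist_eq_norm, add_sub_cancel_left, norm_smul, hb.norm_eq, mul_one,
        Real.norm_eq_abs, abs_of_nonneg hρ]
    have := hb.inner_le _ hmem
    rw [show a - ρ • v + ρ • w - b = ρ • w - ρ • v - (b - a) by abel, inner_sub_left,
      inner_sub_left, inner_smul_left, inner_smul_left, real_inner_self_eq_norm_sq, hb.norm_eq]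
      at this
    simp only [conj_trivial] at this
    linarith
  have h1 := key hz hz'
  have h2 := key hz' hz
  have h3 : ‖u - u'‖ ^ 2 = 2 * (1 - inner ℝ u u') := by
    rw [norm_sub_sq_real, hz.norm_eq, hz'.norm_eq]; ring
  have h4 : inner ℝ (z' - z) u' + inner ℝ (z - z') u = inner ℝ (z - z') (u - u') := by
    rw [inner_sub_right, ← neg_sub z z', inner_neg_left]; ring
  have h5 := real_inner_le_norm (z - z') (u - u')
  rw [real_inner_comm] at h2
  have h6 : ρ * ‖u - u'‖ ^ 2 ≤ ‖z - z'‖ * ‖u - u'‖ := by rw [h3]; linarith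
  rcases (norm_nonneg (u - u')).eq_or_lt with h0 | h0
  · rw [← h0, mul_zero]; positivity
  · refine le_of_mul_le_mul_right ?_ h0
    linarith

/-- The outer balls give `‖z - z'‖ ≤ R * ‖u - u'‖`, so for `r > R` the shift by `r • u` outweighs
the distance of the feet. This keeps facets found near different boundary points distinct. -/
lemma norm_sub_smul_sub_ge (h : RollsBetween K ρ R) (hR : 0 < R) {r : ℝ} (hr : R ≤ r)
    (hz : IsOuterNormal K z u) (hz' : IsOuterNormal K z' u') :
    (r / R - 1) * ‖z - z'‖ ≤ ‖(z - r • u) - (z' - r • u')‖ := by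
  have h1 := h.norm_sub_sq_le hR.le hz hz'.mem
  have h2 := h.norm_sub_sq_le hR.le hz' hz.mem
  rw [norm_sub_rev] at h2
  have h4 : inner ℝ (z' - z) u' + inner ℝ (z - z') u = inner ℝ (z - z') (u - u') := by
    rw [inner_sub_right, ← neg_sub z z', inner_neg_left]; ring
  have h5 := real_inner_le_norm (z - z') (u - u')
  have h6 : ‖z - z'‖ ≤ R * ‖u - u'‖ := by
    rcases (norm_nonneg (z - z')).eq_or_lt with h0 | h0
    · rw [← h0]; positivity
    · refine le_of_mul_le_mul_left ?_ h0
      nlinarith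
  have h7 : ‖r • (u - u')‖ - ‖z - z'‖ ≤ ‖(z - r • u) - (z' - r • u')‖ := by
    rw [show (z - r • u) - (z' - r • u') = -(r • (u - u') - (z - z')) by
      rw [smul_sub]; abel, norm_neg]
    exact norm_sub_norm_le _ _
  rw [norm_smul, Real.norm_eq_abs, abs_of_nonneg (hR.le.trans hr)] at h7
  refine le_trans ?_ h7
  have h8 : r / R * ‖z - z'‖ ≤ r * ‖u - u'‖ := by
    rw [div_mul_eq_mul_div, div_le_iff₀ hR]
    nlinarith [mul_le_mul_of_nonneg_left h6 (hR.le.trans hr)]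
  linarith

end RollsBetween

end Normals

/-! ### Tangent balls from smoothness and free sliding. -/

section Rolling

variable {d : ℕ} {K : Set (EuclideanSpace ℝ (Fin d))}

/-- Slide `K` until it touches the ball at `c + R • u`. The translate of `x` is at least as far in
direction `u` and lies in the ball, so it is the touching point itself. -/
lemma SlidesFreelyIn.subset_closedBall {c : EuclideanSpace ℝ (Fin d)} {R : ℝ} (hR : 0 < R)
    (h : SlidesFreelyIn K (closedBall c R)) {x u : EuclideanSpace ℝ (Fin d)}
    (hx : IsOuterNormal K x u) : K ⊆ closedBall (x - R • u) R := by
  have hb : c + R • u ∈ frontier (closedBall c R) := by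
    rw [frontier_closedBall _ hR.ne', mem_sphere, dist_eq_norm, add_sub_cancel_left, norm_smul,
      hx.norm_eq, mul_one, Real.norm_eq_abs, abs_of_pos hR]
  obtain ⟨v, ⟨z, hz, hzv⟩, hsub⟩ := h _ hb
  have hz' : z = c + R • u - v := eq_sub_of_add_eq hzv
  have hin : ∀ y ∈ K, ‖y + v - c‖ ≤ R := fun y hy => by
    rw [← dist_eq_norm]; exact hsub ⟨y, hy, rfl⟩
  have hxeq : x + v - c = R • u := by
    rw [← sub_eq_zero, ← norm_eq_zero, ← sq_eq_zero_iff]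
    refine le_antisymm ?_ (sq_nonneg _)
    have h1 := hx.inner_le z hz
    rw [hz', show c + R • u - v - x = R • u - (x + v - c) by abel, inner_sub_left, inner_smul_left,
      real_inner_self_eq_norm_sq, hx.norm_eq, conj_trivial] at h1
    have h2 := pow_le_pow_left₀ (norm_nonneg _) (hin x hx.mem) 2
    rw [norm_sub_sq_real, inner_smul_right, norm_smul, hx.norm_eq, mul_one, Real.norm_eq_abs, sq_abs]
    nlinarith
  intro y hy
  rw [mem_closedBall, dist_eq_norm, ← hxeq, show y - (x - (x + v - c)) = y + v - c by abel]
  exact hin y hy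

lemma IsOuterNormal.mem_frontier {x u : EuclideanSpace ℝ (Fin d)} (hx : IsOuterNormal K x u) :
    x ∈ frontier K := by
  refine ⟨subset_closure hx.mem, fun hi => ?_⟩
  obtain ⟨ε, hε, hball⟩ := Metric.mem_nhds_iff.1 (mem_interior_iff_mem_nhds.1 hi)
  have := hx.inner_le (x + (ε / 2) • u) (hball (by
    rw [mem_ball, dist_eq_norm, add_sub_cancel_left, norm_smul, hx.norm_eq, mul_one,
      Real.norm_eq_abs, abs_of_pos (by positivity)]
    linarith))
  rw [add_sub_cancel_left, inner_smul_left, real_inner_self_eq_norm_sq, hx.norm_eq,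
    conj_trivial] at this
  linarith

/-- A local version of Blaschke's rolling theorem. -/
lemma HasC2Boundary.exists_nhds_rolling (hK : HasC2Boundary K) {x₀ : EuclideanSpace ℝ (Fin d)}
    (hx₀ : x₀ ∈ frontier K) : ∃ t ∈ nhds x₀, ∃ ρ > 0, ∀ x ∈ t, ∀ u, IsOuterNormal K x u →
      closedBall (x - ρ • u) ρ ⊆ K := by
  obtain ⟨U, φ, hU, hxU, hφ, hne, hKU⟩ := hK x₀ hx₀
  have hφ0 : ContDiffAt ℝ 2 φ x₀ := hφ.contDiffAt (hU.mem_nhds hxU)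
  have hd : ContDiffAt ℝ 1 (fderiv ℝ φ) x₀ := hφ0.fderiv_right (by norm_num)
  obtain ⟨L, t, ht, hL⟩ := hd.exists_lipschitzOnWith
  set m := ‖fderiv ℝ φ x₀‖ / 2 with hm
  have hm0 : 0 < m := by positivity
  have hev : ∀ᶠ y in nhds x₀, m < ‖fderiv ℝ φ y‖ :=
    hd.continuousAt.norm.eventually_const_lt (by rw [hm]; linarith [norm_pos_iff.2 hne])
  obtain ⟨δ, hδ, hball⟩ := Metric.mem_nhds_iff.1
    (Filter.inter_mem (Filter.inter_mem (hU.mem_nhds hxU) ht) hev)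
  set M : ℝ := L + 1 with hM
  have hM0 : 0 < M := by positivity
  -- The bound `m / (2 * M)` lets the gradient absorb the quadratic Taylor error on the inner ball;
  -- `δ / 8` keeps that ball inside the neighbourhood where the estimates hold.
  refine ⟨ball x₀ (δ / 2), ball_mem_nhds _ (by positivity), min (m / (2 * M)) (δ / 8),
    by positivity, fun x hx u hu => ?_⟩
  set ρ := min (m / (2 * M)) (δ / 8) with hρ
  have hρ0 : 0 < ρ := by positivity
  have hρ1 : 2 * M * ρ ≤ m := by
    have : ρ ≤ m / (2 * M) := min_le_left _ _
    rw [le_div_iff₀ (by positivity)] at this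
    linarith
  have hρ2 : ρ ≤ δ / 8 := min_le_right _ _
  have hxb : x ∈ ball x₀ δ := ball_subset_ball (by linarith) hx
  obtain ⟨⟨hxU', hxt⟩, hxm⟩ := hball hxb
  have hxm : m < ‖fderiv ℝ φ x‖ := hxm
  have hφx : φ x ≤ 0 := (hKU ▸ (⟨hu.mem, hxU'⟩ : x ∈ K ∩ U) : x ∈ {y ∈ U | φ y ≤ 0}).2
  set g := (InnerProductSpace.toDual ℝ (EuclideanSpace ℝ (Fin d))).symm (fderiv ℝ φ x) with hg
  have hgi : ∀ v, fderiv ℝ φ x v = inner ℝ g v := fun v => by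
    rw [hg, InnerProductSpace.toDual_symm_apply]
  have hgn : ‖g‖ = ‖fderiv ℝ φ x‖ := LinearIsometryEquiv.norm_map _ _
  have hg0 : 0 < ‖g‖ := by rw [hgn]; exact hm0.trans hxm
  have htaylor : ∀ v : EuclideanSpace ℝ (Fin d), ‖v‖ < δ / 2 → inner ℝ g v + M * ‖v‖ ^ 2 ≤ 0 →
      x + v ∈ K := by
    intro v hv hneg
    have hseg : segment ℝ x (x + v) ⊆ ball x₀ δ := by
      refine (convex_ball x₀ δ).segment_subset hxb ?_
      rw [mem_ball] at hx ⊢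
      calc dist (x + v) x₀ ≤ dist (x + v) x + dist x x₀ := dist_triangle _ _ _
        _ < δ := by rw [dist_eq_norm, add_sub_cancel_left]; linarith
    have hbound : ∀ y ∈ segment ℝ x (x + v), ‖fderiv ℝ φ y - fderiv ℝ φ x‖ ≤ L * ‖v‖ := by
      intro y hy
      refine (hL.norm_sub_le (hball (hseg hy)).1.2 hxt).trans ?_
      refine mul_le_mul_of_nonneg_left ?_ L.2
      obtain ⟨s, ⟨hs0, hs1⟩, rfl⟩ := (segment_eq_image' ℝ x (x + v)) ▸ hy
      rw [add_sub_cancel_left, add_sub_cancel_left, norm_smul, Real.norm_eq_abs, abs_of_nonneg hs0]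
      exact mul_le_of_le_one_left (norm_nonneg _) hs1
    have hT := Convex.norm_image_sub_le_of_norm_hasFDerivWithin_le'
      (f := φ) (f' := fun y => fderiv ℝ φ y) (φ := fderiv ℝ φ x) (C := L * ‖v‖)
      (s := segment ℝ x (x + v)) (x := x) (y := x + v)
      (fun y hy => ((hφ.contDiffAt (hU.mem_nhds (hball (hseg hy)).1.1)).differentiableAt
        two_ne_zero).hasFDerivAt.hasFDerivWithinAt) hbound (convex_segment _ _)
      (left_mem_segment _ _ _) (right_mem_segment _ _ _)
    rw [add_sub_cancel_left, hgi, Real.norm_eq_abs] at hT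
    have hle := (abs_le.1 hT).2
    have hmem : x + v ∈ {y ∈ U | φ y ≤ 0} := by
      refine ⟨(hball (hseg (right_mem_segment _ _ _))).1.1, ?_⟩
      nlinarith [sq_nonneg ‖v‖]
    rw [← hKU] at hmem
    exact hmem.1
  set e := ‖g‖⁻¹ • g with he
  have hen : ‖e‖ = 1 := by
    rw [he, norm_smul, norm_inv, norm_norm, inv_mul_cancel₀ hg0.ne']
  have hge : g = ‖g‖ • e := by rw [he, smul_smul, mul_inv_cancel₀ hg0.ne', one_smul]
  have hball' : closedBall (x - ρ • e) ρ ⊆ K := by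
    intro y hy
    have hy2 := (mem_closedBall_sub_smul_iff hen hρ0.le).1 hy
    have hnorm : ‖y - x‖ ≤ 2 * ρ := by
      rw [mem_closedBall, dist_eq_norm] at hy
      calc ‖y - x‖ = ‖(y - (x - ρ • e)) - ρ • e‖ := by congr 1; abel
        _ ≤ ‖y - (x - ρ • e)‖ + ‖ρ • e‖ := norm_sub_le _ _
        _ ≤ 2 * ρ := by
          rw [norm_smul, hen, Real.norm_eq_abs, abs_of_pos hρ0]; linarith
    have := htaylor (y - x) (by linarith) (by
      rw [hge, inner_smul_left, conj_trivial, real_inner_comm, ← neg_sub x y, inner_neg_left,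
        norm_neg]
      have h1 : 0 ≤ inner ℝ (x - y) e := by
        by_contra hneg
        nlinarith [sq_nonneg ‖x - y‖, mul_pos hρ0 (neg_pos.2 (not_le.1 hneg))]
      have h2 : m * inner ℝ (x - y) e ≤ ‖g‖ * inner ℝ (x - y) e :=
        mul_le_mul_of_nonneg_right (by linarith) h1
      nlinarith [mul_le_mul_of_nonneg_left hy2 hM0.le, mul_le_mul_of_nonneg_right hρ1 h1])
    rwa [add_sub_cancel] at this
  -- An inner ball tangent at `x` leaves room for only one normal: `x - ρ • e + ρ • u` lies in `K`,
  -- so it must not lie beyond the hyperplane with normal `u`.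
  have hue : u = e := by
    have hmem : x - ρ • e + ρ • u ∈ K := hball' (by
      rw [mem_closedBall, dist_eq_norm, add_sub_cancel_left, norm_smul, hu.norm_eq, mul_one,
        Real.norm_eq_abs, abs_of_pos hρ0])
    have h1 := hu.inner_le _ hmem
    rw [show x - ρ • e + ρ • u - x = ρ • (u - e) by rw [smul_sub]; abel, inner_smul_left,
      inner_sub_left, real_inner_self_eq_norm_sq, hu.norm_eq, conj_trivial] at h1
    have h2 : ‖u - e‖ ^ 2 = 2 - 2 * inner ℝ e u := by
      rw [norm_sub_sq_real, hu.norm_eq, hen, real_inner_comm]; ring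
    rw [← sub_eq_zero, ← norm_eq_zero, ← sq_eq_zero_iff]
    refine le_antisymm ?_ (sq_nonneg _)
    have h3 : 1 ^ 2 - inner ℝ e u ≤ 0 := by
      by_contra hpos
      nlinarith [mul_pos hρ0 (not_le.1 hpos)]
    rw [h2]
    linarith
  rw [hue]
  exact hball'

/-- Compactness of the boundary makes the local inner radii uniform, since shrinking a tangent ball
keeps it inside. -/
theorem HasC2Boundary.exists_rollsBetween (hC2 : HasC2Boundary K) (hK : IsCompact K)
    {c : EuclideanSpace ℝ (Fin d)} {R : ℝ} (hR : 0 < R) (h : SlidesFreelyIn K (closedBall c R)) :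
    ∃ ρ, 0 < ρ ∧ ρ ≤ R ∧ RollsBetween K ρ R := by
  have hcomp : IsCompact (frontier K) :=
    hK.of_isClosed_subset isClosed_frontier hK.isClosed.frontier_subset
  have hloc : ∃ ρ > 0, ∀ x ∈ frontier K, ∀ u, IsOuterNormal K x u →
      closedBall (x - ρ • u) ρ ⊆ K := by
    refine hcomp.induction_on (p := fun s => ∃ ρ > 0, ∀ x ∈ s, ∀ u, IsOuterNormal K x u →
      closedBall (x - ρ • u) ρ ⊆ K) ⟨1, one_pos, by simp⟩ ?_ ?_ ?_
    · rintro s t hst ⟨ρ, hρ, h⟩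
      exact ⟨ρ, hρ, fun x hx => h x (hst hx)⟩
    · rintro s t ⟨ρ, hρ, h⟩ ⟨ρ', hρ', h'⟩
      refine ⟨min ρ ρ', lt_min hρ hρ', ?_⟩
      rintro x (hx | hx) u hu
      · exact (closedBall_sub_smul_subset hu.norm_eq (lt_min hρ hρ').le (min_le_left _ _)).trans
          (h x hx u hu)
      · exact (closedBall_sub_smul_subset hu.norm_eq (lt_min hρ hρ').le (min_le_right _ _)).trans
          (h' x hx u hu)
    · intro x hx
      obtain ⟨t, ht, h⟩ := hC2.exists_nhds_rolling hx
      exact ⟨t, mem_nhdsWithin_of_mem_nhds ht, h⟩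
  obtain ⟨ρ, hρ, hin⟩ := hloc
  refine ⟨min ρ R, lt_min hρ hR, min_le_right _ _, fun x u hu => ⟨?_, h.subset_closedBall hR hu⟩⟩
  exact (closedBall_sub_smul_subset hu.norm_eq (lt_min hρ hR).le (min_le_left _ _)).trans
    (hin x hu.mem_frontier u hu)

end Rolling

/-! ### Volumes of flat cylinders. -/

section Slab

variable {d : ℕ}

/-- The flat cylinder of points at depth between `α` and `β` below `q` in direction `u`, at
tangential distance at most `s` from `q`. -/
def slab (q u : EuclideanSpace ℝ (Fin d)) (α β s : ℝ) : Set (EuclideanSpace ℝ (Fin d)) :=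
  {y | (α ≤ inner ℝ (q - y) u ∧ inner ℝ (q - y) u ≤ β) ∧ ‖q - y - inner ℝ (q - y) u • u‖ ≤ s}

lemma isClosed_slab (q u : EuclideanSpace ℝ (Fin d)) (α β s : ℝ) : IsClosed (slab q u α β s) := by
  have h : Continuous fun y => inner ℝ (q - y) u := by fun_prop
  exact ((isClosed_le continuous_const h).inter (isClosed_le h continuous_const)).inter
    (isClosed_le (f := fun y => ‖q - y - inner ℝ (q - y) u • u‖) (by fun_prop) continuous_const)

/-- An orthonormal basis starting with `u` compares a slab with coordinate boxes, inscribed and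
circumscribed. -/
lemma exists_coordinates {k : ℕ} {u : EuclideanSpace ℝ (Fin (k + 1))} (hu : ‖u‖ = 1)
    (q : EuclideanSpace ℝ (Fin (k + 1))) :
    ∃ Ψ : EuclideanSpace ℝ (Fin (k + 1)) → Fin (k + 1) → ℝ, MeasurePreserving Ψ ∧
      ∀ y, Ψ y 0 = inner ℝ (q - y) u ∧
        ‖q - y - inner ℝ (q - y) u • u‖ ^ 2 = ∑ i : Fin k, Ψ y i.succ ^ 2 := by
  have horth : Orthonormal ℝ (({0} : Set (Fin (k + 1))).domRestrict fun _ => u) :=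
    ⟨fun _ => hu, fun i j hij => absurd (Subsingleton.elim i j) hij⟩
  obtain ⟨b, hb⟩ := horth.exists_orthonormalBasis_extension_of_card_eq
    (by rw [finrank_euclideanSpace_fin, Fintype.card_fin])
  have hb0 : b 0 = u := hb 0 rfl
  refine ⟨fun y => WithLp.ofLp (b.repr (q - y)),
    ((PiLp.volume_preserving_ofLp _).comp b.measurePreserving_repr).comp
      (Measure.measurePreserving_sub_left volume q), fun y => ?_⟩
  have h0 : b.repr (q - y) 0 = inner ℝ (q - y) u := by
    rw [b.repr_apply_apply, hb0, real_inner_comm]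
  refine ⟨h0, ?_⟩
  have h1 : inner ℝ (q - y) (inner ℝ (q - y) u • u) = inner ℝ (q - y) u ^ 2 := by
    rw [inner_smul_right]; ring
  have h2 : ‖q - y‖ ^ 2 = ∑ i, b.repr (q - y) i ^ 2 := by
    rw [← b.repr.norm_map, EuclideanSpace.real_norm_sq_eq]
  rw [norm_sub_sq_real, h1, h2, norm_smul, hu, mul_one, Real.norm_eq_abs, sq_abs,
    Fin.sum_univ_succ, h0]
  ring

lemma volume_slab_le (hd : 1 ≤ d) {q u : EuclideanSpace ℝ (Fin d)} (hu : ‖u‖ = 1) {α β s : ℝ}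
    (hαβ : α ≤ β) (hs : 0 ≤ s) :
    volume (slab q u α β s) ≤ ENNReal.ofReal ((β - α) * (2 * s) ^ (d - 1)) := by
  obtain ⟨k, rfl⟩ : ∃ k, d = k + 1 := ⟨d - 1, by omega⟩
  obtain ⟨Ψ, hΨ, hΨ'⟩ := exists_coordinates hu q
  let B : Set (Fin (k + 1) → ℝ) :=
    univ.pi (Fin.cons (Icc α β) fun _ => Icc (-s) s : Fin (k + 1) → Set ℝ)
  have hsub : slab q u α β s ⊆ Ψ ⁻¹' B := by
    rintro y ⟨h1, h2⟩ i -
    refine Fin.cases ?_ (fun j => ?_) i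
    · simpa [(hΨ' y).1] using h1
    · rw [Fin.cons_succ, mem_Icc, ← abs_le]
      refine abs_le_of_sq_le_sq (le_trans ?_ (pow_le_pow_left₀ (norm_nonneg _) h2 2)) hs
      rw [(hΨ' y).2]
      exact Finset.single_le_sum (f := fun i : Fin k => Ψ y i.succ ^ 2)
        (fun i _ => sq_nonneg _) (Finset.mem_univ j)
  have hB : MeasurableSet B := by
    refine MeasurableSet.univ_pi fun i => ?_
    refine Fin.cases ?_ (fun j => ?_) i <;> simp
  refine (measure_mono hsub).trans ?_
  rw [hΨ.measure_preimage hB.nullMeasurableSet, volume_pi_pi, Fin.prod_univ_succ]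
  simp only [Fin.cons_zero, Fin.cons_succ, Real.volume_Icc, Finset.prod_const, Finset.card_univ,
    Fintype.card_fin]
  rw [sub_neg_eq_add, ← two_mul, ← ENNReal.ofReal_pow (by positivity),
    ← ENNReal.ofReal_mul (by linarith), Nat.add_sub_cancel]

lemma le_volume_slab (hd : 1 ≤ d) {q u : EuclideanSpace ℝ (Fin d)} (hu : ‖u‖ = 1) {α β s : ℝ}
    (hαβ : α ≤ β) (hs : 0 ≤ s) :
    ENNReal.ofReal ((β - α) * (2 * (s / √d)) ^ (d - 1)) ≤ volume (slab q u α β s) := by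
  obtain ⟨k, rfl⟩ : ∃ k, d = k + 1 := ⟨d - 1, by omega⟩
  obtain ⟨Ψ, hΨ, hΨ'⟩ := exists_coordinates hu q
  set t : ℝ := s / √((k + 1 : ℕ) : ℝ) with ht
  have ht0 : 0 ≤ t := by positivity
  have htsq : t ^ 2 * ((k : ℝ) + 1) = s ^ 2 := by
    rw [ht, div_pow, Real.sq_sqrt (by positivity)]
    push_cast
    field_simp
  let B : Set (Fin (k + 1) → ℝ) :=
    univ.pi (Fin.cons (Icc α β) fun _ => Icc (-t) t : Fin (k + 1) → Set ℝ)
  have hsub : Ψ ⁻¹' B ⊆ slab q u α β s := by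
    intro y hy
    refine ⟨by simpa [(hΨ' y).1] using hy 0 (mem_univ _), ?_⟩
    refine abs_le_of_sq_le_sq' ?_ hs |>.2
    rw [(hΨ' y).2]
    have hi : ∀ i : Fin k, Ψ y i.succ ^ 2 ≤ t ^ 2 := by
      intro i
      have := hy i.succ (mem_univ _)
      rw [Fin.cons_succ, mem_Icc] at this
      exact sq_le_sq' this.1 this.2
    refine (Finset.sum_le_sum fun i _ => hi i).trans ?_
    rw [Finset.sum_const, Finset.card_univ, Fintype.card_fin, nsmul_eq_mul, ← htsq]
    nlinarith [sq_nonneg t]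
  have hB : MeasurableSet B := by
    refine MeasurableSet.univ_pi fun i => ?_
    refine Fin.cases ?_ (fun j => ?_) i <;> simp
  refine le_trans (le_of_eq ?_) (measure_mono hsub)
  rw [hΨ.measure_preimage hB.nullMeasurableSet, volume_pi_pi, Fin.prod_univ_succ]
  simp only [Fin.cons_zero, Fin.cons_succ, Real.volume_Icc, Finset.prod_const, Finset.card_univ,
    Fintype.card_fin]
  rw [sub_neg_eq_add, ← two_mul, ← ENNReal.ofReal_pow (by positivity),
    ← ENNReal.ofReal_mul (by linarith), Nat.add_sub_cancel]

end Slab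

/-! ### Boundary layers and their local volume. -/

section Layer

variable {d : ℕ} {K : Set (EuclideanSpace ℝ (Fin d))} {p : EuclideanSpace ℝ (Fin d)} {ρ R : ℝ}

/-- The part of `K` outside the copy of `K` shrunk towards `p` by the factor `1 - ε`. -/
def layer (K : Set (EuclideanSpace ℝ (Fin d))) (p : EuclideanSpace ℝ (Fin d)) (ε : ℝ) :
    Set (EuclideanSpace ℝ (Fin d)) :=
  {x ∈ K | ε < 1 → x ∉ AffineMap.homothety p (1 - ε) '' K}

/-- The points of `K` at depth at most `δ` below some supporting hyperplane. -/
def nearBoundary (K : Set (EuclideanSpace ℝ (Fin d))) (δ : ℝ) : Set (EuclideanSpace ℝ (Fin d)) :=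
  {x ∈ K | ∃ z u, IsOuterNormal K z u ∧ inner ℝ (z - x) u ≤ δ}

lemma layer_subset (ε : ℝ) : layer K p ε ⊆ K := fun _ h => h.1

lemma layer_eq_diff {ε : ℝ} (hε : ε < 1) :
    layer K p ε = K \ (AffineMap.homothety p (1 - ε) '' K) := by
  ext x; simp [layer, hε]

lemma layer_eq_self {ε : ℝ} (hε : ¬ ε < 1) : layer K p ε = K := by
  ext x; simp [layer, hε]

lemma IsCompact.isCompact_image_homothety (hK : IsCompact K) (t : ℝ) :
    IsCompact (AffineMap.homothety p t '' K) :=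
  hK.image (AffineMap.homothety_continuous p t)

lemma IsCompact.measurableSet_layer (hK : IsCompact K) (ε : ℝ) :
    MeasurableSet (layer K p ε) := by
  by_cases hε : ε < 1
  · rw [layer_eq_diff hε]
    exact hK.measurableSet.diff (hK.isCompact_image_homothety _).measurableSet
  · rw [layer_eq_self hε]
    exact hK.measurableSet

lemma volume_layer (hK : IsCompact K) (hconv : Convex ℝ K) (hp : p ∈ K) {ε : ℝ} (h0 : 0 ≤ ε)
    (h1 : ε < 1) :
    volume (layer K p ε) = ENNReal.ofReal (1 - (1 - ε) ^ d) * volume K := by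
  have hsub : AffineMap.homothety p (1 - ε) '' K ⊆ K := by
    rintro _ ⟨y, hy, rfl⟩
    rw [AffineMap.homothety_eq_lineMap]
    exact hconv.lineMap_mem hp hy ⟨by linarith, by linarith⟩
  rw [layer_eq_diff h1, measure_sdiff hsub
    (hK.isCompact_image_homothety _).measurableSet.nullMeasurableSet
    (hK.isCompact_image_homothety _).measure_lt_top.ne, Measure.addHaar_image_homothety,
    finrank_euclideanSpace_fin, abs_of_nonneg (pow_nonneg (by linarith) _),
    ENNReal.ofReal_sub _ (pow_nonneg (by linarith) _), ENNReal.ofReal_one,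
    ENNReal.sub_mul (fun _ _ => hK.measure_lt_top.ne), one_mul]

lemma volume_layer_le (hd : 1 ≤ d) (hK : IsCompact K) (hconv : Convex ℝ K) (hp : p ∈ K) {ε : ℝ}
    (h0 : 0 ≤ ε) : volume (layer K p ε) ≤ ENNReal.ofReal (d * ε) * volume K := by
  by_cases h1 : ε < 1
  · rw [volume_layer hK hconv hp h0 h1]
    gcongr
    have := one_add_mul_le_pow (a := -ε) (by linarith) d
    rw [← sub_eq_add_neg] at this
    linarith
  · refine (measure_mono (layer_subset ε)).trans (le_mul_of_one_le_left (zero_le) ?_)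
    rw [ENNReal.one_le_ofReal]
    have : (1 : ℝ) ≤ d := by exact_mod_cast hd
    nlinarith

lemma le_volume_layer (hd : 1 ≤ d) (hK : IsCompact K) (hconv : Convex ℝ K) (hp : p ∈ K) {ε : ℝ}
    (h0 : 0 ≤ ε) (h1 : ε < 1) : ENNReal.ofReal ε * volume K ≤ volume (layer K p ε) := by
  rw [volume_layer hK hconv hp h0 h1]
  gcongr
  have := pow_le_of_le_one (a := 1 - ε) (by linarith) (by linarith) (by omega : d ≠ 0)
  linarith

/-- The centre `p` has depth at least `ρ₀` below every supporting hyperplane, so the shrunk copy has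
depth at least `ε * ρ₀`. -/
lemma mem_layer_of_inner_lt {ρ₀ : ℝ} (hρ₀ : 0 < ρ₀) (hball : closedBall p ρ₀ ⊆ K) {ε : ℝ}
    (h0 : 0 ≤ ε) {z u x : EuclideanSpace ℝ (Fin d)} (hz : IsOuterNormal K z u) (hx : x ∈ K)
    (h : inner ℝ (z - x) u < ε * ρ₀) : x ∈ layer K p ε := by
  refine ⟨hx, fun h1 hmem => ?_⟩
  obtain ⟨y, hy, rfl⟩ := hmem
  have hpz : ρ₀ ≤ inner ℝ (z - p) u := by
    have := hz.inner_le (p + ρ₀ • u) (hball (by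
      rw [mem_closedBall, dist_eq_norm, add_sub_cancel_left, norm_smul, hz.norm_eq, mul_one,
        Real.norm_eq_abs, abs_of_pos hρ₀]))
    rw [show p + ρ₀ • u - z = ρ₀ • u - (z - p) by abel, inner_sub_left, inner_smul_left,
      real_inner_self_eq_norm_sq, hz.norm_eq, conj_trivial] at this
    linarith
  have hyz : 0 ≤ inner ℝ (z - y) u := by
    have := hz.inner_le y hy
    rw [← neg_sub, inner_neg_left] at this
    linarith
  rw [AffineMap.homothety_apply, vsub_eq_sub, vadd_eq_add,
    show z - ((1 - ε) • (y - p) + p) = ε • (z - p) + (1 - ε) • (z - y) by module, inner_add_left,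
    inner_smul_left, inner_smul_left, conj_trivial, conj_trivial] at h
  nlinarith [mul_nonneg (by linarith : 0 ≤ 1 - ε) hyz]

lemma RollsBetween.norm_sub_le (h : RollsBetween K ρ R) (hR : 0 ≤ R)
    {z u y : EuclideanSpace ℝ (Fin d)} (hz : IsOuterNormal K z u) (hy : y ∈ K) :
    ‖z - y‖ ≤ 2 * R := by
  have h1 := h.norm_sub_sq_le hR hz hy
  have h2 := real_inner_le_norm (z - y) u
  rw [hz.norm_eq, mul_one] at h2
  rcases (norm_nonneg (z - y)).eq_or_lt with h0 | h0
  · rw [← h0]; positivity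
  · nlinarith

/-- A hyperplane separates `x` from the shrunk copy; the parallel supporting hyperplane of `K` is
above `x` by at most `ε` times the depth of `p`. Thus layers, whose volume is explicit, are
controlled by `nearBoundary`, which is suited to local estimates. -/
lemma RollsBetween.layer_subset_nearBoundary (hd : 1 ≤ d) (hK : IsCompact K) (hconv : Convex ℝ K)
    (hp : p ∈ K) (h : RollsBetween K ρ R) (hR : 0 ≤ R) {ε : ℝ} (h0 : 0 ≤ ε) :
    layer K p ε ⊆ nearBoundary K (2 * R * ε) := by
  intro x hx
  refine ⟨hx.1, ?_⟩
  have hle : ∀ {z u y}, IsOuterNormal K z u → y ∈ K → inner ℝ (z - y) u ≤ 2 * R := by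
    intro z u y hz hy
    have h2 := real_inner_le_norm (z - y) u
    rw [hz.norm_eq, mul_one] at h2
    exact h2.trans (h.norm_sub_le hR hz hy)
  by_cases h1 : ε < 1
  · obtain ⟨f, s, hf1, hf2⟩ := geometric_hahn_banach_closed_point
      (hconv.affine_image (AffineMap.homothety p (1 - ε)))
      (hK.isCompact_image_homothety (1 - ε)).isClosed (hx.2 h1)
    set w := (InnerProductSpace.toDual ℝ (EuclideanSpace ℝ (Fin d))).symm f with hw
    have hfw : ∀ y, f y = inner ℝ w y := fun y => by
      rw [hw, InnerProductSpace.toDual_symm_apply]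
    have hlt : ∀ y ∈ K, inner ℝ w (AffineMap.homothety p (1 - ε) y) < inner ℝ w x := by
      intro y hy
      rw [← hfw, ← hfw]
      exact (hf1 _ ⟨y, hy, rfl⟩).trans hf2
    have hw0 : w ≠ 0 := by
      intro h0
      have := hlt p hp
      simp [h0] at this
    have hwn : 0 < ‖w‖ := norm_pos_iff.2 hw0
    obtain ⟨z, hz⟩ := hK.exists_isOuterNormal ⟨p, hp⟩ (u := ‖w‖⁻¹ • w)
      (by rw [norm_smul, norm_inv, norm_norm, inv_mul_cancel₀ hwn.ne'])
    refine ⟨z, _, hz, ?_⟩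
    have h2 := hlt z hz.mem
    have h3 := hle hz hp
    rw [AffineMap.homothety_apply, vsub_eq_sub, vadd_eq_add,
      show (1 - ε) • (z - p) + p = x + ((z - x) - ε • (z - p)) by module, inner_add_right,
      add_lt_iff_neg_left, real_inner_comm] at h2
    have h4 : inner ℝ ((z - x) - ε • (z - p)) (‖w‖⁻¹ • w) ≤ 0 := by
      rw [inner_smul_right]
      exact mul_nonpos_of_nonneg_of_nonpos (by positivity) h2.le
    rw [inner_sub_left, inner_smul_left, conj_trivial] at h4
    nlinarith
  · have : Nonempty (Fin d) := ⟨⟨0, hd⟩⟩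
    have hu : ‖(EuclideanSpace.single (Classical.arbitrary (Fin d)) (1 : ℝ))‖ = 1 := by simp
    obtain ⟨z, hz⟩ := hK.exists_isOuterNormal ⟨p, hp⟩ hu
    exact ⟨z, _, hz, (hle hz hx.1).trans (by nlinarith)⟩

/-- At scale `s` all feet lie within order `s` of each other and the normals turn by order `s`, so
the whole piece lies at depth of order `s ^ 2` below a single supporting hyperplane. -/
lemma RollsBetween.exists_volume_nearBoundary_le (hd : 1 ≤ d) (h : RollsBetween K ρ R)
    (hρ : 0 < ρ) (hR : 0 < R) {M : ℝ} (hM : 0 ≤ M) : ∃ C, 0 < C ∧ ∀ s, 0 ≤ s → ∀ x₁,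
      volume (nearBoundary K (s ^ 2) ∩ closedBall x₁ (M * s)) ≤ ENNReal.ofReal (C * s ^ (d + 1)) := by
  -- Two distances from a point to its foot, each at most `√(2 * R) * s`, plus the diameter `2 * M *
  -- s` of the ball.
  set a := 2 * √(2 * R) + 2 * M with ha
  have ha0 : 0 < a := by positivity
  refine ⟨(1 + a ^ 2 / ρ) * (2 * a) ^ (d - 1), by positivity, fun s hs x₁ => ?_⟩
  rcases eq_empty_or_nonempty (nearBoundary K (s ^ 2) ∩ closedBall x₁ (M * s)) with he | hne
  · rw [he, measure_empty]; exact zero_le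
  have hfar : ∀ {x z u}, x ∈ K → IsOuterNormal K z u → inner ℝ (z - x) u ≤ s ^ 2 →
      ‖z - x‖ ≤ √(2 * R) * s := by
    intro x z u hx hz hi
    refine abs_le_of_sq_le_sq' ?_ (by positivity) |>.2
    rw [mul_pow, Real.sq_sqrt (by positivity)]
    exact (h.norm_sub_sq_le hR.le hz hx).trans (by gcongr)
  obtain ⟨x', ⟨hx'K, z', u', hz', hi'⟩, hx'b⟩ := hne
  have hsub : nearBoundary K (s ^ 2) ∩ closedBall x₁ (M * s) ⊆
      slab z' u' 0 ((1 + a ^ 2 / ρ) * s ^ 2) (a * s) := by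
    rintro x ⟨⟨hxK, z, u, hz, hi⟩, hxb⟩
    have h1 := hfar hx'K hz' hi'
    have h2 := hfar hxK hz hi
    have h3 : ‖x' - x‖ ≤ 2 * M * s := by
      rw [← dist_eq_norm]
      calc dist x' x ≤ dist x' x₁ + dist x x₁ := dist_triangle_right _ _ _
        _ ≤ 2 * M * s := by
          rw [mem_closedBall] at hxb hx'b; linarith
    have h4 : ‖z' - x‖ ≤ √(2 * R) * s + 2 * M * s :=
      (norm_sub_le_norm_sub_add_norm_sub z' x' x).trans (add_le_add h1 h3)
    have h4' : ‖z' - x‖ ≤ a * s := h4.trans (by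
      rw [ha]; nlinarith [Real.sqrt_nonneg (2 * R)])
    have h5 : ‖z' - z‖ ≤ a * s := by
      refine (norm_sub_le_norm_sub_add_norm_sub z' x z).trans ?_
      rw [norm_sub_rev x z]
      calc ‖z' - x‖ + ‖z - x‖ ≤ (√(2 * R) * s + 2 * M * s) + √(2 * R) * s := add_le_add h4 h2
        _ = a * s := by rw [ha]; ring
    have h6 := h.mul_norm_sub_le hρ.le hz' hz
    have hnn : 0 ≤ inner ℝ (z' - x) u' := by
      have := hz'.inner_le x hxK
      rw [← neg_sub, inner_neg_left] at this
      linarith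
    refine ⟨⟨hnn, ?_⟩, ?_⟩
    · have h7 : inner ℝ (z' - x) u' = inner ℝ (z' - z) u + inner ℝ (z - x) u
          + inner ℝ (z' - x) (u' - u) := by
        rw [inner_sub_right, ← inner_add_left, sub_add_sub_cancel]; ring
      have h8 := hz.inner_le z' hz'.mem
      have h9 := real_inner_le_norm (z' - x) (u' - u)
      have h10 : ‖u' - u‖ ≤ a * s / ρ := by
        rw [le_div_iff₀ hρ]; linarith
      have h11 : ‖z' - x‖ * ‖u' - u‖ ≤ a * s * (a * s / ρ) := by gcongr
      have h12 : a * s * (a * s / ρ) = a ^ 2 / ρ * s ^ 2 := by ring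
      linarith
    · refine abs_le_of_sq_le_sq' ?_ (by positivity) |>.2
      rw [norm_sub_sq_real, inner_smul_right, norm_smul, hz'.norm_eq, mul_one, Real.norm_eq_abs,
        sq_abs]
      nlinarith [pow_le_pow_left₀ (norm_nonneg _) h4' 2, sq_nonneg (inner ℝ (z' - x) u')]
  refine (measure_mono hsub).trans ((volume_slab_le hd hz'.norm_eq (by positivity)
    (by positivity)).trans (ENNReal.ofReal_le_ofReal (le_of_eq ?_)))
  obtain ⟨k, rfl⟩ : ∃ k, d = k + 1 := ⟨d - 1, by omega⟩
  rw [Nat.add_sub_cancel, sub_zero, ← mul_assoc 2 a s, mul_pow (2 * a) s]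
  ring

end Layer

/-! ### Caps cut off by balls of radius larger than `R`. -/

section Cap

variable {d : ℕ} {K : Set (EuclideanSpace ℝ (Fin d))} {ρ R r : ℝ}

/-- A ball of radius `r > R` through a point of `K` cuts off a cap of height `s ^ 2`, width at most
of order `s` and volume at least of order `s ^ (d + 1)`. -/
lemma RollsBetween.exists_cap_bounds (hd : 1 ≤ d) (hK : IsCompact K) (h : RollsBetween K ρ R)
    (hρ : 0 < ρ) (hρR : ρ ≤ R) (hRr : R < r) : ∃ κ > 0, ∃ C > 0, ∀ c, (∃ y ∈ K, dist y c = r) →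
      ∃ s, 0 ≤ s ∧ ENNReal.ofReal (κ * s ^ (d + 1)) ≤ volume (K \ closedBall c r) ∧
        ∃ z u, IsOuterNormal K z u ∧ ∀ x ∈ K, r ≤ dist x c →
          inner ℝ (z - x) u ≤ C * s ^ 2 ∧ ‖z - x‖ ≤ C * s := by
  have hR : 0 < R := hρ.trans_le hρR
  have hr : 0 < r := hR.trans hRr
  set θ := ρ / R with hθ
  have hθ0 : 0 < θ := by positivity
  have hθ1 : θ ≤ 1 := (div_le_one hR).2 hρR
  have hθR : θ * R = ρ := div_mul_cancel₀ _ hR.ne'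
  set C₁ := (r + R) / (r - R) with hC₁
  have hrR : 0 < r - R := sub_pos.2 hRr
  have hC₁0 : 0 < C₁ := by positivity
  have hd0 : (0 : ℝ) < √(d : ℝ) := Real.sqrt_pos.2 (by exact_mod_cast hd)
  refine ⟨θ / 4 * (2 * (√(ρ * θ / 4) / √d)) ^ (d - 1), by positivity, C₁ + √(2 * R * C₁),
    by positivity, ?_⟩
  rintro c ⟨y, hy, hyc⟩
  -- The top of the cap is the point of `K` farthest from `c`, with the radial direction as normal.
  -- Its excess `t` over `r` is the height, so the scale is `s = √t`.
  obtain ⟨z, hz, hmax⟩ := hK.exists_isMaxOn ⟨y, hy⟩ (f := fun x => dist x c) (by fun_prop)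
  have hmax : ∀ x ∈ K, dist x c ≤ dist z c := hmax
  have hzr : r ≤ dist z c := hyc ▸ hmax y hy
  have hzpos : 0 < dist z c := hr.trans_le hzr
  set u := (dist z c)⁻¹ • (z - c) with hu
  have hzu : IsOuterNormal K z u := isOuterNormal_of_farthest hz hmax hzpos
  set t := dist z c - r with ht
  have ht0 : 0 ≤ t := sub_nonneg.2 hzr
  have ht2 : t ≤ 2 * R := by
    have h1 := h.norm_sub_le hR.le hzu hy
    have h2 := dist_triangle z y c
    rw [← dist_eq_norm] at h1
    linarith
  have hzc : z - c = (r + t) • u := by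
    rw [hu, smul_smul, show r + t = dist z c by rw [ht]; ring, mul_inv_cancel₀ hzpos.ne', one_smul]
  have hdist : ∀ x, dist x c ^ 2 = (r + t) ^ 2 - 2 * (r + t) * inner ℝ (z - x) u + ‖z - x‖ ^ 2 := by
    intro x
    rw [dist_eq_norm, show x - c = (z - c) - (z - x) by abel, norm_sub_sq_real, hzc,
      inner_smul_left, norm_smul, hzu.norm_eq, real_inner_comm]
    simp only [conj_trivial, mul_one, Real.norm_eq_abs, sq_abs]
    ring
  have hsq : √t ^ 2 = t := Real.sq_sqrt ht0
  refine ⟨√t, Real.sqrt_nonneg _, ?_, z, u, hzu, ?_⟩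
  · rcases ht0.eq_or_lt with h0 | htpos
    · rw [← h0]; simp
    -- The slab is thin enough to stay outside `closedBall c r` and, by its minimal depth, narrow
    -- enough to lie in the inner ball of radius `ρ`.
    have hsub : slab z u (θ * t / 4) (θ * t / 2) √(ρ * θ * t / 4) ⊆ K \ closedBall c r := by
      rintro x ⟨⟨h1, h2⟩, h3⟩
      set a := inner ℝ (z - x) u with ha
      have h4 : ‖z - x - a • u‖ ^ 2 ≤ ρ * θ * t / 4 := by
        have := pow_le_pow_left₀ (norm_nonneg _) h3 2
        rwa [Real.sq_sqrt (by positivity)] at this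
      have h5 : ‖z - x‖ ^ 2 = a ^ 2 + ‖z - x - a • u‖ ^ 2 := by
        rw [norm_sub_sq_real (z - x), inner_smul_right, norm_smul, hzu.norm_eq, mul_one,
          Real.norm_eq_abs, sq_abs, ← ha]
        ring
      have ha0 : 0 < a := lt_of_lt_of_le (by positivity) h1
      have haρ : a ≤ ρ := by nlinarith
      have hat : a ≤ t / 2 := by nlinarith
      constructor
      · refine h.mem_of_norm_sq_le hρ.le hzu ?_
        rw [h5, ← ha]
        nlinarith
      · rw [mem_closedBall, not_le]
        refine lt_of_pow_lt_pow_left₀ 2 dist_nonneg ?_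
        rw [hdist x, ← ha, h5]
        nlinarith [sq_nonneg ‖z - x - a • u‖]
    refine le_trans (le_trans (le_of_eq ?_) (le_volume_slab hd hzu.norm_eq
      (by nlinarith [mul_pos hθ0 htpos]) (Real.sqrt_nonneg _))) (measure_mono hsub)
    congr 1
    obtain ⟨k, rfl⟩ : ∃ k, d = k + 1 := ⟨d - 1, by omega⟩
    rw [Nat.add_sub_cancel, show ρ * θ * t / 4 = ρ * θ / 4 * t by ring,
      Real.sqrt_mul (by positivity), show k + 1 + 1 = k + 2 by ring, pow_add, hsq,
      show 2 * (√(ρ * θ / 4) * √t / √((k + 1 : ℕ) : ℝ)) =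
        2 * (√(ρ * θ / 4) / √((k + 1 : ℕ) : ℝ)) * √t by ring, mul_pow _ (√t)]
    ring
  · intro x hx hxr
    have h1 := h.norm_sub_sq_le hR.le hzu hx
    have h2 := pow_le_pow_left₀ hr.le hxr 2
    rw [hdist x] at h2
    -- Here `R < r` enters: the outer ball bounds `‖z - x‖ ^ 2` by `2 * R` times the depth, while
    -- lying outside the `r`-ball demands almost `2 * r` times the depth. The bound `t ≤ 2 * R`
    -- gives the form of `C₁`.
    have h3 : inner ℝ (z - x) u ≤ C₁ * t := by
      rw [hC₁, div_mul_eq_mul_div, le_div_iff₀ hrR]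
      have ha0 : 0 ≤ inner ℝ (z - x) u := by nlinarith [sq_nonneg ‖z - x‖]
      nlinarith [mul_nonneg ht0 ha0]
    constructor
    · rw [hsq, add_mul]
      exact h3.trans (le_add_of_nonneg_right (by positivity))
    · have h4 : ‖z - x‖ ≤ √(2 * R * C₁) * √t := by
        rw [← Real.sqrt_mul (by positivity)]
        refine Real.le_sqrt_of_sq_le (h1.trans ?_)
        calc 2 * R * inner ℝ (z - x) u ≤ 2 * R * (C₁ * t) :=
              mul_le_mul_of_nonneg_left h3 (by positivity)
          _ = 2 * R * C₁ * t := by ring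
      rw [add_mul]
      exact h4.trans (le_add_of_nonneg_left (by positivity))

end Cap

/-! ### Projections of locally closed sets. -/

section Measurability

/-- An open set is a countable union of closed sets, so the intersection is σ-compact, and so is its
projection. It serves conditions on centres: contact is closed, linear independence is open. -/
lemma measurableSet_exists_closed_inter_open {X Y : Type*} [MetricSpace X] [ProperSpace X]
    [MeasurableSpace X] [BorelSpace X] [MetricSpace Y] [ProperSpace Y] {A B : Set (X × Y)}
    (hA : IsClosed A) (hB : IsOpen B) : MeasurableSet {x | ∃ y, (x, y) ∈ A ∩ B} := by
  obtain ⟨F, hF, -, hFB, -⟩ := hB.exists_iUnion_isClosed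
  have himg : {x | ∃ y, (x, y) ∈ A ∩ B} = ⋃ n, Prod.fst '' (A ∩ F n) := by
    ext x
    rw [← hFB]
    simp only [mem_ofPred_eq, mem_inter_iff, mem_iUnion, mem_image, Prod.exists, exists_and_right,
      exists_eq_right]
    constructor
    · rintro ⟨y, h1, n, h2⟩
      exact ⟨n, y, h1, h2⟩
    · rintro ⟨n, y, h1, h2⟩
      exact ⟨y, h1, n, h2⟩
  rw [himg]
  refine MeasurableSet.iUnion fun n => ?_
  obtain ⟨κ, hκ, hκU⟩ := (isSigmaCompact_univ.of_isClosed_subset (hA.inter (hF n))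
    (subset_univ _)).image continuous_fst
  rw [← hκU]
  exact MeasurableSet.iUnion fun j => (hκ j).measurableSet

end Measurability

/-! ### Spheres through `d` given points. -/

section ThroughCenters

variable {d : ℕ} {ι : Type*} {r : ℝ}

/-- The centres of the radius-`r` balls with all the points `y i` on the boundary, in linearly
independent directions. -/
def throughCenters (r : ℝ) (y : ι → EuclideanSpace ℝ (Fin d)) : Set (EuclideanSpace ℝ (Fin d)) :=
  {c | (∀ i, dist (y i) c = r) ∧ LinearIndependent ℝ fun i => y i - c}

/-- Relative to one centre `c`, any other centre `a` has product `‖a - c‖ ^ 2 / 2` with each vector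
of the basis `y i - c`. Hence `a - c` divided by its squared norm is determined, and so is `a`. -/
lemma encard_throughCenters_le [Fintype ι] (hι : Fintype.card ι = d)
    (y : ι → EuclideanSpace ℝ (Fin d)) : (throughCenters r y).encard ≤ 2 := by
  rcases (throughCenters r y).eq_empty_or_nonempty with he | ⟨c, hc⟩
  · rw [he, encard_empty]; exact zero_le
  have hspan : Submodule.span ℝ (range fun i => y i - c) = ⊤ :=
    hc.2.span_eq_top_of_card_eq_finrank' (by rw [hι, finrank_euclideanSpace_fin])
  have hinner : ∀ a ∈ throughCenters r y, ∀ i, 2 * inner ℝ (y i - c) (a - c) = ‖a - c‖ ^ 2 := by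
    intro a ha i
    have h1 := dist_add_smul_sq (y i) c (a - c) 1
    rw [one_smul, add_sub_cancel, ha.1 i, hc.1 i] at h1
    linarith
  have hone : (throughCenters r y \ {c}).encard ≤ 1 := by
    rw [encard_le_one_iff]
    rintro a b ⟨ha, hac⟩ ⟨hb, hbc⟩
    have hz : ‖b - c‖ ^ 2 • (a - c) - ‖a - c‖ ^ 2 • (b - c) = 0 := by
      refine (Submodule.eq_bot_iff _).1 (Submodule.top_orthogonal_eq_bot (𝕜 := ℝ)) _ ?_
      rw [← hspan, Submodule.mem_orthogonal]
      intro v hv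
      induction hv using Submodule.span_induction with
      | mem v hv =>
        obtain ⟨i, rfl⟩ := hv
        rw [inner_sub_right, inner_smul_right, inner_smul_right]
        linear_combination (‖b - c‖ ^ 2 / 2) * hinner a ha i - (‖a - c‖ ^ 2 / 2) * hinner b hb i
      | zero => simp
      | add v w _ _ hv hw => rw [inner_add_left, hv, hw, add_zero]
      | smul t v _ hv => rw [inner_smul_left, hv, mul_zero]
    have ha0 : 0 < ‖a - c‖ := norm_pos_iff.2 (sub_ne_zero.2 hac)
    have hb0 : 0 < ‖b - c‖ := norm_pos_iff.2 (sub_ne_zero.2 hbc)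
    rw [sub_eq_zero] at hz
    have hn := congrArg norm hz
    rw [norm_smul, norm_smul, norm_pow, norm_pow, norm_norm, norm_norm] at hn
    have heq : ‖a - c‖ = ‖b - c‖ := by
      have : ‖a - c‖ * ‖b - c‖ * (‖b - c‖ - ‖a - c‖) = 0 := by linear_combination hn
      rcases mul_eq_zero.1 this with h | h
      · exact absurd h (by positivity)
      · linarith
    rw [heq] at hz
    exact sub_left_injective (smul_right_injective _ (pow_ne_zero 2 hb0.ne') hz)
  calc (throughCenters r y).encard ≤ (throughCenters r y \ {c}).encard + ({c} : Set _).encard :=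
        encard_le_encard_sdiff_add_encard _ _
    _ ≤ 1 + 1 := by rw [encard_singleton]; gcongr
    _ = 2 := by norm_num

lemma mem_facetCenters_iff {n : ℕ} {x : Fin n → EuclideanSpace ℝ (Fin d)}
    {c : EuclideanSpace ℝ (Fin d)} :
    c ∈ facetCenters r x ↔ (∀ i, dist (x i) c ≤ r) ∧
      ∃ S : Finset (Fin n), S.card = d ∧ c ∈ throughCenters r fun i : S => x i := by
  simp [facetCenters, throughCenters, LinearIndepOn]

/-- The configurations whose points with index in `S` determine a facet. -/
def facetEvent {n : ℕ} (r : ℝ) (S : Finset (Fin n)) : Set (Fin n → EuclideanSpace ℝ (Fin d)) :=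
  {x | ∃ c ∈ throughCenters r fun i : S => x i, ∀ i, dist (x i) c ≤ r}

lemma encard_facetCenters_le {n : ℕ} (x : Fin n → EuclideanSpace ℝ (Fin d)) :
    ((facetCenters r x).encard : ℝ≥0∞) ≤
      ∑ S ∈ Finset.powersetCard d (Finset.univ : Finset (Fin n)),
        (facetEvent r S).indicator (fun _ => 2) x := by
  classical
  have hsub : facetCenters r x ⊆ ⋃ S ∈ Finset.powersetCard d (Finset.univ : Finset (Fin n)),
      {c ∈ throughCenters r fun i : S => x i | ∀ i, dist (x i) c ≤ r} := by
    intro c hc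
    obtain ⟨h1, S, hS, h2⟩ := mem_facetCenters_iff.1 hc
    simp only [mem_iUnion]
    exact ⟨S, Finset.mem_powersetCard.2 ⟨Finset.subset_univ _, hS⟩, h2, h1⟩
  have h1 : Measure.count (facetCenters r x) ≤ _ := (measure_mono hsub).trans
    (measure_biUnion_finset_le _ _)
  have hcount : ∀ s : Set (EuclideanSpace ℝ (Fin d)), Measure.count s = (s.encard : ℝ≥0∞) :=
    fun s => by
      by_cases hs : s.Finite
      · exact Measure.count_apply hs.measurableSet
      · rw [Measure.count_apply_infinite hs, encard_eq_top hs, ENat.toENNReal_top]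
  rw [hcount] at h1
  refine h1.trans (Finset.sum_le_sum fun S hS => ?_)
  by_cases hx : x ∈ facetEvent r S
  · rw [indicator_of_mem hx, hcount]
    have h2 := (encard_le_encard (sep_subset (throughCenters r fun i : S => x i)
      fun c => ∀ i, dist (x i) c ≤ r)).trans
      (encard_throughCenters_le (by rw [Fintype.card_coe]; exact (Finset.mem_powersetCard.1 hS).2) _)
    exact_mod_cast ENat.toENNReal_le.2 h2
  · rw [indicator_of_notMem hx, nonpos_iff_eq_zero]
    have : {c ∈ throughCenters r fun i : S => x i | ∀ i, dist (x i) c ≤ r} = ∅ := by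
      rw [eq_empty_iff_forall_notMem]
      rintro c ⟨h2, h3⟩
      exact hx ⟨c, h2, h3⟩
    rw [this, measure_empty]

end ThroughCenters

/-! ### Conditioning on some of the independent points. -/

section Pi

variable {d : ℕ}

lemma measurePreserving_pi_split {ι E : Type*} [Fintype ι] [MeasurableSpace E] (ν : Measure E)
    [SigmaFinite ν] (p : ι → Prop) [DecidablePred p] [Fintype {i // p i}]
    [Fintype {i // ¬ p i}] :
    MeasurePreserving (MeasurableEquiv.piEquivPiSubtypeProd (fun _ : ι => E) p)
      (Measure.pi fun _ => ν) ((Measure.pi fun _ => ν).prod (Measure.pi fun _ => ν)) := by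
  convert measurePreserving_piEquivPiSubtypeProd (fun _ : ι => ν) p

/-- Fubini: given the point with index `i₀`, the others independently hit a set of measure at most
`b`. -/
lemma measure_pi_star_le {ι : Type*} [Fintype ι] (i₀ : ι)
    (ν : Measure (EuclideanSpace ℝ (Fin d))) [IsProbabilityMeasure ν]
    {L : Set (EuclideanSpace ℝ (Fin d))} (hL : MeasurableSet L) {D : ℝ} {b : ℝ≥0∞}
    (hb : ∀ a, ν (L ∩ closedBall a D) ≤ b) :
    Measure.pi (fun _ : ι => ν) {y | ∀ i, y i ∈ L ∩ closedBall (y i₀) D} ≤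
      ν L * b ^ (Fintype.card ι - 1) := by
  classical
  let e := MeasurableEquiv.piEquivPiSubtypeProd (fun _ : ι => EuclideanSpace ℝ (Fin d))
    (fun i => i = i₀)
  have he := measurePreserving_pi_split (ι := ι) ν (fun i => i = i₀)
  let G : Set (({i : ι // i = i₀} → EuclideanSpace ℝ (Fin d)) ×
      ({i : ι // ¬ i = i₀} → EuclideanSpace ℝ (Fin d))) :=
    {q | q.1 ⟨i₀, rfl⟩ ∈ L ∧ ∀ i, q.2 i ∈ L ∧ dist (q.2 i) (q.1 ⟨i₀, rfl⟩) ≤ D}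
  have hG : MeasurableSet G := by
    refine MeasurableSet.inter (hL.preimage (by fun_prop)) ?_
    refine measurableSet_setOfPred.2 (Measurable.forall fun i => ?_)
    have h1 : Measurable fun q : ({i : ι // i = i₀} → EuclideanSpace ℝ (Fin d)) ×
        ({i : ι // ¬ i = i₀} → EuclideanSpace ℝ (Fin d)) => q.2 i := by fun_prop
    have h2 : Measurable fun q : ({i : ι // i = i₀} → EuclideanSpace ℝ (Fin d)) ×
        ({i : ι // ¬ i = i₀} → EuclideanSpace ℝ (Fin d)) => dist (q.2 i) (q.1 ⟨i₀, rfl⟩) := by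
      fun_prop
    exact measurableSet_setOfPred.1 ((hL.preimage h1).inter (measurableSet_le h2 measurable_const))
  have hsub : {y : ι → EuclideanSpace ℝ (Fin d) | ∀ i, y i ∈ L ∩ closedBall (y i₀) D} ⊆ e ⁻¹' G :=
    fun y hy => ⟨(hy i₀).1, fun i => hy i⟩
  refine (measure_mono hsub).trans ?_
  rw [he.measure_preimage hG.nullMeasurableSet, Measure.prod_apply hG]
  calc ∫⁻ a, Measure.pi (fun _ : {i : ι // ¬ i = i₀} => ν) (Prod.mk a ⁻¹' G)
        ∂Measure.pi (fun _ : {i : ι // i = i₀} => ν)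
      ≤ ∫⁻ a, ((fun a : {i : ι // i = i₀} → EuclideanSpace ℝ (Fin d) => a ⟨i₀, rfl⟩) ⁻¹' L).indicator
          (fun _ => b ^ (Fintype.card ι - 1)) a ∂Measure.pi (fun _ : {i : ι // i = i₀} => ν) := by
        refine lintegral_mono fun a => ?_
        by_cases ha : a ⟨i₀, rfl⟩ ∈ L
        · rw [indicator_of_mem (by exact ha)]
          have hs : Prod.mk a ⁻¹' G ⊆ univ.pi fun _ => L ∩ closedBall (a ⟨i₀, rfl⟩) D :=
            fun z hz i _ => hz.2 i
          refine (measure_mono hs).trans ?_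
          rw [Measure.pi_pi]
          refine (Finset.prod_le_prod' fun i _ => hb _).trans (le_of_eq ?_)
          rw [Finset.prod_const, Finset.card_univ, Fintype.card_subtype_compl,
            Fintype.card_subtype_eq]
        · have hs : Prod.mk a ⁻¹' G = ∅ := by
            rw [eq_empty_iff_forall_notMem]
            exact fun z hz => ha hz.1
          rw [hs, measure_empty]
          exact zero_le
    _ = ν L * b ^ (Fintype.card ι - 1) := by
        rw [lintegral_indicator (hL.preimage (by fun_prop)), setLIntegral_const,
          (measurePreserving_eval (fun _ : {i : ι // i = i₀} => ν) ⟨i₀, rfl⟩).measure_preimage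
            hL.nullMeasurableSet, mul_comm]

/-- Given the points indexed by `S`, at most two balls are candidates, and the other `n - d` points
fall into each of them independently. -/
lemma measure_facetEvent_le {n : ℕ} {r : ℝ} (S : Finset (Fin n)) (hS : S.card = d)
    (ν : Measure (EuclideanSpace ℝ (Fin d))) [IsProbabilityMeasure ν]
    {b : (S → EuclideanSpace ℝ (Fin d)) → ℝ≥0∞}
    (hb : ∀ᵐ y ∂Measure.pi fun _ : S => ν, ∀ c ∈ throughCenters r y,
      ν (closedBall c r) ^ (n - d) ≤ b y) :
    Measure.pi (fun _ : Fin n => ν) (facetEvent r S) ≤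
      2 * ∫⁻ y, b y ∂Measure.pi fun _ : S => ν := by
  classical
  let e := MeasurableEquiv.piEquivPiSubtypeProd (fun _ : Fin n => EuclideanSpace ℝ (Fin d))
    (fun i => i ∈ S)
  have he := measurePreserving_pi_split (ι := Fin n) ν (fun i => i ∈ S)
  let G : Set (({i // i ∈ S} → EuclideanSpace ℝ (Fin d)) ×
      ({i // ¬ i ∈ S} → EuclideanSpace ℝ (Fin d))) :=
    {q | ∃ c ∈ throughCenters r q.1, ∀ i, dist (q.2 i) c ≤ r}
  have hG : MeasurableSet G := by
    let A : Set ((({i // i ∈ S} → EuclideanSpace ℝ (Fin d)) ×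
      ({i // ¬ i ∈ S} → EuclideanSpace ℝ (Fin d))) × EuclideanSpace ℝ (Fin d)) :=
      {q | (∀ i, dist (q.1.1 i) q.2 = r) ∧ ∀ i, dist (q.1.2 i) q.2 ≤ r}
    let B : Set ((({i // i ∈ S} → EuclideanSpace ℝ (Fin d)) ×
      ({i // ¬ i ∈ S} → EuclideanSpace ℝ (Fin d))) × EuclideanSpace ℝ (Fin d)) :=
      {q | LinearIndependent ℝ fun i => q.1.1 i - q.2}
    have hA : IsClosed A := by
      have : A = (⋂ i, {q | dist (q.1.1 i) q.2 = r}) ∩ ⋂ i, {q | dist (q.1.2 i) q.2 ≤ r} := by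
        ext q; simp [A]
      rw [this]
      exact (isClosed_iInter fun i => isClosed_eq (by fun_prop) continuous_const).inter
        (isClosed_iInter fun i => isClosed_le (by fun_prop) continuous_const)
    have hB : IsOpen B := isOpen_setOfPred_linearIndependent.preimage
      (f := fun q : (({i // i ∈ S} → EuclideanSpace ℝ (Fin d)) ×
      ({i // ¬ i ∈ S} → EuclideanSpace ℝ (Fin d))) × EuclideanSpace ℝ (Fin d) =>
        fun i => q.1.1 i - q.2) (by fun_prop)
    convert measurableSet_exists_closed_inter_open hA hB using 1
    ext q
    constructor
    · rintro ⟨c, ⟨h1, h2⟩, h3⟩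
      exact ⟨c, ⟨h1, h3⟩, h2⟩
    · rintro ⟨c, ⟨h1, h3⟩, h2⟩
      exact ⟨c, ⟨h1, h2⟩, h3⟩
  have hsub : facetEvent r S ⊆ e ⁻¹' G := by
    rintro x ⟨c, hc, h⟩
    exact ⟨c, hc, fun i => h i⟩
  refine (measure_mono hsub).trans ?_
  rw [he.measure_preimage hG.nullMeasurableSet, Measure.prod_apply hG,
    ← lintegral_const_mul' _ _ (by norm_num)]
  refine lintegral_mono_ae ?_
  filter_upwards [hb] with y hy
  have hs : Prod.mk y ⁻¹' G ⊆ ⋃ c ∈ throughCenters r y, univ.pi fun _ => closedBall c r := by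
    rintro z ⟨c, hc, hz⟩
    exact mem_biUnion hc fun i _ => hz i
  have hcard := encard_throughCenters_le (r := r) (by rw [Fintype.card_coe, hS]) y
  have hfin : (throughCenters r y).Finite := finite_of_encard_le_coe (k := 2) hcard
  refine (measure_mono hs).trans ((measure_biUnion_le _ hfin.countable _).trans ?_)
  calc ∑' c : throughCenters r y, Measure.pi (fun _ : {i // ¬ i ∈ S} => ν)
        (univ.pi fun _ => closedBall c.1 r)
      ≤ ∑' _ : throughCenters r y, b y := by
        refine ENNReal.tsum_le_tsum fun c => ?_
        rw [Measure.pi_pi, Finset.prod_const, Finset.card_univ, Fintype.card_subtype_compl,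
          Fintype.card_fin, Fintype.card_coe, hS]
        exact hy c c.2
    _ ≤ 2 * b y := by
        rw [ENNReal.tsum_set_const]
        gcongr
        exact_mod_cast ENat.toENNReal_le.2 hcard

end Pi

/-! ### Uniform points and the upper bound. -/

section Uniform

variable {d : ℕ} {K : Set (EuclideanSpace ℝ (Fin d))} {p : EuclideanSpace ℝ (Fin d)} {ρ₀ ρ R r : ℝ}

/-- A convex body containing the ball of radius `ρ₀` around `p`, in which balls of radius `ρ` roll
freely and which rolls freely in balls of radius `R`. -/
structure IsRollingBody (K : Set (EuclideanSpace ℝ (Fin d))) (p : EuclideanSpace ℝ (Fin d))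
    (ρ₀ ρ R : ℝ) : Prop where
  one_le : 1 ≤ d
  isCompact : IsCompact K
  convex : Convex ℝ K
  pos₀ : 0 < ρ₀
  ball_subset : closedBall p ρ₀ ⊆ K
  rolls : RollsBetween K ρ R
  pos : 0 < ρ
  le : ρ ≤ R

namespace IsRollingBody

variable (hK : IsRollingBody K p ρ₀ ρ R)
include hK

lemma pos_R : 0 < R := hK.pos.trans_le hK.le

lemma center_mem : p ∈ K := hK.ball_subset (mem_closedBall_self hK.pos₀.le)

lemma measureReal_pos : 0 < volume.real K := by
  refine ENNReal.toReal_pos ?_ hK.isCompact.measure_lt_top.ne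
  exact ((measure_closedBall_pos volume p hK.pos₀).trans_le (measure_mono hK.ball_subset)).ne'

lemma volume_eq : volume K = ENNReal.ofReal (volume.real K) :=
  (ofReal_measureReal hK.isCompact.measure_lt_top.ne).symm

lemma volume_ne_zero : volume K ≠ 0 := by
  rw [hK.volume_eq]
  exact (ENNReal.ofReal_pos.2 hK.measureReal_pos).ne'

lemma isProbabilityMeasure : IsProbabilityMeasure (ProbabilityTheory.cond volume K) :=
  ProbabilityTheory.cond_isProbabilityMeasure_of_finite hK.volume_ne_zero
    hK.isCompact.measure_lt_top.ne

lemma cond_le {A : Set (EuclideanSpace ℝ (Fin d))} {a : ℝ}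
    (h : volume A ≤ ENNReal.ofReal a) :
    ProbabilityTheory.cond volume K A ≤ ENNReal.ofReal (a / volume.real K) := by
  rw [ProbabilityTheory.cond_apply hK.isCompact.measurableSet, hK.volume_eq,
    ← ENNReal.ofReal_inv_of_pos hK.measureReal_pos, div_eq_inv_mul,
    ENNReal.ofReal_mul (inv_nonneg.2 hK.measureReal_pos.le)]
  gcongr
  exact (measure_mono inter_subset_right).trans h

lemma le_cond {A : Set (EuclideanSpace ℝ (Fin d))} {a : ℝ}
    (h : ENNReal.ofReal a ≤ volume (K ∩ A)) :
    ENNReal.ofReal (a / volume.real K) ≤ ProbabilityTheory.cond volume K A := by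
  rw [ProbabilityTheory.cond_apply hK.isCompact.measurableSet, hK.volume_eq,
    ← ENNReal.ofReal_inv_of_pos hK.measureReal_pos, div_eq_inv_mul,
    ENNReal.ofReal_mul (inv_nonneg.2 hK.measureReal_pos.le)]
  gcongr

lemma ae_forall_mem (ι : Type*) [Fintype ι] :
    ∀ᵐ y ∂Measure.pi (fun _ : ι => ProbabilityTheory.cond volume K), ∀ i, y i ∈ K := by
  have := hK.isProbabilityMeasure
  rw [ae_all_iff]
  intro i
  exact (measurePreserving_eval (fun _ : ι => ProbabilityTheory.cond volume K)
    i).quasiMeasurePreserving.ae (ProbabilityTheory.ae_cond_mem hK.isCompact.measurableSet)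

/-- The exponent is `2 + (d + 1) * (d - 1)`: one point in a layer of thickness of order `s ^ 2`, the
other `d - 1` in pieces of volume of order `s ^ (d + 1)`. -/
lemma exists_measure_star_le {a b : ℝ} (ha : 0 < a) (hb : 0 ≤ b) : ∃ C, 0 < C ∧
    ∀ s, 0 ≤ s → ∀ (ι : Type) [Fintype ι] (i₀ : ι), Fintype.card ι = d →
      Measure.pi (fun _ : ι => ProbabilityTheory.cond volume K)
        {y | ∀ i, y i ∈ layer K p (a * s ^ 2) ∩ closedBall (y i₀) (b * s)} ≤
      ENNReal.ofReal (C * s ^ (d ^ 2 + 1)) := by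
  have := hK.isProbabilityMeasure
  have hv := hK.measureReal_pos
  have hR := hK.pos_R
  have hd0 : (0 : ℝ) < d := by exact_mod_cast hK.one_le
  set g := √(2 * R * a) with hg
  have hg0 : 0 < g := Real.sqrt_pos.2 (by positivity)
  obtain ⟨C, hC0, hC⟩ := hK.rolls.exists_volume_nearBoundary_le hK.one_le hK.pos hR
    (M := b / g) (by positivity)
  refine ⟨d * a * (C * g ^ (d + 1) / volume.real K) ^ (d - 1), by positivity,
    fun s hs ι _ i₀ hι => ?_⟩
  have hball : ∀ y, ProbabilityTheory.cond volume K (layer K p (a * s ^ 2) ∩ closedBall y (b * s))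
      ≤ ENNReal.ofReal (C * (g * s) ^ (d + 1) / volume.real K) := by
    intro y
    refine hK.cond_le (le_trans (measure_mono ?_) (hC (g * s) (by positivity) y))
    rw [show b / g * (g * s) = b * s by field_simp]
    refine inter_subset_inter_left _ ?_
    rw [mul_pow, hg, Real.sq_sqrt (by positivity), mul_assoc (2 * R) a]
    exact hK.rolls.layer_subset_nearBoundary hK.one_le hK.isCompact hK.convex hK.center_mem hR.le
      (by positivity)
  have hlayer : ProbabilityTheory.cond volume K (layer K p (a * s ^ 2)) ≤
      ENNReal.ofReal (d * (a * s ^ 2)) := by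
    have h1 := volume_layer_le hK.one_le hK.isCompact hK.convex hK.center_mem
      (ε := a * s ^ 2) (by positivity)
    rw [hK.volume_eq, ← ENNReal.ofReal_mul (by positivity)] at h1
    have h2 := hK.cond_le h1
    rwa [mul_div_assoc, div_self hv.ne', mul_one] at h2
  refine (measure_pi_star_le i₀ _ (hK.isCompact.measurableSet_layer _) hball).trans ?_
  rw [hι, ← ENNReal.ofReal_pow (by positivity)]
  refine (mul_le_mul_left hlayer _).trans ?_
  rw [← ENNReal.ofReal_mul (by positivity)]
  refine ENNReal.ofReal_le_ofReal (le_of_eq ?_)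
  obtain ⟨k, rfl⟩ : ∃ k, d = k + 1 := ⟨d - 1, by have := hK.one_le; omega⟩
  rw [Nat.add_sub_cancel, show (k + 1) ^ 2 + 1 = 2 + (k + 1 + 1) * k by ring, pow_add s 2,
    pow_mul s, mul_pow g s, show C * (g ^ (k + 1 + 1) * s ^ (k + 1 + 1)) / volume.real K =
      C * g ^ (k + 1 + 1) / volume.real K * s ^ (k + 1 + 1) by ring, mul_pow _ (s ^ (k + 1 + 1))]
  ring

lemma cond_closedBall_pow_le {c : EuclideanSpace ℝ (Fin d)} {a : ℝ} (ha : 0 ≤ a)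
    (h : ENNReal.ofReal a ≤ volume (K \ closedBall c r)) (m : ℕ) :
    ProbabilityTheory.cond volume K (closedBall c r) ^ m ≤
      ENNReal.ofReal (Real.exp (-(m * (a / volume.real K)))) := by
  have := hK.isProbabilityMeasure
  have h1 := hK.le_cond (A := (closedBall c r)ᶜ) (by rwa [← sdiff_eq])
  rw [prob_compl_eq_one_sub measurableSet_closedBall] at h1
  have h2 : ProbabilityTheory.cond volume K (closedBall c r) ≤
      ENNReal.ofReal (Real.exp (-(a / volume.real K))) := by
    calc ProbabilityTheory.cond volume K (closedBall c r)
        = 1 - (1 - ProbabilityTheory.cond volume K (closedBall c r)) :=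
          (ENNReal.sub_sub_cancel ENNReal.one_ne_top prob_le_one).symm
      _ ≤ 1 - ENNReal.ofReal (a / volume.real K) := tsub_le_tsub_left h1 _
      _ = ENNReal.ofReal (1 - a / volume.real K) := by
          rw [ENNReal.ofReal_sub _ (div_nonneg ha hK.measureReal_pos.le), ENNReal.ofReal_one]
      _ ≤ _ := ENNReal.ofReal_le_ofReal (Real.one_sub_le_exp_neg _)
  refine (pow_le_pow_left' h2 m).trans (le_of_eq ?_)
  rw [← ENNReal.ofReal_pow (Real.exp_pos _).le, ← Real.exp_nat_mul, mul_neg]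

/-- The probability that `d` given points determine a facet. -/
lemma exists_measure_facetEvent_le (hr : R < r) : ∃ C, 0 < C ∧
    ∀ (n : ℕ) (S : Finset (Fin n)), S.card = d → ∀ q, 0 < q → q ^ (d + 1) * ((n - d : ℕ) : ℝ) = 1 →
      uniformSample K n (facetEvent r S) ≤ ENNReal.ofReal (C * q ^ (d ^ 2 + 1)) := by
  have := hK.isProbabilityMeasure
  have hv := hK.measureReal_pos
  have hd := hK.one_le
  obtain ⟨κ, hκ, C, hC, hcap⟩ := hK.rolls.exists_cap_bounds hd hK.isCompact hK.pos hK.le hr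
  obtain ⟨C', hC', hstar⟩ := hK.exists_measure_star_le (a := C / ρ₀) (b := 2 * C)
    (div_pos hC hK.pos₀) (by positivity)
  set κ' := κ / volume.real K with hκ'
  have hκ'0 : 0 < κ' := by positivity
  have hsum : Summable fun k : ℕ => Real.exp (-(κ' * k)) * ((k : ℝ) + 1) ^ d := by
    have h1 := (summable_nat_add_iff 1).2 (Real.summable_pow_mul_exp_neg_nat_mul d hκ'0)
    refine (h1.mul_left (Real.exp κ')).congr fun k => ?_
    push_cast
    rw [mul_left_comm, ← Real.exp_add, mul_comm]
    congr 2
    ring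
  set A := ∑' k : ℕ, Real.exp (-(κ' * k)) * ((k : ℝ) + 1) ^ d with hA
  have hA0 : 0 < A := hsum.tsum_pos (fun k => by positivity) 0 (by positivity)
  refine ⟨2 * (C' * A), by positivity, fun n S hS q hq hqm => ?_⟩
  set m := n - d with hm
  -- Scales are sorted by `k = ⌊m * s ^ (d + 1)⌋`; level `k` then means `s < w k * q`. Its cap is
  -- missed with probability at most `exp (-(κ' * k))`.
  let w : ℕ → ℝ := fun k => ((k : ℝ) + 1) ^ (((d + 1 : ℕ) : ℝ)⁻¹)
  have hw : ∀ k, w k ^ (d + 1) = (k : ℝ) + 1 := fun k =>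
    Real.rpow_inv_natCast_pow (by positivity) (by omega)
  have hw1 : ∀ k, 1 ≤ w k := fun k => Real.one_le_rpow (by simp) (by positivity)
  have hne : S.Nonempty := by rw [← Finset.card_pos]; omega
  let i₀ : S := ⟨hne.choose, hne.choose_spec⟩
  let T : ℕ → Set (S → EuclideanSpace ℝ (Fin d)) := fun k =>
    {y | ∀ i, y i ∈ layer K p (C / ρ₀ * (w k * q) ^ 2) ∩ closedBall (y i₀) (2 * C * (w k * q))}
  set π := Measure.pi fun _ : S => ProbabilityTheory.cond volume K with hπ
  have hT : ∀ k, π (T k) ≤ ENNReal.ofReal (C' * (w k * q) ^ (d ^ 2 + 1)) := fun k =>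
    hstar (w k * q) (by have := hw1 k; positivity) S i₀ (by rw [Fintype.card_coe, hS])
  let b : (S → EuclideanSpace ℝ (Fin d)) → ℝ≥0∞ := fun y =>
    ∑' k : ℕ, (toMeasurable π (T k)).indicator
      (fun _ => ENNReal.ofReal (Real.exp (-(κ' * k)))) y
  have hb : ∀ᵐ y ∂π, ∀ c ∈ throughCenters r y,
      ProbabilityTheory.cond volume K (closedBall c r) ^ (n - d) ≤ b y := by
    filter_upwards [hK.ae_forall_mem S] with y hyK c hc
    obtain ⟨s, hs, hvol, z, u, hz, hin⟩ := hcap c ⟨y i₀, hyK i₀, hc.1 i₀⟩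
    set k := ⌊m * s ^ (d + 1)⌋₊ with hk
    have hms : 0 ≤ m * s ^ (d + 1) := by positivity
    have hlt : s < w k * q := by
      refine lt_of_pow_lt_pow_left₀ (d + 1) (by have := hw1 k; positivity) ?_
      rw [mul_pow, hw]
      calc s ^ (d + 1) = m * s ^ (d + 1) * q ^ (d + 1) := by linear_combination (-s ^ (d + 1)) * hqm
        _ < (k + 1) * q ^ (d + 1) := by gcongr; exact Nat.lt_floor_add_one _
    have hyT : y ∈ T k := by
      have hfar : ∀ i, ‖z - y i‖ ≤ C * (w k * q) := fun i =>
        (hin (y i) (hyK i) (hc.1 i).ge).2.trans (by gcongr)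
      intro i
      refine ⟨mem_layer_of_inner_lt hK.pos₀ hK.ball_subset (by have := hK.pos₀; positivity) hz
        (hyK i) ?_, ?_⟩
      · calc inner ℝ (z - y i) u ≤ C * s ^ 2 := (hin (y i) (hyK i) (hc.1 i).ge).1
          _ < C * (w k * q) ^ 2 := by gcongr
          _ = C / ρ₀ * (w k * q) ^ 2 * ρ₀ := by have := hK.pos₀; field_simp
      · rw [mem_closedBall]
        have h1 := dist_triangle_left (y i) (y i₀) z
        rw [dist_eq_norm z, dist_eq_norm z] at h1
        linarith [hfar i, hfar i₀]
    refine le_trans ?_ (ENNReal.le_tsum k)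
    rw [indicator_of_mem (subset_toMeasurable _ _ hyT)]
    refine (hK.cond_closedBall_pow_le (by positivity) hvol (n - d)).trans
      (ENNReal.ofReal_le_ofReal (Real.exp_le_exp.2 (neg_le_neg ?_)))
    calc κ' * k ≤ κ' * (m * s ^ (d + 1)) := by gcongr; exact Nat.floor_le hms
      _ = ((n - d : ℕ) : ℝ) * (κ * s ^ (d + 1) / volume.real K) := by rw [hκ', hm]; ring
  have hmain := measure_facetEvent_le (r := r) S hS (ProbabilityTheory.cond volume K) (b := b) hb
  refine hmain.trans ?_
  have hint : ∫⁻ y, b y ∂π ≤ ENNReal.ofReal (C' * A * q ^ (d ^ 2 + 1)) := by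
    calc ∫⁻ y, b y ∂π = ∑' k : ℕ, ENNReal.ofReal (Real.exp (-(κ' * k))) * π (T k) := by
          rw [lintegral_tsum fun k => (measurable_const.indicator
            (measurableSet_toMeasurable _ _)).aemeasurable]
          refine tsum_congr fun k => ?_
          rw [lintegral_indicator_const (measurableSet_toMeasurable _ _), measure_toMeasurable]
      _ ≤ ∑' k : ℕ, ENNReal.ofReal (C' * q ^ (d ^ 2 + 1) *
            (Real.exp (-(κ' * k)) * ((k : ℝ) + 1) ^ d)) := by
          refine ENNReal.tsum_le_tsum fun k => ?_
          refine (mul_le_mul_right (hT k) _).trans ?_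
          rw [← ENNReal.ofReal_mul (Real.exp_pos _).le]
          refine ENNReal.ofReal_le_ofReal ?_
          -- From `d ^ 2 + 1 ≤ (d + 1) * d`; the exponential factor beats this polynomial growth.
          have h1 : w k ^ (d ^ 2 + 1) ≤ ((k : ℝ) + 1) ^ d := by
            rw [← hw k, ← pow_mul]
            exact pow_le_pow_right₀ (hw1 k) (by nlinarith)
          calc Real.exp (-(κ' * k)) * (C' * (w k * q) ^ (d ^ 2 + 1))
              = C' * q ^ (d ^ 2 + 1) * (Real.exp (-(κ' * k)) * w k ^ (d ^ 2 + 1)) := by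
                rw [mul_pow]; ring
            _ ≤ _ := by gcongr
      _ = ENNReal.ofReal (C' * A * q ^ (d ^ 2 + 1)) := by
          rw [← ENNReal.ofReal_tsum_of_nonneg (fun k => by positivity) (hsum.mul_left _),
            tsum_mul_left]
          congr 1
          ring
  refine (mul_le_mul_right hint 2).trans (le_of_eq ?_)
  rw [← ENNReal.ofReal_ofNat, ← ENNReal.ofReal_mul (by norm_num)]
  congr 1
  ring

end IsRollingBody

lemma measurableSet_facetEvent {n : ℕ} (S : Finset (Fin n)) :
    MeasurableSet (facetEvent (d := d) r S) := by
  let A : Set ((Fin n → EuclideanSpace ℝ (Fin d)) × EuclideanSpace ℝ (Fin d)) :=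
    {q | (∀ i : S, dist (q.1 i) q.2 = r) ∧ ∀ i, dist (q.1 i) q.2 ≤ r}
  let B : Set ((Fin n → EuclideanSpace ℝ (Fin d)) × EuclideanSpace ℝ (Fin d)) :=
    {q | LinearIndependent ℝ fun i : S => q.1 i - q.2}
  have hA : IsClosed A := by
    have : A = (⋂ i : S, {q | dist (q.1 i) q.2 = r}) ∩ ⋂ i, {q | dist (q.1 i) q.2 ≤ r} := by
      ext q; simp [A]
    rw [this]
    exact (isClosed_iInter fun i => isClosed_eq (by fun_prop) continuous_const).inter
      (isClosed_iInter fun i => isClosed_le (by fun_prop) continuous_const)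
  have hB : IsOpen B := isOpen_setOfPred_linearIndependent.preimage
    (f := fun q : (Fin n → EuclideanSpace ℝ (Fin d)) × EuclideanSpace ℝ (Fin d) =>
      fun i : S => q.1 i - q.2) (by fun_prop)
  convert measurableSet_exists_closed_inter_open hA hB using 1
  ext q
  constructor
  · rintro ⟨c, ⟨h1, h2⟩, h3⟩
    exact ⟨c, ⟨h1, h3⟩, h2⟩
  · rintro ⟨c, ⟨h1, h3⟩, h2⟩
    exact ⟨c, ⟨h1, h2⟩, h3⟩

lemma natCast_rpow_eq_ofReal_pow (hd : 1 ≤ d) (n : ℕ) :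
    (n : ℝ≥0∞) ^ (((d : ℝ) - 1) / ((d : ℝ) + 1)) =
      ENNReal.ofReal (((n : ℝ) ^ (((d + 1 : ℕ) : ℝ)⁻¹)) ^ (d - 1)) := by
  have hd1 : (1 : ℝ) ≤ d := by exact_mod_cast hd
  rw [← ENNReal.ofReal_natCast, ENNReal.ofReal_rpow_of_nonneg (Nat.cast_nonneg n)
    (div_nonneg (by linarith) (by linarith)), ← Real.rpow_natCast, ← Real.rpow_mul (Nat.cast_nonneg n),
    Nat.cast_sub hd]
  congr 2
  push_cast
  rw [div_eq_inv_mul]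

/-- Union bound over `d`-subsets: the powers of `τ = n ^ (1 / (d + 1))` combine to `d * (d + 1) - (d
^ 2 + 1) = d - 1`. The condition `2 * d < n` makes `n - d` comparable to `n`. -/
theorem IsRollingBody.exists_lintegral_facetCenters_le (hK : IsRollingBody K p ρ₀ ρ R)
    (hr : R < r) : ∃ C, 0 < C ∧ ∀ n : ℕ, 2 * d < n →
      ∫⁻ x, ((facetCenters r x).encard : ℝ≥0∞) ∂uniformSample K n ≤
        ENNReal.ofReal C * (n : ℝ≥0∞) ^ (((d : ℝ) - 1) / ((d : ℝ) + 1)) := by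
  have hd := hK.one_le
  obtain ⟨C, hC, hle⟩ := hK.exists_measure_facetEvent_le hr
  refine ⟨2 * C * 2 ^ (d ^ 2 + 1), by positivity, fun n hn => ?_⟩
  have hn0 : (0 : ℝ) < n := by exact_mod_cast (by omega : 0 < n)
  set m := n - d with hm
  have hm0 : (0 : ℝ) < m := by exact_mod_cast (by omega : 0 < m)
  have hmn : (n : ℝ) ≤ 2 * m := by exact_mod_cast (by omega : n ≤ 2 * m)
  set τ := (n : ℝ) ^ (((d + 1 : ℕ) : ℝ)⁻¹) with hτ
  have hτ0 : 0 < τ := by positivity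
  have hτn : τ ^ (d + 1) = n := Real.rpow_inv_natCast_pow hn0.le (by omega)
  set q := ((m : ℝ)⁻¹) ^ (((d + 1 : ℕ) : ℝ)⁻¹) with hq
  have hq0 : 0 < q := by positivity
  have hqm : q ^ (d + 1) = (m : ℝ)⁻¹ := Real.rpow_inv_natCast_pow (by positivity) (by omega)
  have hqτ : q ≤ 2 * τ⁻¹ := by
    refine le_of_pow_le_pow_left₀ (n := d + 1) (by omega) (by positivity) ?_
    rw [hqm, mul_pow, inv_pow, hτn]
    calc (m : ℝ)⁻¹ ≤ 2 ^ 1 * (n : ℝ)⁻¹ := by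
          rw [← div_eq_mul_inv, inv_le_comm₀ hm0 (by positivity), inv_div]
          linarith
      _ ≤ 2 ^ (d + 1) * (n : ℝ)⁻¹ := by
          gcongr
          · norm_num
          · omega
  calc ∫⁻ x, ((facetCenters r x).encard : ℝ≥0∞) ∂uniformSample K n
      ≤ ∫⁻ x, ∑ S ∈ Finset.powersetCard d (Finset.univ : Finset (Fin n)),
          (facetEvent r S).indicator (fun _ => 2) x ∂uniformSample K n :=
        lintegral_mono fun x => encard_facetCenters_le x
    _ = ∑ S ∈ Finset.powersetCard d (Finset.univ : Finset (Fin n)),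
          2 * uniformSample K n (facetEvent r S) := by
        rw [lintegral_finsetSum _ fun S _ => measurable_const.indicator (measurableSet_facetEvent S)]
        exact Finset.sum_congr rfl fun S _ =>
          lintegral_indicator_const (measurableSet_facetEvent S) _
    _ ≤ ∑ S ∈ Finset.powersetCard d (Finset.univ : Finset (Fin n)),
          2 * ENNReal.ofReal (C * q ^ (d ^ 2 + 1)) := by
        refine Finset.sum_le_sum fun S hS => ?_
        gcongr
        exact hle n S (Finset.mem_powersetCard.1 hS).2 q hq0 (by
          rw [hqm, inv_mul_cancel₀ hm0.ne'])
    _ = (n.choose d : ℝ≥0∞) * (2 * ENNReal.ofReal (C * q ^ (d ^ 2 + 1))) := by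
        rw [Finset.sum_const, Finset.card_powersetCard, Finset.card_univ, Fintype.card_fin,
          nsmul_eq_mul]
    _ = ENNReal.ofReal (n.choose d * (2 * (C * q ^ (d ^ 2 + 1)))) := by
        rw [ENNReal.ofReal_mul (Nat.cast_nonneg _), ENNReal.ofReal_mul zero_le_two,
          ENNReal.ofReal_natCast, ENNReal.ofReal_ofNat]
    _ ≤ ENNReal.ofReal (2 * C * 2 ^ (d ^ 2 + 1) * τ ^ (d - 1)) := by
        refine ENNReal.ofReal_le_ofReal ?_
        have h1 : (n.choose d : ℝ) ≤ (τ ^ (d + 1)) ^ d := by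
          rw [hτn]; exact_mod_cast Nat.choose_le_pow n d
        have h2 : q ^ (d ^ 2 + 1) ≤ (2 * τ⁻¹) ^ (d ^ 2 + 1) := by gcongr
        calc (n.choose d : ℝ) * (2 * (C * q ^ (d ^ 2 + 1)))
            ≤ (τ ^ (d + 1)) ^ d * (2 * (C * (2 * τ⁻¹) ^ (d ^ 2 + 1))) := by gcongr
          _ = 2 * C * 2 ^ (d ^ 2 + 1) * τ ^ (d - 1) := by
            obtain ⟨k, rfl⟩ : ∃ k, d = k + 1 := ⟨d - 1, by omega⟩
            rw [mul_pow 2, inv_pow, ← pow_mul, Nat.add_sub_cancel,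
              show (k + 1 + 1) * (k + 1) = ((k + 1) ^ 2 + 1) + k by ring, pow_add]
            field_simp
    _ = _ := by
        rw [natCast_rpow_eq_ofReal_pow hd, ← ENNReal.ofReal_mul (by positivity)]

end Uniform

/-! ### Extremal centres have spanning contact directions. -/

section Vertex

open Filter Topology

variable {V : Type*} [NormedAddCommGroup V] [InnerProductSpace ℝ V] {ι : Type*} [Finite ι]

/-- If the centre `c` can be moved along `v` to first order without leaving the balls around the
points `y i`, then it can be moved away from `w`, provided that the points `y i` at distance `r`
from `c` lie beyond `w` as seen from `c`. -/
lemma exists_move_away {y : ι → V} {c w v : V} {r δ : ℝ} (hr : 0 < r) (hδ : 0 < δ)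
    (hc : ∀ i, dist (y i) c ≤ r) (hv0 : v ≠ 0)
    (hv : ∀ i, dist (y i) c = r → inner ℝ (y i - c) v = 0)
    (hw : ∀ i, dist (y i) c = r → 0 < inner ℝ (y i - w) (w - c)) :
    ∃ c', dist c' c < δ ∧ (∀ i, dist (y i) c' ≤ r) ∧ dist c w < dist c' w := by
  -- The sign of `v` is free; it is chosen so that `w` is not approached to first order.
  obtain ⟨v, hv0, hv, hgv⟩ : ∃ v : V, v ≠ 0 ∧ (∀ i, dist (y i) c = r → inner ℝ (y i - c) v = 0) ∧
      inner ℝ (w - c) v ≤ 0 := by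
    rcases le_total (inner ℝ (w - c) v) 0 with h | h
    · exact ⟨v, hv0, hv, h⟩
    · refine ⟨-v, neg_ne_zero.2 hv0, fun i hi => ?_, ?_⟩
      · rw [inner_neg_right, hv i hi, neg_zero]
      · rw [inner_neg_right]; linarith
  set g := w - c with hg
  have hyg : ∀ i, inner ℝ (y i - c) g = inner ℝ (y i - w) g + ‖g‖ ^ 2 := by
    intro i
    rw [← real_inner_self_eq_norm_sq, ← inner_add_left, hg]
    congr 1; abel
  obtain ⟨μ, hμ, hμi⟩ : ∃ μ, ‖g‖ ^ 2 < μ ∧ ∀ i, dist (y i) c = r → μ ≤ inner ℝ (y i - c) g := by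
    have hev : ∀ᶠ μ in 𝓝[>] (‖g‖ ^ 2), ∀ i, dist (y i) c = r → μ ≤ inner ℝ (y i - c) g := by
      refine eventually_all.2 fun i => ?_
      by_cases hi : dist (y i) c = r
      · have hlt : ‖g‖ ^ 2 < inner ℝ (y i - c) g := by
          rw [hyg i]; linarith [hw i hi]
        filter_upwards [(eventually_lt_nhds hlt).filter_mono nhdsWithin_le_nhds] with μ hμ _
        exact hμ.le
      · exact Eventually.of_forall fun _ h => absurd h hi
    obtain ⟨μ, h1, h2⟩ := (hev.and self_mem_nhdsWithin).exists
    exact ⟨μ, h2, h1⟩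
  have hg2 : 0 ≤ ‖g‖ ^ 2 := sq_nonneg _
  have hv2 : 0 < ‖v‖ ^ 2 := by positivity
  -- The path is `c + ε • v + (ε ^ 2 * α) • g`. In the squared distances the coefficient of `ε ^ 2`
  -- is at most `‖v‖ ^ 2 - 2 * α * μ < 0` for contact points and equals `‖v‖ ^ 2 - 2 * α * ‖g‖ ^ 2 >
  -- 0` for `w`; this `α` lies between the two thresholds because `‖g‖ ^ 2 < μ`.
  set α := ‖v‖ ^ 2 / (‖g‖ ^ 2 + μ) with hα
  have hα0 : 0 < α := by rw [hα]; exact div_pos hv2 (by linarith)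
  have hαeq : α * (‖g‖ ^ 2 + μ) = ‖v‖ ^ 2 := div_mul_cancel₀ _ (by linarith)
  let m : ℝ → V := fun ε => c + ε • (v + (ε * α) • g)
  have hdist : ∀ (x : V) (ε : ℝ), dist x (m ε) ^ 2 = dist x c ^ 2 - 2 * ε * inner ℝ (x - c) v +
      ε ^ 2 * (‖v‖ ^ 2 - 2 * α * inner ℝ (x - c) g + ε * (2 * α * inner ℝ v g)
        + ε ^ 2 * (α ^ 2 * ‖g‖ ^ 2)) := by
    intro x ε
    rw [dist_add_smul_sq, inner_add_right, inner_smul_right, norm_add_sq_real, inner_smul_right,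
      norm_smul, mul_pow, Real.norm_eq_abs, sq_abs]
    ring
  have hm : Continuous m := by fun_prop
  have hclose : ∀ᶠ ε in 𝓝[>] (0 : ℝ), dist (m ε) c < δ := by
    have : ∀ᶠ ε in 𝓝 (0 : ℝ), dist (m ε) c < δ :=
      (hm.dist continuous_const).continuousAt.eventually_lt_const (by simpa [m] using hδ)
    exact this.filter_mono nhdsWithin_le_nhds
  have hin : ∀ᶠ ε in 𝓝[>] (0 : ℝ), ∀ i, dist (y i) (m ε) ≤ r := by
    refine eventually_all.2 fun i => ?_
    rcases (hc i).lt_or_eq with hlt | heq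
    · have : ∀ᶠ ε in 𝓝 (0 : ℝ), dist (y i) (m ε) < r :=
        (continuous_const.dist hm).continuousAt.eventually_lt_const (by simpa [m] using hlt)
      exact (this.filter_mono nhdsWithin_le_nhds).mono fun _ h => h.le
    · have hcont : Continuous fun ε : ℝ => ‖v‖ ^ 2 - 2 * α * inner ℝ (y i - c) g +
          ε * (2 * α * inner ℝ v g) + ε ^ 2 * (α ^ 2 * ‖g‖ ^ 2) := by fun_prop
      have hneg : ∀ᶠ ε in 𝓝 (0 : ℝ), ‖v‖ ^ 2 - 2 * α * inner ℝ (y i - c) g +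
          ε * (2 * α * inner ℝ v g) + ε ^ 2 * (α ^ 2 * ‖g‖ ^ 2) < 0 := by
        refine hcont.continuousAt.eventually_lt_const ?_
        have := mul_le_mul_of_nonneg_left (hμi i heq) hα0.le
        have := mul_lt_mul_of_pos_left hμ hα0
        simp only [zero_mul, add_zero, ne_eq, OfNat.ofNat_ne_zero, not_false_eq_true, zero_pow]
        linarith
      filter_upwards [hneg.filter_mono nhdsWithin_le_nhds] with ε hε
      refine abs_le_of_sq_le_sq' ?_ hr.le |>.2
      rw [hdist, heq, hv i heq]
      nlinarith [mul_nonneg (sq_nonneg ε) (neg_nonneg.2 hε.le)]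
  have hfar : ∀ᶠ ε in 𝓝[>] (0 : ℝ), dist w c < dist w (m ε) := by
    have hcont : Continuous fun ε : ℝ => ‖v‖ ^ 2 - 2 * α * inner ℝ (w - c) g +
        ε * (2 * α * inner ℝ v g) + ε ^ 2 * (α ^ 2 * ‖g‖ ^ 2) := by fun_prop
    have hpos : ∀ᶠ ε in 𝓝 (0 : ℝ), 0 < ‖v‖ ^ 2 - 2 * α * inner ℝ (w - c) g +
        ε * (2 * α * inner ℝ v g) + ε ^ 2 * (α ^ 2 * ‖g‖ ^ 2) := by
      refine hcont.continuousAt.eventually_const_lt ?_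
      have := mul_lt_mul_of_pos_left hμ hα0
      rw [← hg, real_inner_self_eq_norm_sq]
      simp only [zero_mul, add_zero, ne_eq, OfNat.ofNat_ne_zero, not_false_eq_true, zero_pow]
      linarith
    filter_upwards [hpos.filter_mono nhdsWithin_le_nhds, self_mem_nhdsWithin] with ε hε hε0
    have hε0 : 0 < ε := hε0
    refine lt_of_pow_lt_pow_left₀ 2 dist_nonneg ?_
    rw [hdist w ε, ← hg]
    have h1 := mul_pos (pow_pos hε0 2) hε
    have h2 := mul_nonneg hε0.le (neg_nonneg.2 hgv)
    rw [← hg] at h1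
    linarith
  obtain ⟨ε, h1, h2, h3⟩ := (hclose.and (hin.and hfar)).exists
  exact ⟨m ε, h1, h2, by rwa [dist_comm c w, dist_comm (m ε) w]⟩

/-- A direction orthogonal to all contact directions would permit the move of `exists_move_away`; as
`dist c c₀ < s` is strict, a small move stays among the competitors and contradicts maximality. -/
lemma span_eq_top_of_farthest [FiniteDimensional ℝ V] {y : ι → V} {c c₀ w : V} {r s : ℝ}
    (hr : 0 < r) (hc : ∀ i, dist (y i) c ≤ r) (hs : dist c c₀ < s)
    (hmax : ∀ c', dist c' c₀ ≤ s → (∀ i, dist (y i) c' ≤ r) → dist c' w ≤ dist c w)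
    (hw : ∀ i, dist (y i) c = r → 0 < inner ℝ (y i - w) (w - c)) :
    Submodule.span ℝ ((fun i => y i - c) '' {i | dist (y i) c = r}) = ⊤ := by
  by_contra hne
  obtain ⟨v, hv, hv0⟩ := Submodule.exists_mem_ne_zero_of_ne_bot
    (mt Submodule.orthogonal_eq_bot_iff.1 hne)
  obtain ⟨c', h1, h2, h3⟩ := exists_move_away hr (sub_pos.2 hs) hc hv0
    (fun i hi => (Submodule.mem_orthogonal _ _).1 hv _ (Submodule.subset_span ⟨i, hi, rfl⟩)) hw
  have h4 := hmax c' (by linarith [dist_triangle c' c c₀]) h2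
  linarith

end Vertex

/-! ### Tangential directions and the confinement inequality. -/

section LocalFacet

variable {d : ℕ}

/-- The tangential directions at a point with normal `u`, obtained by projecting the vectors of the
standard basis and their negatives. -/
noncomputable def tangentDir (u : EuclideanSpace ℝ (Fin d)) (i : Fin d × Bool) :
    EuclideanSpace ℝ (Fin d) :=
  (if i.2 then (1 : ℝ) else -1) •
    (EuclideanSpace.single i.1 (1 : ℝ) - inner ℝ (EuclideanSpace.single i.1 (1 : ℝ)) u • u)

lemma inner_tangentDir_normal {u : EuclideanSpace ℝ (Fin d)} (hu : ‖u‖ = 1) (i : Fin d × Bool) :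
    inner ℝ (tangentDir u i) u = 0 := by
  rw [tangentDir, inner_smul_left, inner_sub_left, inner_smul_left, real_inner_self_eq_norm_sq, hu]
  simp

lemma norm_tangentDir_le {u : EuclideanSpace ℝ (Fin d)} (hu : ‖u‖ = 1) (i : Fin d × Bool) :
    ‖tangentDir u i‖ ≤ 1 := by
  have h1 : ‖(if i.2 then (1 : ℝ) else -1)‖ = 1 := by split_ifs <;> simp
  rw [tangentDir, norm_smul, h1, one_mul]
  refine abs_le_of_sq_le_sq' ?_ zero_le_one |>.2
  rw [norm_sub_sq_real, inner_smul_right, norm_smul, hu, mul_one, Real.norm_eq_abs, sq_abs]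
  simp only [PiLp.norm_single, norm_one]
  nlinarith [sq_nonneg (inner ℝ (EuclideanSpace.single i.1 (1 : ℝ)) u)]

lemma exists_inner_tangentDir_ge (hd : 1 ≤ d) (u q : EuclideanSpace ℝ (Fin d)) :
    ∃ i, ‖q - inner ℝ q u • u‖ / √d ≤ inner ℝ (tangentDir u i) q := by
  set p := q - inner ℝ q u • u with hp
  have hd0 : (0 : ℝ) < d := by exact_mod_cast hd
  obtain ⟨j, -, hj⟩ : ∃ j ∈ Finset.univ, ‖p‖ ^ 2 / d ≤ p j ^ 2 := by
    refine Finset.exists_le_of_sum_le ⟨⟨0, hd⟩, Finset.mem_univ _⟩ ?_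
    rw [← EuclideanSpace.real_norm_sq_eq, Finset.sum_const, Finset.card_univ, Fintype.card_fin,
      nsmul_eq_mul, mul_div_cancel₀ _ hd0.ne']
  have hj' : ‖p‖ / √d ≤ |p j| := by
    refine abs_le_of_sq_le_sq' ?_ (abs_nonneg _) |>.2
    rwa [div_pow, Real.sq_sqrt hd0.le, sq_abs]
  have hin : ∀ s : Bool, inner ℝ (tangentDir u (j, s)) q = (if s then (1 : ℝ) else -1) * p j := by
    intro s
    have h1 : p j = inner ℝ (EuclideanSpace.single j (1 : ℝ)) p := by
      simp [EuclideanSpace.inner_single_left]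
    rw [tangentDir, inner_smul_left, conj_trivial, h1, hp, inner_sub_left, inner_smul_left,
      inner_sub_right, inner_smul_right, real_inner_comm q u, conj_trivial]
    ring
  rcases le_total 0 (p j) with h | h
  · refine ⟨(j, true), ?_⟩
    rw [hin, if_pos rfl, one_mul, ← abs_of_nonneg h]
    exact hj'
  · refine ⟨(j, false), ?_⟩
    rw [hin, if_neg (by simp), neg_one_mul, ← abs_of_nonpos h]
    exact hj'

/-- Excludes a maximising displacement of length exactly `Q = lam * t`, with tangential part `P` and
normal part `σ`: some local point would be farther than `r`. If `σ ≥ -Q / 2`, then `P ≥ Q / 2` and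
the tangential gain wins by the size of `lam`; otherwise the retreat along the normal alone
suffices. The hypothesis `hσ` comes from maximality, and small `β` makes it nearly `2 * r * σ ≤ Q ^
2`. -/
lemma confinement_arith {r A lam β t Q P σ a k : ℝ} (hr : 0 < r) (hA : 0 < A) (hk : 1 ≤ k)
    (hlam : lam = 16 * r * A * k) (hβ : 0 < β) (hβr : β ≤ r / 2) (hβlam : β * lam ^ 2 ≤ r ^ 2 * A)
    (ht : 0 < t) (ht1 : 4 * A * t ^ 2 ≤ r) (ht2 : 2 * lam * t ≤ r) (ht3 : t < 2 * r)
    (hP : 0 ≤ P) (hPQ : P ^ 2 + σ ^ 2 = Q ^ 2) (hQ : Q = lam * t)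
    (hσ : 2 * (r - β) * σ ≤ Q ^ 2) (ha0 : 0 ≤ a) (ha : a ≤ 2 * A * t ^ 2) :
    0 < Q ^ 2 - 2 * r * σ + 2 * a * σ + t * P / k - 4 * r * A * t ^ 2 := by
  have hk0 : 0 < k := by linarith
  have hlam0 : 0 < lam := by rw [hlam]; positivity
  have hQ0 : 0 < Q := by rw [hQ]; positivity
  have hPk : 0 ≤ t * P / k := by positivity
  rcases le_or_gt (-(Q / 2)) σ with h1 | h1
  · have hσ2 : σ ≤ Q / 2 := by
      by_contra hgt
      have hσ0 : 0 < σ := by linarith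
      have h2 : r * σ ≤ Q ^ 2 := by nlinarith
      have h3 : Q ≤ r / 2 := by rw [hQ]; linarith
      nlinarith
    have hPQ2 : Q / 2 ≤ P := by
      refine abs_le_of_sq_le_sq' ?_ hP |>.2
      nlinarith
    have h4 : 8 * r * A * t ^ 2 ≤ t * P / k := by
      rw [le_div_iff₀ hk0]
      have : 8 * r * A * k * t ≤ P := by
        have : 8 * r * A * k * t = Q / 2 := by rw [hQ, hlam]; ring
        linarith
      nlinarith
    have h5 : -(2 * r * A * t ^ 2) ≤ Q ^ 2 - 2 * r * σ := by
      rcases le_total σ 0 with hs | hs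
      · nlinarith [mul_nonneg hr.le (neg_nonneg.2 hs), sq_nonneg Q, mul_pos (mul_pos hr hA) (pow_pos ht 2)]
      · have h6 : r * σ ≤ Q ^ 2 := by nlinarith
        have h7 : r * (β * σ) ≤ r * (r * A * t ^ 2) := by
          calc r * (β * σ) = β * (r * σ) := by ring
            _ ≤ β * Q ^ 2 := by gcongr
            _ = β * lam ^ 2 * t ^ 2 := by rw [hQ]; ring
            _ ≤ r ^ 2 * A * t ^ 2 := by gcongr
            _ = r * (r * A * t ^ 2) := by ring
        have h8 := le_of_mul_le_mul_left h7 hr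
        nlinarith
    have h6 : -(r * A * t ^ 2) ≤ 2 * a * σ := by
      have h7 : -(a * Q) ≤ 2 * a * σ := by nlinarith
      have h8 : a * Q ≤ r * A * t ^ 2 := by
        calc a * Q ≤ 2 * A * t ^ 2 * Q := by gcongr
          _ = A * t ^ 2 * (2 * lam * t) := by rw [hQ]; ring
          _ ≤ A * t ^ 2 * r := by gcongr
          _ = r * A * t ^ 2 := by ring
      linarith
    have h7 : 0 < r * A * t ^ 2 := by positivity
    linarith
  · have h2 : r * (Q / 2) ≤ -2 * r * σ + 2 * a * σ := by nlinarith
    have h3 : 4 * r * A * t ^ 2 < r * (Q / 2) := by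
      have h4 : 8 * r * A * t ≤ Q / 2 := by
        rw [hQ, hlam]
        have : 0 ≤ r * A * t * (k - 1) := mul_nonneg (by positivity) (by linarith)
        linarith
      have h5 : 0 < r * (A * t) := by positivity
      nlinarith
    nlinarith [sq_nonneg Q]

end LocalFacet

/-! ### A facet near a given boundary point. -/

section LocalFacet

variable {d : ℕ} {K : Set (EuclideanSpace ℝ (Fin d))} {p : EuclideanSpace ℝ (Fin d)} {ρ₀ ρ R r : ℝ}

/-- Small regions below the boundary point `z` with normal `u`, one for each tangential
direction. -/
def localRegion (z u : EuclideanSpace ℝ (Fin d)) (A η t : ℝ) (i : Fin d × Bool) :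
    Set (EuclideanSpace ℝ (Fin d)) :=
  slab (z - t • tangentDir u i) u (A * t ^ 2) (2 * A * t ^ 2) (η * t)

/-- The part of `K` at depth of order `t ^ 2` and tangential distance of order `t` from `z`. -/
def localCap (K : Set (EuclideanSpace ℝ (Fin d))) (z u : EuclideanSpace ℝ (Fin d)) (C t : ℝ) :
    Set (EuclideanSpace ℝ (Fin d)) :=
  {x ∈ K | inner ℝ (z - x) u ≤ C * t ^ 2 ∧ ‖z - x‖ ≤ C * t}

lemma mem_localRegion_iff {z u y : EuclideanSpace ℝ (Fin d)} (hu : ‖u‖ = 1) {A η t : ℝ}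
    {i : Fin d × Bool} : y ∈ localRegion z u A η t i ↔
      (A * t ^ 2 ≤ inner ℝ (z - y) u ∧ inner ℝ (z - y) u ≤ 2 * A * t ^ 2) ∧
        ‖z - y - inner ℝ (z - y) u • u - t • tangentDir u i‖ ≤ η * t := by
  have h1 : inner ℝ (z - t • tangentDir u i - y) u = inner ℝ (z - y) u := by
    rw [show z - t • tangentDir u i - y = (z - y) - t • tangentDir u i by abel, inner_sub_left,
      inner_smul_left, inner_tangentDir_normal hu, mul_zero, sub_zero]
  rw [localRegion, slab, mem_ofPred_eq, h1,
    show z - t • tangentDir u i - y - inner ℝ (z - y) u • u =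
      z - y - inner ℝ (z - y) u • u - t • tangentDir u i by abel]

lemma dist_sub_smul_add_sq {z u y q : EuclideanSpace ℝ (Fin d)} (hu : ‖u‖ = 1) (r : ℝ) :
    dist y (z - r • u + q) ^ 2 = r ^ 2 + (‖q‖ ^ 2 - 2 * r * inner ℝ q u + 2 * inner ℝ (z - y) q
      + ‖z - y‖ ^ 2 - 2 * r * inner ℝ (z - y) u) := by
  rw [dist_comm, dist_eq_norm, show z - r • u + q - y = ((z - y) - r • u) + q by abel,
    norm_add_sq_real, norm_sub_sq_real (z - y), inner_sub_left (z - y), inner_smul_left,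
    inner_smul_right, norm_smul,
    hu, mul_one, Real.norm_eq_abs, sq_abs, real_inner_comm u q, conj_trivial]
  ring

lemma norm_sq_eq_inner_sq_add {u q : EuclideanSpace ℝ (Fin d)} (hu : ‖u‖ = 1) :
    ‖q - inner ℝ q u • u‖ ^ 2 + inner ℝ q u ^ 2 = ‖q‖ ^ 2 := by
  rw [norm_sub_sq_real, inner_smul_right, norm_smul, hu, mul_one, Real.norm_eq_abs, sq_abs]
  ring

/-- For each displacement `q` of the centre, the point in some local region is far away. -/
lemma exists_dist_sq_ge (hd : 1 ≤ d) {z u q : EuclideanSpace ℝ (Fin d)} (hu : ‖u‖ = 1)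
    {A t : ℝ} (hr : 0 ≤ r) (ht : 0 ≤ t) {y : Fin d × Bool → EuclideanSpace ℝ (Fin d)}
    (hy : ∀ i, y i ∈ localRegion z u A (1 / (2 * √d)) t i) :
    ∃ i a, A * t ^ 2 ≤ a ∧ a ≤ 2 * A * t ^ 2 ∧
      r ^ 2 + (‖q‖ ^ 2 - 2 * r * inner ℝ q u + 2 * a * inner ℝ q u +
        t * ‖q - inner ℝ q u • u‖ / √d - 4 * r * A * t ^ 2) ≤ dist (y i) (z - r • u + q) ^ 2 := by
  obtain ⟨i, hi⟩ := exists_inner_tangentDir_ge hd u q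
  obtain ⟨⟨h1, h2⟩, h3⟩ := (mem_localRegion_iff hu).1 (hy i)
  refine ⟨i, inner ℝ (z - y i) u, h1, h2, ?_⟩
  set a := inner ℝ (z - y i) u with ha
  set P := ‖q - inner ℝ q u • u‖ with hP
  set e := z - y i - a • u - t • tangentDir u i with he
  have hd0 : (0 : ℝ) < √d := Real.sqrt_pos.2 (by exact_mod_cast hd)
  have heu : inner ℝ e u = 0 := by
    rw [he, inner_sub_left, inner_sub_left, ← ha, inner_smul_left, inner_smul_left,
      inner_tangentDir_normal hu, real_inner_self_eq_norm_sq, hu]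
    simp
  have heq : -(1 / (2 * √d) * t * P) ≤ inner ℝ e q := by
    have h4 : inner ℝ e q = inner ℝ e (q - inner ℝ q u • u) := by
      rw [inner_sub_right, inner_smul_right, heu, mul_zero, sub_zero]
    rw [h4]
    have h5 := (abs_le.1 (abs_real_inner_le_norm e (q - inner ℝ q u • u))).1
    have h6 : ‖e‖ * P ≤ 1 / (2 * √d) * t * P := by gcongr
    linarith
  have hzy : inner ℝ (z - y i) q = a * inner ℝ q u + t * inner ℝ (tangentDir u i) q + inner ℝ e q := by
    have h4 : z - y i = a • u + t • tangentDir u i + e := by rw [he]; abel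
    calc inner ℝ (z - y i) q = inner ℝ (a • u + t • tangentDir u i + e) q := by rw [← h4]
      _ = _ := by
        rw [inner_add_left, inner_add_left, inner_smul_left, inner_smul_left, conj_trivial,
          conj_trivial, real_inner_comm u q]
  -- The tolerance `1 / (2 * √d)` of the regions costs at most half of the gain in the chosen
  -- tangential direction.
  have h7 : t * P / √d ≤ 2 * (t * inner ℝ (tangentDir u i) q + inner ℝ e q) := by
    have h8 : t * (P / √d) ≤ t * inner ℝ (tangentDir u i) q := by gcongr
    have h9 : 1 / (2 * √d) * t * P = t * (P / √d) / 2 := by field_simp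
    rw [mul_div_assoc]
    linarith
  rw [dist_sub_smul_add_sq hu, hzy, ← ha]
  have h10 : 2 * r * a ≤ 4 * r * A * t ^ 2 := by nlinarith
  nlinarith [sq_nonneg ‖z - y i‖]

/-- The tangential distance is at most `2 * t`; with `A = 4 / ρ` the depth `A * t ^ 2` suffices for
the inner ball. -/
lemma IsRollingBody.exists_localRegion_subset (hK : IsRollingBody K p ρ₀ ρ R) {A t : ℝ}
    (hA : A = 4 / ρ) (ht : 0 < t) (ht1 : t ≤ 1) (htρ : 2 * A * t ^ 2 ≤ ρ)
    {z u : EuclideanSpace ℝ (Fin d)} (hz : IsOuterNormal K z u) {i : Fin d × Bool}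
    {y : EuclideanSpace ℝ (Fin d)} (hy : y ∈ localRegion z u A (1 / (2 * √d)) t i) :
    y ∈ K ∧ ‖z - y‖ ≤ (2 * A + 2) * t := by
  have hρ := hK.pos
  have hA0 : 0 < A := by rw [hA]; positivity
  have hd1 : (1 : ℝ) ≤ √d := Real.one_le_sqrt.2 (by exact_mod_cast hK.one_le)
  obtain ⟨⟨h1, h2⟩, h3⟩ := (mem_localRegion_iff hz.norm_eq).1 hy
  set a := inner ℝ (z - y) u with ha
  have hτ : ‖z - y - a • u‖ ≤ 2 * t := by
    calc ‖z - y - a • u‖ = ‖(z - y - a • u - t • tangentDir u i) + t • tangentDir u i‖ := by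
          rw [sub_add_cancel]
      _ ≤ 1 / (2 * √d) * t + t * 1 := by
          refine (norm_add_le _ _).trans (add_le_add h3 ?_)
          rw [norm_smul, Real.norm_eq_abs, abs_of_pos ht]
          gcongr
          exact norm_tangentDir_le hz.norm_eq i
      _ ≤ 2 * t := by
          have : 1 / (2 * √d) ≤ 1 := by rw [div_le_one (by positivity)]; linarith
          nlinarith
  have ha0 : 0 < a := lt_of_lt_of_le (by positivity) h1
  have hsq := norm_sq_eq_inner_sq_add (q := z - y) hz.norm_eq
  rw [← ha] at hsq
  have hτ2 : ‖z - y - a • u‖ ^ 2 ≤ 4 * t ^ 2 := by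
    have := pow_le_pow_left₀ (norm_nonneg _) hτ 2
    nlinarith
  constructor
  · refine hK.rolls.mem_of_norm_sq_le hρ.le hz ?_
    have h4 : 4 * t ^ 2 ≤ ρ * a := by
      have : ρ * (A * t ^ 2) = 4 * t ^ 2 := by rw [hA]; field_simp
      rw [← this]; gcongr
    rw [← ha]
    nlinarith
  · calc ‖z - y‖ = ‖(z - y - a • u) + a • u‖ := by rw [sub_add_cancel]
      _ ≤ 2 * t + a := by
          refine (norm_add_le _ _).trans (add_le_add hτ ?_)
          rw [norm_smul, hz.norm_eq, mul_one, Real.norm_eq_abs, abs_of_pos ha0]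
      _ ≤ (2 * A + 2) * t := by nlinarith [mul_pos hA0 ht]

/-- The main term `β * (r - β)` is at least `β * r / 2`, and all other terms are of order `t`. This
yields the hypothesis `hw` of `span_eq_top_of_farthest`. -/
lemma vertex_arith {r A lam β t σ α b : ℝ} (hA : 0 < A) (hlam : 0 < lam) (hβ : 0 < β)
    (hβr : β ≤ r / 2) (ht : 0 < t) (ht1 : t ≤ 1)
    (h : (β * lam + 2 * r * A + (2 * A + 2) * lam) * t < β * r / 2) (hσ : σ ≤ lam * t)
    (hα0 : 0 ≤ α) (hα : α ≤ 2 * A * t ^ 2) (hb : -((2 * A + 2) * t * (lam * t)) ≤ b) :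
    0 < β * (r - β) - β * σ - (r - β) * α + b := by
  have h1 : β * σ ≤ β * (lam * t) := by gcongr
  have ht2 : t ^ 2 ≤ t := by nlinarith
  have h2 : (r - β) * α ≤ r * (2 * A * t) := by
    calc (r - β) * α ≤ r * α := by nlinarith
      _ ≤ r * (2 * A * t) := by
        have : 2 * A * t ^ 2 ≤ 2 * A * t := by gcongr
        exact mul_le_mul_of_nonneg_left (hα.trans this) (by linarith)
  have h3 : (2 * A + 2) * t * (lam * t) ≤ (2 * A + 2) * lam * t := by
    calc (2 * A + 2) * t * (lam * t) = (2 * A + 2) * lam * t ^ 2 := by ring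
      _ ≤ _ := by gcongr
  have h4 : β * r / 2 ≤ β * (r - β) := by nlinarith
  linarith

/-- The outer ball gives `(g + 1) * S ^ 2 ≤ 2 * r * α`; the surplus `g * S ^ 2` from `r > R` absorbs
the mixed term `2 * lam * t * S`. -/
lemma cap_arith {r R A lam t σ α S g C₀ C₁ : ℝ} (hr : 0 < r) (hR : 0 < R) (hg : g = r / R - 1)
    (hg0 : 0 < g) (hlam : 0 < lam) (hC₀ : 0 ≤ C₀)
    (hC₀sq : C₀ ^ 2 = 2 / g * (lam ^ 2 + 8 * r * A + 2 * lam ^ 2 / g))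
    (hC₁ : C₁ = (lam ^ 2 + 8 * r * A + 2 * C₀ * lam + C₀ ^ 2) / (2 * r)) (ht : 0 < t)
    (hS : 0 ≤ S) (hσ : -(4 * A * t ^ 2) ≤ σ) (hSα : S ^ 2 ≤ 2 * R * α)
    (h : 0 ≤ lam ^ 2 * t ^ 2 - 2 * r * σ + 2 * (S * (lam * t)) + S ^ 2 - 2 * r * α) :
    α ≤ C₁ * t ^ 2 ∧ S ≤ C₀ * t := by
  have h1 : 2 * r * α ≤ (lam ^ 2 + 8 * r * A) * t ^ 2 + 2 * lam * t * S + S ^ 2 := by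
    have := mul_le_mul_of_nonneg_left hσ hr.le
    linarith
  have h2 : (g + 1) * S ^ 2 ≤ 2 * r * α := by
    rw [hg, sub_add_cancel, div_mul_eq_mul_div, div_le_iff₀ hR]
    have := mul_le_mul_of_nonneg_left hSα hr.le
    linarith
  have h3 : 2 * lam * t * S ≤ g * S ^ 2 / 2 + 2 * lam ^ 2 / g * t ^ 2 := by
    have h4 : g * S ^ 2 / 2 + 2 * lam ^ 2 / g * t ^ 2 - 2 * lam * t * S =
        (g * S - 2 * lam * t) ^ 2 / (2 * g) := by
      field_simp
      ring
    have h5 : 0 ≤ (g * S - 2 * lam * t) ^ 2 / (2 * g) := by positivity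
    linarith
  have h4 : S ≤ C₀ * t := by
    refine abs_le_of_sq_le_sq' ?_ (by positivity) |>.2
    rw [mul_pow, hC₀sq, mul_assoc, div_mul_eq_mul_div, le_div_iff₀ hg0]
    linarith
  refine ⟨?_, h4⟩
  rw [hC₁, div_mul_eq_mul_div, le_div_iff₀ (by positivity)]
  have h5 : 2 * lam * t * S ≤ 2 * lam * t * (C₀ * t) := by gcongr
  have h6 : S ^ 2 ≤ (C₀ * t) ^ 2 := by gcongr
  linarith

/-- The centre sought maximises the distance from `w = z - β • u` among admissible centres within
`lam * t` of `z - r • u`. Confinement makes it an interior maximiser, so its contact directions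
span. The last clause says that sample points outside the local cap cannot spoil the ball. -/
lemma IsRollingBody.exists_local_facet (hK : IsRollingBody K p ρ₀ ρ R) (hr : R < r) :
    ∃ A > 0, ∃ lam > 0, ∃ C > 0, ∃ t₀ > 0, ∀ t, 0 < t → t < t₀ → ∀ z u, IsOuterNormal K z u →
      (∀ i, localRegion z u A (1 / (2 * √d)) t i ⊆ localCap K z u C t) ∧
      ∀ y : Fin d × Bool → EuclideanSpace ℝ (Fin d), (∀ i, y i ∈ localRegion z u A (1 / (2 * √d)) t i) →
        ∃ c, dist c (z - r • u) ≤ lam * t ∧ (∀ i, dist (y i) c ≤ r) ∧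
          Submodule.span ℝ ((fun i => y i - c) '' {i | dist (y i) c = r}) = ⊤ ∧
          ∀ x ∈ K, r ≤ dist x c → x ∈ localCap K z u C t := by
  have hρ := hK.pos
  have hR := hK.pos_R
  have hr0 : 0 < r := hR.trans hr
  have hd1 : (1 : ℝ) ≤ √d := Real.one_le_sqrt.2 (by exact_mod_cast hK.one_le)
  obtain ⟨A, hA⟩ : ∃ A, A = 4 / ρ := ⟨_, rfl⟩
  have hA0 : 0 < A := by rw [hA]; positivity
  obtain ⟨lam, hlam⟩ : ∃ lam, lam = 16 * r * A * √d := ⟨_, rfl⟩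
  have hlam0 : 0 < lam := by rw [hlam]; positivity
  obtain ⟨β, hβ0, hβr, hβlam⟩ : ∃ β, 0 < β ∧ β ≤ r / 2 ∧ β * lam ^ 2 ≤ r ^ 2 * A := by
    refine ⟨min (r / 2) (r ^ 2 * A / lam ^ 2), by positivity, min_le_left _ _, ?_⟩
    rw [← le_div_iff₀ (by positivity)]
    exact min_le_right _ _
  set g := r / R - 1 with hg
  have hg0 : 0 < g := by
    rw [hg, sub_pos, one_lt_div hR]; exact hr
  set C₀ := √(2 / g * (lam ^ 2 + 8 * r * A + 2 * lam ^ 2 / g)) with hC₀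
  have hC₀0 : 0 ≤ C₀ := Real.sqrt_nonneg _
  have hC₀sq : C₀ ^ 2 = 2 / g * (lam ^ 2 + 8 * r * A + 2 * lam ^ 2 / g) :=
    Real.sq_sqrt (by positivity)
  set C₁ := (lam ^ 2 + 8 * r * A + 2 * C₀ * lam + C₀ ^ 2) / (2 * r) with hC₁
  have hC₁0 : 0 ≤ C₁ := by positivity
  set C := C₀ + C₁ + (2 * A + 2) with hC
  have hev : ∀ᶠ t in nhds (0 : ℝ), t < 1 ∧ 2 * A * t ^ 2 < ρ ∧ 4 * A * t ^ 2 < r ∧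
      2 * lam * t < r ∧ t < 2 * r ∧ (β * lam + 2 * r * A + (2 * A + 2) * lam) * t < β * r / 2 := by
    have key : ∀ {f : ℝ → ℝ} {b : ℝ}, Continuous f → f 0 < b → ∀ᶠ t in nhds (0 : ℝ), f t < b :=
      fun hf hb => hf.continuousAt.eventually_lt_const hb
    refine (key continuous_id zero_lt_one).and ((key (by fun_prop) (by simpa)).and
      ((key (by fun_prop) (by simpa)).and ((key (by fun_prop) (by simpa)).and
      ((key continuous_id (by simpa)).and (key (by fun_prop) ?_)))))
    rw [mul_zero]; positivity
  obtain ⟨t₀, ht₀, hall⟩ := Metric.eventually_nhds_iff.1 hev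
  refine ⟨A, hA0, lam, hlam0, C, by positivity, t₀, ht₀, fun t ht htt z u hz => ?_⟩
  obtain ⟨h1, h2, h3, h4, h5, h6⟩ := hall (y := t) (by rwa [Real.dist_0_eq_abs, abs_of_pos ht])
  have hreg : ∀ {i y}, y ∈ localRegion z u A (1 / (2 * √d)) t i → y ∈ K ∧ ‖z - y‖ ≤ (2 * A + 2) * t :=
    fun hy => hK.exists_localRegion_subset hA ht h1.le h2.le hz hy
  refine ⟨fun i y hy => ⟨(hreg hy).1, ?_, (hreg hy).2.trans ?_⟩, fun y hy => ?_⟩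
  · refine ((mem_localRegion_iff hz.norm_eq).1 hy).1.2.trans ?_
    gcongr
    linarith
  · gcongr
    linarith
  set c₀ := z - r • u with hc₀
  set w := z - β • u with hw
  let N : Set (EuclideanSpace ℝ (Fin d)) := {c | dist c c₀ ≤ lam * t ∧ ∀ i, dist (y i) c ≤ r}
  have hN : IsCompact N := by
    have hcl : IsClosed {c | ∀ i, dist (y i) c ≤ r} := by
      rw [ofPred_forall]
      exact isClosed_iInter fun i => isClosed_le (by fun_prop) continuous_const
    exact (isCompact_closedBall c₀ (lam * t)).inter_right hcl
  have hc₀N : c₀ ∈ N := by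
    refine ⟨by rw [dist_self]; positivity, fun i => ?_⟩
    have := (hK.rolls z u hz).2 (hreg (hy i)).1
    exact closedBall_sub_smul_subset hz.norm_eq hR.le hr.le this
  obtain ⟨c, hcN, hcmax⟩ := hN.exists_isMaxOn ⟨c₀, hc₀N⟩ (f := fun c => dist c w) (by fun_prop)
  have hcmax : ∀ c' ∈ N, dist c' w ≤ dist c w := hcmax
  obtain ⟨q, hq⟩ : ∃ q, q = c - c₀ := ⟨_, rfl⟩
  have hcq : c = c₀ + q := by rw [hq]; abel
  set σ := inner ℝ q u with hσ
  have hqle : ‖q‖ ≤ lam * t := by rw [hq, ← dist_eq_norm]; exact hcN.1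
  have hσabs : |σ| ≤ lam * t := by
    refine (abs_real_inner_le_norm q u).trans ?_
    rwa [hz.norm_eq, mul_one]
  have hσup : 2 * (r - β) * σ ≤ ‖q‖ ^ 2 := by
    have h7 := pow_le_pow_left₀ dist_nonneg (hcmax c₀ hc₀N) 2
    have h8 : c - w = q - (r - β) • u := by rw [hcq, hc₀, hw]; module
    have h9 : c₀ - w = -((r - β) • u) := by rw [hc₀, hw]; module
    rw [dist_eq_norm, dist_eq_norm, h8, h9, norm_neg, norm_sub_sq_real, inner_smul_right,
      ← hσ] at h7
    linarith
  have hsqq : ‖q - σ • u‖ ^ 2 + σ ^ 2 = ‖q‖ ^ 2 := norm_sq_eq_inner_sq_add hz.norm_eq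
  obtain ⟨i₀, a, ha1, ha2, hge⟩ := exists_dist_sq_ge (q := q) hK.one_le hz.norm_eq hr0.le ht.le hy
  rw [← hc₀, ← hcq, ← hσ] at hge
  have hle := hge.trans (pow_le_pow_left₀ dist_nonneg (hcN.2 i₀) 2)
  have ha0 : 0 ≤ a := le_trans (by positivity) ha1
  -- A larger retreat along `u` would leave the point `y i₀` outside the ball.
  have hσlow : -(4 * A * t ^ 2) ≤ σ := by
    by_contra hneg
    have h7 : 0 ≤ t * ‖q - σ • u‖ / √d := by positivity
    have h8 : 0 ≤ A * t ^ 2 := by positivity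
    nlinarith [sq_nonneg ‖q‖]
  have hlt : dist c c₀ < lam * t := by
    refine lt_of_le_of_ne hcN.1 fun heq => ?_
    have := confinement_arith hr0 hA0 hd1 hlam hβ0 hβr hβlam ht h3.le h4.le h5 (norm_nonneg _)
      hsqq (by rw [hq, ← dist_eq_norm]; exact heq) hσup ha0 ha2
    linarith
  refine ⟨c, hcN.1, hcN.2, span_eq_top_of_farthest hr0 hcN.2 hlt (fun c' h h' => hcmax c' ⟨h, h'⟩)
    fun i _ => ?_, fun x hx hxr => ?_⟩
  · obtain ⟨⟨h7, h8⟩, -⟩ := (mem_localRegion_iff hz.norm_eq).1 (hy i)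
    have h9 := (abs_le.1 ((abs_real_inner_le_norm (z - y i) q).trans
      (mul_le_mul (hreg (hy i)).2 hqle (norm_nonneg _) (by positivity)))).1
    have h10 : inner ℝ (y i - w) (w - c) = β * (r - β) - β * σ - (r - β) * inner ℝ (z - y i) u +
        inner ℝ (z - y i) q := by
      rw [show y i - w = β • u - (z - y i) by rw [hw]; module,
        show w - c = (r - β) • u - q by rw [hcq, hc₀, hw]; module, inner_sub_left (β • u),
        inner_sub_right, inner_sub_right, inner_smul_left, inner_smul_left, inner_smul_right,
        inner_smul_right,
        real_inner_self_eq_norm_sq, hz.norm_eq, real_inner_comm q u, ← hσ]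
      simp only [conj_trivial]
      ring
    rw [h10]
    exact vertex_arith hA0 hlam0 hβ0 hβr ht h1.le h6 ((le_abs_self _).trans hσabs)
      (le_trans (by positivity) h7) h8 h9
  · have h7 := hK.rolls.norm_sub_sq_le hR.le hz hx
    have h8 := pow_le_pow_left₀ hr0.le hxr 2
    rw [hcq, hc₀, dist_sub_smul_add_sq hz.norm_eq, ← hσ] at h8
    have h9 : inner ℝ (z - x) q ≤ ‖z - x‖ * (lam * t) :=
      (real_inner_le_norm _ _).trans (by gcongr)
    have hq2 : ‖q‖ ^ 2 ≤ lam ^ 2 * t ^ 2 := by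
      rw [← mul_pow]; exact pow_le_pow_left₀ (norm_nonneg _) hqle 2
    obtain ⟨h10, h11⟩ := cap_arith hr0 hR hg hg0 hlam0 hC₀0 hC₀sq hC₁ ht (norm_nonneg _) hσlow h7
      (by linarith)
    exact ⟨hx, h10.trans (by gcongr; linarith), h11.trans (by gcongr; linarith)⟩

end LocalFacet

/-! ### A prescribed pattern of hits. -/

section GoodEvent

/-- For independent points with law `ν`, the event that each of the subsets `D j` of `Q` is hit by
its own point and that no other point lies in `Q`. -/
lemma exists_pi_event {E ι : Type*} [MeasurableSpace E] [Fintype ι] (ν : Measure E)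
    [IsProbabilityMeasure ν] {D : ι → Set E} {Q : Set E} (hD : ∀ j, MeasurableSet (D j))
    (hQ : MeasurableSet Q) (hDQ : ∀ j, D j ⊆ Q) {a b : ℝ≥0∞} (ha : ∀ j, a ≤ ν (D j))
    (hb : b ≤ ν Qᶜ) (n : ℕ) : ∃ G : Set (Fin n → E), MeasurableSet G ∧
      (n.choose (Fintype.card ι) : ℝ≥0∞) * (a ^ Fintype.card ι * b ^ (n - Fintype.card ι)) ≤
        Measure.pi (fun _ => ν) G ∧
      ∀ x ∈ G, ∃ (S : Finset (Fin n)) (e : S ≃ ι), (∀ i : S, x i ∈ D (e i)) ∧ ∀ i ∉ S, x i ∉ Q := by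
  classical
  set N := Fintype.card ι with hN
  let 𝒮 := Finset.powersetCard N (Finset.univ : Finset (Fin n))
  have hcard : ∀ S : 𝒮, S.1.card = N := fun S => (Finset.mem_powersetCard.1 S.2).2
  let e : ∀ S : 𝒮, S.1 ≃ ι := fun S =>
    Fintype.equivOfCardEq (by rw [Fintype.card_coe, hcard S])
  let F : 𝒮 → Fin n → Set E := fun S i => if h : i ∈ S.1 then D (e S ⟨i, h⟩) else Qᶜ
  have hFD : ∀ (S : 𝒮) (i : S.1), F S i = D (e S i) := fun S i => dif_pos i.2
  have hFQ : ∀ (S : 𝒮) (i : Fin n), i ∉ S.1 → F S i = Qᶜ := fun S i hi => dif_neg hi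
  have hF : ∀ S i, MeasurableSet (F S i) := by
    intro S i
    by_cases hi : i ∈ S.1
    · rw [hFD S ⟨i, hi⟩]; exact hD _
    · rw [hFQ S i hi]; exact hQ.compl
  have hmeas : ∀ S, MeasurableSet (univ.pi (F S)) := fun S => MeasurableSet.univ_pi (hF S)
  -- The set `S` is recovered as the indices of the points in `Q`, so the events for different `S`
  -- are disjoint and their probabilities add.
  have hiff : ∀ S : 𝒮, ∀ x ∈ univ.pi (F S), ∀ i, i ∈ S.1 ↔ x i ∈ Q := by
    intro S x hx i
    have hxi := hx i (mem_univ i)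
    by_cases hi : i ∈ S.1
    · rw [hFD S ⟨i, hi⟩] at hxi
      exact ⟨fun _ => hDQ _ hxi, fun _ => hi⟩
    · rw [hFQ S i hi] at hxi
      exact ⟨fun h => absurd h hi, fun h => absurd h hxi⟩
  have hdisj : Pairwise (Function.onFun Disjoint fun S => univ.pi (F S)) := by
    intro S S' hne
    rw [Function.onFun, disjoint_left]
    intro x hx hx'
    refine hne (Subtype.ext (Finset.ext fun i => ?_))
    rw [hiff S x hx, hiff S' x hx']
  refine ⟨⋃ S, univ.pi (F S), MeasurableSet.iUnion hmeas, ?_, ?_⟩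
  · rw [measure_iUnion hdisj hmeas, tsum_fintype]
    have hle : ∀ S : 𝒮, a ^ N * b ^ (n - N) ≤ Measure.pi (fun _ => ν) (univ.pi (F S)) := by
      intro S
      rw [Measure.pi_pi, ← Finset.prod_mul_prod_compl S.1]
      refine mul_le_mul' ?_ ?_
      · rw [← hcard S]
        refine Finset.pow_card_le_prod _ _ _ fun i hi => ?_
        rw [hFD S ⟨i, hi⟩]
        exact ha _
      · have : n - N = (S.1ᶜ).card := by rw [Finset.card_compl, Fintype.card_fin, hcard S]
        rw [this]
        refine Finset.pow_card_le_prod _ _ _ fun i hi => ?_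
        rw [hFQ S i (Finset.mem_compl.1 hi)]
        exact hb
    refine le_trans (le_of_eq ?_) (Finset.sum_le_sum fun S _ => hle S)
    rw [Finset.sum_const, Finset.card_univ, Fintype.card_coe, Finset.card_powersetCard,
      Finset.card_univ, Fintype.card_fin, nsmul_eq_mul]
  · intro x hx
    obtain ⟨S, hS⟩ := mem_iUnion.1 hx
    refine ⟨S.1, e S, fun i => ?_, fun i hi => ?_⟩
    · rw [← hFD S i]
      exact hS i (mem_univ _)
    · have := hS i (mem_univ i)
      rwa [hFQ S i hi] at this

end GoodEvent

/-! ### Separated boundary points and the lower bound. -/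

section LowerBound

variable {d : ℕ} {K : Set (EuclideanSpace ℝ (Fin d))} {p : EuclideanSpace ℝ (Fin d)} {ρ₀ ρ R r : ℝ}

lemma le_volume_localRegion (hd : 1 ≤ d) {z u : EuclideanSpace ℝ (Fin d)} (hu : ‖u‖ = 1)
    {A η t : ℝ} (hA : 0 ≤ A) (hη : 0 ≤ η) (ht : 0 ≤ t) (i : Fin d × Bool) :
    ENNReal.ofReal (A * (2 * (η / √d)) ^ (d - 1) * t ^ (d + 1)) ≤
      volume (localRegion z u A η t i) := by
  refine le_trans (le_of_eq ?_) (le_volume_slab hd hu (by nlinarith [sq_nonneg t]) (by positivity))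
  congr 1
  obtain ⟨k, rfl⟩ : ∃ k, d = k + 1 := ⟨d - 1, by omega⟩
  rw [Nat.add_sub_cancel, mul_div_right_comm η t, ← mul_assoc 2 _ t, mul_pow _ t]
  ring

lemma isClosed_localCap (hK : IsClosed K) (z u : EuclideanSpace ℝ (Fin d)) (C t : ℝ) :
    IsClosed (localCap K z u C t) :=
  hK.inter ((isClosed_le (f := fun x => inner ℝ (z - x) u) (by fun_prop) continuous_const).inter
    (isClosed_le (f := fun x => ‖z - x‖) (by fun_prop) continuous_const))

namespace IsRollingBody

variable (hK : IsRollingBody K p ρ₀ ρ R)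
include hK

lemma exists_volume_localCap_le {C : ℝ} (hC : 0 < C) : ∃ C', 0 < C' ∧ ∀ t, 0 ≤ t → ∀ z u,
    IsOuterNormal K z u → volume (localCap K z u C t) ≤ ENNReal.ofReal (C' * t ^ (d + 1)) := by
  obtain ⟨C', hC', h⟩ := hK.rolls.exists_volume_nearBoundary_le hK.one_le hK.pos hK.pos_R
    (M := √C) (Real.sqrt_nonneg C)
  refine ⟨C' * √C ^ (d + 1), by positivity, fun t ht z u hz => ?_⟩
  refine (measure_mono ?_).trans ((h (√C * t) (by positivity) z).trans (le_of_eq ?_))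
  · rintro x ⟨hx, h1, h2⟩
    refine ⟨⟨hx, z, u, hz, ?_⟩, ?_⟩
    · rwa [mul_pow, Real.sq_sqrt hC.le]
    · rwa [mem_closedBall, dist_comm, dist_eq_norm, ← mul_assoc, Real.mul_self_sqrt hC.le]
  · rw [mul_pow, mul_assoc]

/-- There are many boundary points with large mutual distances. -/
lemma exists_separated {L : ℝ} (hL : 0 < L) : ∃ C, 0 < C ∧ ∀ t : ℝ, 0 < t → t < 1 → ∀ k : ℕ,
    ((k : ℝ) - 1) * t ^ (d - 1) < C → ∃ z u : Fin k → EuclideanSpace ℝ (Fin d),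
      (∀ i, IsOuterNormal K (z i) (u i)) ∧ ∀ i j, i ≠ j → L * t < ‖z i - z j‖ := by
  have hR := hK.pos_R
  have hv := hK.measureReal_pos
  set s₀ := √(2 * R) with hs₀
  have hs₀0 : 0 < s₀ := Real.sqrt_pos.2 (by positivity)
  have hs₀sq : s₀ ^ 2 = 2 * R := Real.sq_sqrt (by positivity)
  obtain ⟨C, hC, hvol⟩ := hK.rolls.exists_volume_nearBoundary_le hK.one_le hK.pos hR
    (M := (L + 2 * R) / s₀) (by positivity)
  refine ⟨volume.real K / (C * s₀ ^ (d + 1)), by positivity, fun t ht ht1 k => ?_⟩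
  induction k with
  | zero => exact fun _ => ⟨fun i => i.elim0, fun i => i.elim0, fun i => i.elim0, fun i => i.elim0⟩
  | succ k ih =>
    intro hk
    push_cast at hk
    rw [add_sub_cancel_right] at hk
    obtain ⟨z, u, hzu, hsep⟩ := ih (lt_of_le_of_lt (by gcongr; linarith) hk)
    -- Greedy choice: balls around the `k` earlier points cover volume of order `k * t ^ (d + 1)` of
    -- a layer of volume at least `t ^ 2 * volume K`. The extra `2 * R` pays for passing from `x` to
    -- its foot.
    obtain ⟨x, hx, hxfar⟩ : ∃ x ∈ layer K p (t ^ 2), ∀ i, (L + 2 * R) * t < dist x (z i) := by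
      by_contra! hcon
      have hsub : layer K p (t ^ 2) ⊆ ⋃ i : Fin k,
          nearBoundary K ((s₀ * t) ^ 2) ∩ closedBall (z i) ((L + 2 * R) / s₀ * (s₀ * t)) := by
        intro x hx
        obtain ⟨i, hi⟩ := hcon x hx
        refine mem_iUnion.2 ⟨i, ?_, ?_⟩
        · have := hK.rolls.layer_subset_nearBoundary hK.one_le hK.isCompact hK.convex
            hK.center_mem hR.le (sq_nonneg t) hx
          rwa [mul_pow, hs₀sq]
        · rwa [mem_closedBall, ← mul_assoc, div_mul_cancel₀ _ hs₀0.ne']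
      have h1 := (le_volume_layer hK.one_le hK.isCompact hK.convex hK.center_mem (sq_nonneg t)
        (by nlinarith)).trans ((measure_mono hsub).trans ((measure_iUnion_fintype_le _ _).trans
        (Finset.sum_le_sum fun i _ => hvol (s₀ * t) (by positivity) (z i))))
      rw [Finset.sum_const, Finset.card_univ, Fintype.card_fin, nsmul_eq_mul, hK.volume_eq,
        ← ENNReal.ofReal_mul (by positivity), ← ENNReal.ofReal_natCast,
        ← ENNReal.ofReal_mul (by positivity), ENNReal.ofReal_le_ofReal_iff (by positivity)] at h1
      rw [lt_div_iff₀ (by positivity)] at hk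
      have hpow : t ^ (d + 1) = t ^ (d - 1) * t ^ 2 := by
        rw [← pow_add]; congr 1; have := hK.one_le; omega
      rw [mul_pow, hpow] at h1
      have ht2 : 0 < t ^ 2 := by positivity
      nlinarith
    obtain ⟨-, z', u', hz', hi⟩ := hK.rolls.layer_subset_nearBoundary hK.one_le hK.isCompact
      hK.convex hK.center_mem hR.le (sq_nonneg t) hx
    have hnear : ‖z' - x‖ ≤ 2 * R * t := by
      refine abs_le_of_sq_le_sq' ?_ (by positivity) |>.2
      calc ‖z' - x‖ ^ 2 ≤ 2 * R * inner ℝ (z' - x) u' := hK.rolls.norm_sub_sq_le hR.le hz' hx.1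
        _ ≤ 2 * R * (2 * R * t ^ 2) := by gcongr
        _ = (2 * R * t) ^ 2 := by ring
    have hfar : ∀ i, L * t < ‖z' - z i‖ := by
      intro i
      have h1 := hxfar i
      have h2 := norm_sub_le_norm_sub_add_norm_sub x z' (z i)
      rw [dist_eq_norm] at h1
      rw [norm_sub_rev x z'] at h2
      linarith
    refine ⟨Fin.cons z' z, Fin.cons u' u, fun i => ?_, fun i j hij => ?_⟩
    · refine Fin.cases ?_ (fun i => ?_) i
      · simpa using hz'
      · simpa using hzu i
    · induction i using Fin.cases with
      | zero =>
        induction j using Fin.cases with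
        | zero => exact absurd rfl hij
        | succ j => simpa using hfar j
      | succ i =>
        induction j using Fin.cases with
        | zero =>
          rw [Fin.cons_zero, Fin.cons_succ, norm_sub_rev]
          exact hfar i
        | succ j => simpa using hsep i j (fun h => hij (by rw [h]))

/-- Near a given boundary point a facet occurs with probability bounded below. -/
lemma exists_facet_event (hr : R < r) : ∃ lam > 0, ∃ π > 0, ∃ n₀ : ℕ, ∀ n > n₀, ∀ t : ℝ, 0 < t →
    t ^ (d + 1) * n = 1 → ∀ z u, IsOuterNormal K z u →
      ∃ G : Set (Fin n → EuclideanSpace ℝ (Fin d)), MeasurableSet G ∧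
        ENNReal.ofReal π ≤ uniformSample K n G ∧
        ∀ x ∈ G, (∀ i, x i ∈ K) → ∃ c ∈ facetCenters r x, dist c (z - r • u) ≤ lam * t := by
  have := hK.isProbabilityMeasure
  have hv := hK.measureReal_pos
  have hd0 : (0 : ℝ) < √d := Real.sqrt_pos.2 (by exact_mod_cast hK.one_le)
  obtain ⟨A, hA, lam, hlam, C, hC, t₀, ht₀, hloc⟩ := hK.exists_local_facet hr
  obtain ⟨C', hC', hcap⟩ := hK.exists_volume_localCap_le hC
  set κ := A * (2 * (1 / (2 * √d) / √d)) ^ (d - 1) / volume.real K with hκ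
  have hκ0 : 0 < κ := by positivity
  set B := C' / volume.real K with hB
  have hB0 : 0 < B := by positivity
  set N := Fintype.card (Fin d × Bool) with hN
  obtain ⟨n₁, hn₁⟩ := exists_nat_gt (2 * B + 1 / t₀ ^ (d + 1))
  -- Each region has probability at least `κ / n` and the cap at most `B / n`; the bound follows
  -- from `n.choose N ≥ (n / 2) ^ N / N!` and `1 - x ≥ exp (-2 * x)` for `x ≤ 1 / 2`.
  refine ⟨lam, hlam, (κ / 2) ^ N / N.factorial * Real.exp (-(2 * B)), by positivity,
    n₁ + 2 * N, fun n hn t ht htn z u hz => ?_⟩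
  have hn0 : (0 : ℝ) < n := by exact_mod_cast (by omega : 0 < n)
  have hnn₁ : (n₁ : ℝ) ≤ n := by exact_mod_cast (by omega : n₁ ≤ n)
  have htn' : t ^ (d + 1) = 1 / n := eq_div_of_mul_eq hn0.ne' htn
  have htt₀ : t < t₀ := by
    refine lt_of_pow_lt_pow_left₀ (d + 1) ht₀.le ?_
    rw [htn', one_div_lt hn0 (by positivity)]
    linarith
  have hBn : B / n ≤ 1 / 2 := by
    rw [div_le_iff₀ hn0]
    have : 0 < 1 / t₀ ^ (d + 1) := by positivity
    linarith
  obtain ⟨hsub, hfacet⟩ := hloc t ht htt₀ z u hz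
  have ha : ∀ i, ENNReal.ofReal (κ / n) ≤
      ProbabilityTheory.cond volume K (localRegion z u A (1 / (2 * √d)) t i) := by
    intro i
    have h1 := le_volume_localRegion hK.one_le (z := z) hz.norm_eq hA.le
      (by positivity : 0 ≤ 1 / (2 * √d)) ht.le i
    rw [← inter_eq_right.2 ((hsub i).trans fun x hx => hx.1)] at h1
    refine le_trans (le_of_eq ?_) (hK.le_cond h1)
    rw [htn', hκ]
    congr 1
    ring
  have hclosed := isClosed_localCap hK.isCompact.isClosed z u C t
  have hb : ENNReal.ofReal (1 - B / n) ≤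
      ProbabilityTheory.cond volume K (localCap K z u C t)ᶜ := by
    rw [prob_compl_eq_one_sub hclosed.measurableSet, ENNReal.ofReal_sub _ (by positivity),
      ENNReal.ofReal_one]
    refine tsub_le_tsub_left ((hK.cond_le (hcap t ht.le z u hz)).trans (le_of_eq ?_)) _
    rw [htn', hB]
    congr 1
    ring
  obtain ⟨G, hG, hGle, hGx⟩ := exists_pi_event (ProbabilityTheory.cond volume K)
    (fun i => (isClosed_slab _ _ _ _ _).measurableSet) hclosed.measurableSet hsub ha hb n
  refine ⟨G, hG, le_trans ?_ hGle, fun x hx hxK => ?_⟩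
  · rw [← hN, ← ENNReal.ofReal_natCast, ← ENNReal.ofReal_pow (by positivity),
      ← ENNReal.ofReal_pow (by linarith), ← ENNReal.ofReal_mul (by positivity),
      ← ENNReal.ofReal_mul (by positivity)]
    refine ENNReal.ofReal_le_ofReal ?_
    have h1 : ((n : ℝ) / 2) ^ N ≤ N.factorial * n.choose N := by
      have h2 : (((n + 1 - N : ℕ) ^ N : ℕ) : ℝ) ≤ ((N.factorial * n.choose N : ℕ) : ℝ) := by
        have := Nat.pow_sub_le_descFactorial n N
        rw [Nat.descFactorial_eq_factorial_mul_choose] at this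
        exact_mod_cast this
      push_cast at h2
      refine le_trans ?_ h2
      gcongr
      rw [div_le_iff₀ two_pos]
      exact_mod_cast (by omega : n ≤ (n + 1 - N) * 2)
    have h2 : Real.exp (-(2 * B)) ≤ (1 - B / n) ^ (n - N) := by
      have h3 : Real.exp (-(2 * (B / n))) ≤ 1 - B / n := by
        rw [Real.exp_neg, inv_le_comm₀ (Real.exp_pos _) (by linarith)]
        refine le_trans ?_ (Real.add_one_le_exp _)
        rw [inv_le_iff_one_le_mul₀ (by linarith)]
        nlinarith [div_pos hB0 hn0]
      calc Real.exp (-(2 * B)) = Real.exp (-(2 * (B / n))) ^ n := by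
            rw [← Real.exp_nat_mul]; congr 1; field_simp
        _ ≤ (1 - B / n) ^ n := by gcongr
        _ ≤ (1 - B / n) ^ (n - N) :=
            pow_le_pow_of_le_one (by linarith) (by linarith [div_pos hB0 hn0]) (Nat.sub_le _ _)
    calc (κ / 2) ^ N / N.factorial * Real.exp (-(2 * B))
        = ((n : ℝ) / 2) ^ N / N.factorial * ((κ / n) ^ N * Real.exp (-(2 * B))) := by
          rw [div_mul_eq_mul_div, div_mul_eq_mul_div, ← mul_assoc, ← mul_pow]
          congr 3
          field_simp
      _ ≤ n.choose N * ((κ / n) ^ N * (1 - B / n) ^ (n - N)) := by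
          have h4 : ((n : ℝ) / 2) ^ N / N.factorial ≤ n.choose N := by
            rw [div_le_iff₀ (by positivity)]; linarith
          gcongr
  · obtain ⟨S, e, hS, hSQ⟩ := hGx x hx
    obtain ⟨c, hc1, hc2, hc3, hc4⟩ := hfacet (fun j => x (e.symm j)) fun j => by
      have := hS (e.symm j)
      rwa [e.apply_symm_apply] at this
    refine ⟨c, mem_facetCenters_of_span_eq_top (fun i => ?_) ?_, hc1⟩
    · by_cases hi : i ∈ S
      · have := hc2 (e ⟨i, hi⟩)
        rwa [e.symm_apply_apply] at this
      · by_contra! hgt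
        exact hSQ i hi (hc4 _ (hxK i) hgt.le)
    · rw [← top_le_iff, ← hc3]
      refine Submodule.span_mono ?_
      rintro _ ⟨j, hj, rfl⟩
      exact ⟨e.symm j, hj, rfl⟩

theorem exists_le_lintegral_facetCenters (hr : R < r) : ∃ C, 0 < C ∧ ∃ n₀ : ℕ, ∀ n > n₀,
    ENNReal.ofReal C * (n : ℝ≥0∞) ^ (((d : ℝ) - 1) / ((d : ℝ) + 1)) ≤
      ∫⁻ x, ((facetCenters r x).encard : ℝ≥0∞) ∂uniformSample K n := by
  classical
  have hR := hK.pos_R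
  obtain ⟨lam, hlam, π, hπ, n₀, hev⟩ := hK.exists_facet_event hr
  have hg0 : 0 < r / R - 1 := by rw [sub_pos, one_lt_div hR]; exact hr
  -- This separation puts the points `z - r • u` more than `2 * lam * t` apart, so their `lam *
  -- t`-balls are disjoint and the centres found there are distinct.
  obtain ⟨C, hC, hsep⟩ := hK.exists_separated (L := 2 * lam / (r / R - 1)) (by positivity)
  refine ⟨C * π, by positivity, n₀ + 1, fun n hn => ?_⟩
  have hn0 : (0 : ℝ) < n := by exact_mod_cast (by omega : 0 < n)
  have hn1 : (1 : ℝ) < n := by exact_mod_cast (by omega : 1 < n)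
  set τ := (n : ℝ) ^ (((d + 1 : ℕ) : ℝ)⁻¹) with hτ
  have hτ1 : 1 < τ := Real.one_lt_rpow hn1 (by positivity)
  have hτ0 : 0 < τ := by linarith
  have hτn : τ ^ (d + 1) = n := Real.rpow_inv_natCast_pow hn0.le (by omega)
  set k := ⌈C * τ ^ (d - 1)⌉₊ with hk
  obtain ⟨z, u, hzu, hzsep⟩ := hsep τ⁻¹ (by positivity) (inv_lt_one_of_one_lt₀ hτ1) k (by
    rw [inv_pow, ← div_eq_mul_inv, div_lt_iff₀ (by positivity)]
    have := Nat.ceil_lt_add_one (by positivity : 0 ≤ C * τ ^ (d - 1))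
    linarith)
  choose G hG hGle hGx using fun i => hev n (by omega) τ⁻¹ (by positivity)
    (by rw [inv_pow, hτn, inv_mul_cancel₀ hn0.ne']) (z i) (u i) (hzu i)
  have hcount : ∀ᵐ x ∂uniformSample K n, ∑ i, (G i).indicator (fun _ => (1 : ℝ≥0∞)) x ≤
      ((facetCenters r x).encard : ℝ≥0∞) := by
    filter_upwards [hK.ae_forall_mem (Fin n)] with x hx
    have hc : ∀ i, ∃ c, x ∈ G i → c ∈ facetCenters r x ∧ dist c (z i - r • u i) ≤ lam * τ⁻¹ := by
      intro i
      by_cases hi : x ∈ G i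
      · obtain ⟨c, h1, h2⟩ := hGx i x hi hx
        exact ⟨c, fun _ => ⟨h1, h2⟩⟩
      · exact ⟨0, fun h => absurd h hi⟩
    choose c hc using hc
    let I : Finset (Fin k) := Finset.univ.filter fun i => x ∈ G i
    have hI : ∀ i ∈ (I : Set (Fin k)), x ∈ G i := fun i hi => by simpa [I] using hi
    have hinj : InjOn c I := by
      intro i hi j hj hij
      by_contra hne
      have h1 := (hc i (hI i hi)).2
      have h2 := (hc j (hI j hj)).2
      rw [← hij] at h2
      have h3 := hzsep i j hne
      have h4 := hK.rolls.norm_sub_smul_sub_ge hR hr.le (hzu i) (hzu j)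
      have h5 := dist_triangle_left (z i - r • u i) (z j - r • u j) (c i)
      rw [dist_eq_norm] at h5
      have h6 := mul_lt_mul_of_pos_left h3 hg0
      rw [← mul_assoc, mul_div_cancel₀ _ hg0.ne'] at h6
      linarith
    have hle := encard_le_encard_of_injOn (fun i hi => (hc i (hI i hi)).1) hinj
    rw [encard_coe_eq_coe_finsetCard] at hle
    calc ∑ i, (G i).indicator (fun _ => (1 : ℝ≥0∞)) x = (I.card : ℝ≥0∞) := by
          rw [Finset.card_filter, Nat.cast_sum]
          refine Finset.sum_congr rfl fun i _ => ?_
          by_cases hi : x ∈ G i <;> simp [hi]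
      _ ≤ _ := by exact_mod_cast ENat.toENNReal_le.2 hle
  calc ENNReal.ofReal (C * π) * (n : ℝ≥0∞) ^ (((d : ℝ) - 1) / ((d : ℝ) + 1))
      = ENNReal.ofReal (C * τ ^ (d - 1)) * ENNReal.ofReal π := by
        rw [natCast_rpow_eq_ofReal_pow hK.one_le, ← hτ, ← ENNReal.ofReal_mul (by positivity),
          ← ENNReal.ofReal_mul (by positivity)]
        congr 1; ring
    _ ≤ (k : ℝ≥0∞) * ENNReal.ofReal π := by
        gcongr
        rw [← ENNReal.ofReal_natCast]
        exact ENNReal.ofReal_le_ofReal (Nat.le_ceil _)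
    _ ≤ ∑ i, uniformSample K n (G i) := by
        refine le_trans (le_of_eq ?_) (Finset.sum_le_sum fun i _ => hGle i)
        rw [Finset.sum_const, Finset.card_univ, Fintype.card_fin, nsmul_eq_mul]
    _ = ∫⁻ x, ∑ i, (G i).indicator (fun _ => (1 : ℝ≥0∞)) x ∂uniformSample K n := by
        rw [lintegral_finsetSum _ fun i _ => measurable_const.indicator (hG i)]
        refine Finset.sum_congr rfl fun i _ => ?_
        rw [lintegral_indicator_const (hG i), one_mul]
    _ ≤ _ := lintegral_mono_ae hcount

end IsRollingBody

end LowerBound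

/-! ### Measurability of the number of facets. -/

section Measurability

variable {d : ℕ} {r : ℝ}

lemma Set.natCast_le_encard_iff {α : Type*} {s : Set α} {k : ℕ} :
    (k : ℕ∞) ≤ s.encard ↔ ∃ c : Fin k → α, Function.Injective c ∧ ∀ j, c j ∈ s := by
  constructor
  · intro h
    obtain ⟨t, hts, htk⟩ := exists_subset_encard_eq h
    have hfin : t.Finite := finite_of_encard_eq_coe htk
    have hcard : hfin.toFinset.card = k := by
      rw [hfin.encard_eq_coe_toFinset_card] at htk
      exact_mod_cast htk
    let e := Finset.equivFinOfCardEq hcard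
    exact ⟨fun j => e.symm j, Subtype.val_injective.comp e.symm.injective,
      fun j => hts (hfin.mem_toFinset.1 (e.symm j).2)⟩
  · rintro ⟨c, hc, hcs⟩
    have h1 : (range c).encard ≤ s.encard := encard_le_encard (range_subset_iff.2 hcs)
    have h2 : (range c).encard = k := by
      rw [← image_univ, hc.encard_image, encard_univ]
      simp
    exact h2 ▸ h1

/-- Having at least `k` centres means that, for some finite choice of index sets, there is a
`k`-tuple satisfying closed conditions (contact, containment) and open ones (distinctness,
independence). -/
lemma measurable_encard_facetCenters (n : ℕ) :
    Measurable fun x : Fin n → EuclideanSpace ℝ (Fin d) =>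
      ((facetCenters r x).encard : ℝ≥0∞) := by
  have hle : ∀ k : ℕ, MeasurableSet
      {x : Fin n → EuclideanSpace ℝ (Fin d) | (k : ℕ∞) ≤ (facetCenters r x).encard} := by
    intro k
    let A : (Fin k → Finset (Fin n)) →
        Set ((Fin n → EuclideanSpace ℝ (Fin d)) × (Fin k → EuclideanSpace ℝ (Fin d))) := fun S =>
      {q | (∀ j, ∀ i : S j, dist (q.1 i) (q.2 j) = r) ∧ ∀ j i, dist (q.1 i) (q.2 j) ≤ r}
    let B : (Fin k → Finset (Fin n)) →
        Set ((Fin n → EuclideanSpace ℝ (Fin d)) × (Fin k → EuclideanSpace ℝ (Fin d))) := fun S =>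
      {q | (∀ j j', j ≠ j' → q.2 j ≠ q.2 j') ∧
        ∀ j, LinearIndependent ℝ fun i : S j => q.1 i - q.2 j}
    have hA : ∀ S, IsClosed (A S) := by
      intro S
      have : A S = (⋂ j, ⋂ i : S j, {q | dist (q.1 i) (q.2 j) = r}) ∩
          ⋂ j, ⋂ i, {q | dist (q.1 i) (q.2 j) ≤ r} := by
        ext q; simp [A]
      rw [this]
      exact (isClosed_iInter fun j => isClosed_iInter fun i =>
        isClosed_eq (by fun_prop) continuous_const).inter
        (isClosed_iInter fun j => isClosed_iInter fun i =>
          isClosed_le (by fun_prop) continuous_const)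
    have hB : ∀ S, IsOpen (B S) := by
      intro S
      have : B S = (⋂ j, ⋂ j', ⋂ _ : j ≠ j', {q | q.2 j ≠ q.2 j'}) ∩
          ⋂ j, {q | LinearIndependent ℝ fun i : S j => q.1 i - q.2 j} := by
        ext q; simp [B]
      rw [this]
      refine (isOpen_iInter_of_finite fun j => isOpen_iInter_of_finite fun j' =>
        isOpen_iInter_of_finite fun _ => isOpen_ne_fun (by fun_prop) (by fun_prop)).inter
        (isOpen_iInter_of_finite fun j => ?_)
      exact isOpen_setOfPred_linearIndependent.preimage
        (f := fun q : (Fin n → EuclideanSpace ℝ (Fin d)) × (Fin k → EuclideanSpace ℝ (Fin d)) =>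
          fun i : S j => q.1 i - q.2 j) (by fun_prop)
    have heq : {x : Fin n → EuclideanSpace ℝ (Fin d) | (k : ℕ∞) ≤ (facetCenters r x).encard} =
        ⋃ S : Fin k → Finset (Fin n), ⋃ _ : ∀ j, (S j).card = d, {x | ∃ c, (x, c) ∈ A S ∩ B S} := by
      ext x
      simp only [mem_ofPred_eq, natCast_le_encard_iff, mem_iUnion]
      constructor
      · rintro ⟨c, hc, hmem⟩
        choose hdist S hS hthrough using fun j => mem_facetCenters_iff.1 (hmem j)
        exact ⟨S, hS, c, ⟨fun j => (hthrough j).1, hdist⟩,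
          fun j j' hj => hc.ne hj, fun j => (hthrough j).2⟩
      · rintro ⟨S, hS, c, ⟨h1, h2⟩, h3, h4⟩
        exact ⟨c, fun j j' h => by_contra fun hj => h3 j j' hj h,
          fun j => mem_facetCenters_iff.2 ⟨h2 j, S j, hS j, h1 j, h4 j⟩⟩
    rw [heq]
    exact MeasurableSet.iUnion fun S => MeasurableSet.iUnion fun _ =>
      measurableSet_exists_closed_inter_open (hA S) (hB S)
  have hmeas : Measurable fun x : Fin n → EuclideanSpace ℝ (Fin d) =>
      (facetCenters r x).encard := by
    rw [ENat.measurable_iff]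
    intro k
    have : (fun x : Fin n → EuclideanSpace ℝ (Fin d) => (facetCenters r x).encard) ⁻¹' {(k : ℕ∞)} =
        {x | (k : ℕ∞) ≤ (facetCenters r x).encard} \
          {x | ((k + 1 : ℕ) : ℕ∞) ≤ (facetCenters r x).encard} := by
      ext x
      simp only [mem_preimage, mem_singleton_iff, mem_sdiff, mem_ofPred_eq, not_le]
      rw [Nat.cast_add, Nat.cast_one, ENat.lt_add_one_iff (ENat.natCast_ne_top k)]
      exact ⟨fun h => ⟨h.ge, h.le⟩, fun h => le_antisymm h.2 h.1⟩
    rw [this]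
    exact (hle k).diff (hle (k + 1))
  exact Measurable.of_discrete.comp hmeas

lemma ballHull_singleton (hr : 0 < r) (p : EuclideanSpace ℝ (Fin d)) :
    ballHull r {p} = {p} := by
  refine Subset.antisymm (fun y hy => ?_) fun y hy c hc => hc hy
  by_contra hyp
  have h0 : 0 < ‖y - p‖ := norm_pos_iff.2 (sub_ne_zero.2 hyp)
  have h := hy (p - (r / ‖y - p‖) • (y - p)) (by
    rw [singleton_subset_iff, mem_closedBall, dist_eq_norm, sub_sub_cancel, norm_smul, norm_div,
      norm_norm, Real.norm_eq_abs, abs_of_pos hr, div_mul_cancel₀ _ h0.ne'])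
  rw [mem_closedBall, dist_eq_norm,
    show y - (p - (r / ‖y - p‖) • (y - p)) = (1 + r / ‖y - p‖) • (y - p) by module,
    norm_smul, Real.norm_eq_abs, abs_of_pos (by positivity), add_mul, one_mul,
    div_mul_cancel₀ _ h0.ne'] at h
  linarith

open Classical in
-- A single point needs its own count: for `d = 1` its one facet comes from two centres, so the
-- bijection with centres fails.
lemma numFacets_one (hd : 1 ≤ d) (hr : 0 < r) (x : Fin 1 → EuclideanSpace ℝ (Fin d)) :
    numFacets r x = if d = 1 then 1 else 0 := by
  have : NeZero d := ⟨by omega⟩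
  have hfac : ∀ F, F ∈ facets r ({x 0} : Set (EuclideanSpace ℝ (Fin d))) →
      F = {x 0} ∧ 0 < Measure.hausdorffMeasure ((d : ℝ) - 1) {x 0} := by
    rintro F ⟨-, ⟨c, ⟨-, y, hy, hyc⟩, rfl⟩, hpos⟩
    rw [mem_singleton_iff] at hy
    subst hy
    have h1 : ({x 0} : Set (EuclideanSpace ℝ (Fin d))) ∩ sphere c r = {x 0} :=
      inter_eq_left.2 (singleton_subset_iff.2 hyc)
    rw [h1] at hpos ⊢
    exact ⟨rfl, hpos⟩
  rw [numFacets, range_unique, ballHull_singleton hr, show (default : Fin 1) = 0 from rfl]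
  split_ifs with hd1
  · have : facets r ({x 0} : Set (EuclideanSpace ℝ (Fin d))) = {{x 0}} := by
      refine Subset.antisymm (fun F hF => (hfac F hF).1) ?_
      rw [singleton_subset_iff]
      have hsph : x 0 ∈ sphere (x 0 - EuclideanSpace.single 0 r) r := by
        rw [mem_sphere, dist_eq_norm, sub_sub_cancel, PiLp.norm_single, Real.norm_eq_abs,
          abs_of_pos hr]
      refine ⟨?_, ⟨_, ⟨singleton_subset_iff.2 (sphere_subset_closedBall hsph), x 0, rfl, hsph⟩,
        (inter_eq_left.2 (singleton_subset_iff.2 hsph)).symm⟩, ?_⟩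
      · rw [frontier, closure_singleton, interior_singleton, sdiff_empty]
      · have h0 : (d : ℝ) - 1 = 0 := by rw [hd1, Nat.cast_one, sub_self]
        rw [h0, Measure.hausdorffMeasure_zero_singleton]
        exact one_pos
    rw [this, encard_singleton, ENat.toENNReal_one]
  · have h0 : (0 : ℝ) < (d : ℝ) - 1 := by
      rw [sub_pos]
      exact_mod_cast (by omega : 1 < d)
    have := Measure.nullSingletonClass_hausdorff (EuclideanSpace ℝ (Fin d)) h0
    have : facets r ({x 0} : Set (EuclideanSpace ℝ (Fin d))) = ∅ := by
      rw [eq_empty_iff_forall_notMem]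
      intro F hF
      exact (hfac F hF).2.ne' (measure_singleton _)
    rw [this, encard_empty, ENat.toENNReal_zero]

end Measurability

/-! ### Transfer to the random sample and conclusion. -/

section RandomPoints

variable {d : ℕ} {K : Set (EuclideanSpace ℝ (Fin d))} {p : EuclideanSpace ℝ (Fin d)}
  {ρ₀ ρ R r : ℝ}

lemma IsRollingBody.exists_subset_closedBall (hK : IsRollingBody K p ρ₀ ρ R) :
    ∃ c₀, K ⊆ closedBall c₀ R := by
  have hd := hK.one_le
  have : NeZero d := ⟨by omega⟩
  obtain ⟨z, hz⟩ := hK.isCompact.exists_isOuterNormal ⟨p, hK.center_mem⟩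
    (u := EuclideanSpace.single (0 : Fin d) (1 : ℝ)) (by rw [PiLp.norm_single, norm_one])
  exact ⟨_, (hK.rolls z _ hz).2⟩

/-- Coincidence of all points is a star event of radius zero, and single points are null. -/
lemma IsRollingBody.ae_exists_ne (hK : IsRollingBody K p ρ₀ ρ R) {n : ℕ} (hn : 2 ≤ n) :
    ∀ᵐ x ∂uniformSample K n, ∃ i j, x i ≠ x j := by
  have hd := hK.one_le
  have : NeZero d := ⟨by omega⟩
  have := hK.isProbabilityMeasure
  have h0 := measure_pi_star_le (⟨0, by omega⟩ : Fin n) (ProbabilityTheory.cond volume K)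
    MeasurableSet.univ (D := 0) (b := 0) fun a => by
      rw [univ_inter, closedBall_zero]
      exact (ProbabilityTheory.cond_absolutelyContinuous (measure_singleton a)).le
  rw [Fintype.card_fin, zero_pow (by omega), mul_zero] at h0
  refine measure_mono_null (fun x hx => ?_) (le_antisymm h0 zero_le)
  simp only [mem_compl_iff, mem_ofPred_eq, not_exists, not_not] at hx
  exact fun i => ⟨mem_univ _, mem_closedBall.2 (by rw [hx i _, dist_self])⟩

lemma IsRollingBody.ae_numFacets_eq (hK : IsRollingBody K p ρ₀ ρ R) (hr : R < r) {n : ℕ}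
    (hn : 2 ≤ n) : ∀ᵐ x ∂uniformSample K n,
      numFacets r x = ((facetCenters r x).encard : ℝ≥0∞) := by
  obtain ⟨c₀, hc₀⟩ := hK.exists_subset_closedBall
  filter_upwards [hK.ae_forall_mem (Fin n), hK.ae_exists_ne hn] with x hx hne
  exact numFacets_eq_encard_facetCenters hK.one_le (hK.pos_R.trans hr) hr
    (fun i => hc₀ (hx i)) hne

lemma IsRollingBody.aemeasurable_numFacets (hK : IsRollingBody K p ρ₀ ρ R) (hr : R < r) (n : ℕ) :
    AEMeasurable (numFacets (d := d) (n := n) r) (uniformSample K n) := by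
  match n with
  | 0 => exact (Subsingleton.measurable (f := numFacets r)).aemeasurable
  | 1 =>
    have : numFacets (d := d) (n := 1) r = fun _ => if d = 1 then 1 else 0 :=
      funext fun x => by rw [numFacets_one hK.one_le (hK.pos_R.trans hr)]
    rw [this]
    exact aemeasurable_const
  | n + 2 => exact ⟨_, measurable_encard_facetCenters _, hK.ae_numFacets_eq hr (by omega)⟩

lemma IsRollingBody.sameOrder_expectedNumFacets (hK : IsRollingBody K p ρ₀ ρ R) (hr : R < r) :
    SameOrder (expectedNumFacets K r)
      (fun n : ℕ => (n : ℝ≥0∞) ^ (((d : ℝ) - 1) / ((d : ℝ) + 1))) := by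
  have hexp : ∀ n, 2 ≤ n → expectedNumFacets K r n =
      ∫⁻ x, ((facetCenters r x).encard : ℝ≥0∞) ∂uniformSample K n := fun n hn =>
    lintegral_congr_ae (hK.ae_numFacets_eq hr hn)
  have hpos : ∀ n : ℕ, 0 < n → (n : ℝ≥0∞) ^ (((d : ℝ) - 1) / ((d : ℝ) + 1)) ≠ 0 ∧
      (n : ℝ≥0∞) ^ (((d : ℝ) - 1) / ((d : ℝ) + 1)) ≠ ∞ := by
    intro n hn
    rw [natCast_rpow_eq_ofReal_pow hK.one_le]
    have : (0 : ℝ) < n := by exact_mod_cast hn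
    exact ⟨(ENNReal.ofReal_pos.2 (by positivity)).ne', ENNReal.ofReal_ne_top⟩
  constructor
  · obtain ⟨C, hC, n₀, h⟩ := hK.exists_le_lintegral_facetCenters hr
    -- The factor `2` makes the inequality strict, since the power of `n` is positive and finite;
    -- below, `C + 1` plays the same role.
    refine ⟨Real.toNNReal (2 / C), Real.toNNReal_pos.2 (by positivity), n₀ + 2, fun n hn => ?_⟩
    obtain ⟨h0, h1⟩ := hpos n (by omega)
    calc (n : ℝ≥0∞) ^ (((d : ℝ) - 1) / ((d : ℝ) + 1))
        < 2 * (n : ℝ≥0∞) ^ (((d : ℝ) - 1) / ((d : ℝ) + 1)) := by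
          rw [two_mul]; exact ENNReal.lt_add_right h1 h0
      _ = ENNReal.ofReal (2 / C) *
          (ENNReal.ofReal C * (n : ℝ≥0∞) ^ (((d : ℝ) - 1) / ((d : ℝ) + 1))) := by
          rw [← mul_assoc, ← ENNReal.ofReal_mul (by positivity), div_mul_cancel₀ _ hC.ne',
            ENNReal.ofReal_ofNat]
      _ ≤ _ := by
          rw [hexp n (by omega)]
          exact mul_le_mul_right (h n (by omega)) _
  · obtain ⟨C, hC, h⟩ := hK.exists_lintegral_facetCenters_le hr
    refine ⟨Real.toNNReal (C + 1), Real.toNNReal_pos.2 (by positivity), 2 * d + 2, fun n hn => ?_⟩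
    obtain ⟨h0, h1⟩ := hpos n (by omega)
    rw [hexp n (by omega)]
    refine (h n (by omega)).trans_lt ?_
    exact ENNReal.mul_lt_mul_left h0 h1 (ENNReal.ofReal_lt_ofReal_iff (by positivity) |>.2 (by linarith))

end RandomPoints

/-- The first conjunct says that the number of facets is a random variable, so that its
expectation is meaningful. -/
theorem theorem1p2 {d : ℕ} (hd : 1 ≤ d) (K : ConvexBody (EuclideanSpace ℝ (Fin d)))
    (hK : (interior (K : Set (EuclideanSpace ℝ (Fin d)))).Nonempty)
    (hC2 : HasC2Boundary (K : Set (EuclideanSpace ℝ (Fin d))))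
    (R : ℝ) (hR : 0 < R)
    (hslide : ∃ c : EuclideanSpace ℝ (Fin d),
      SlidesFreelyIn (K : Set (EuclideanSpace ℝ (Fin d))) (closedBall c R))
    (r : ℝ) (hr : R < r) :
    (∀ n : ℕ, AEMeasurable (numFacets (d := d) (n := n) r)
      (uniformSample (K : Set (EuclideanSpace ℝ (Fin d))) n)) ∧
    SameOrder (expectedNumFacets (K : Set (EuclideanSpace ℝ (Fin d))) r)
      (fun n : ℕ => (n : ℝ≥0∞) ^ (((d : ℝ) - 1) / ((d : ℝ) + 1))) := by
  obtain ⟨c, hc⟩ := hslide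
  obtain ⟨ρ, hρ, hρR, hrolls⟩ := hC2.exists_rollsBetween K.isCompact hR hc
  obtain ⟨p, hp⟩ := hK
  obtain ⟨ρ₀, hρ₀, hball⟩ := nhds_basis_closedBall.mem_iff.1 (mem_interior_iff_mem_nhds.1 hp)
  have hbody : IsRollingBody (K : Set (EuclideanSpace ℝ (Fin d))) p ρ₀ ρ R :=
    ⟨hd, K.isCompact, K.convex, hρ₀, hball, hrolls, hρ, hρR⟩
  exact ⟨hbody.aemeasurable_numFacets hr, hbody.sameOrder_expectedNumFacets hr⟩
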